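/- Let $N$ be a finite-dimensional smooth manifold (Hausdorff, $\sigma$-compact, without boundary), $A=C^\infty(N)$, and let $\mathcal L\to N$ be a smooth real vector bundle of finite rank carrying a transitive Lie algebroid structure, i.e. the anchor $\mathcal L\to TN$ is surjective on every fibre. Let $L=\Gamma(\mathcal L)$ be the $(\mathbb R,A)$-Lie algebra of smooth sections, which acts on $A$ through the anchor, let $p\colon L\to\mathrm{Vect}(N)$ be the induced morphism, $L'=\ker p$, $L''=p(L)$, and let $\mathbf e\colon 0\to L'\to L\to L''\to 0$ be the resulting extension of $(\mathbb R,A)$-Lie algebras. For $a\in A$ and $\alpha\in L$ let $\pi^*a$ be the pullback of $a$ to the total space $\mathcal L^*$ of the dual bundle, and let $\ell_\alpha$ be the fibrewise linear function on $\mathcal L^*$ defined by $\alpha$. Then the following hold. 1. $L''=\mathrm{Vect}(N)$. 2. The extension $\mathbf e$ splits as an extension of $A$-modules: there is an $A$-linear section $\omega\colon L''\to L$ of $p$ (a connection). For every connection $\omega$ there is a unique alternating $A$-bilinear map $\Omega\colon L''\times L''\to L'$ (its curvature) with $[\omega\alpha'',\omega\beta'']=\omega[\alpha'',\beta'']+\Omega(\alpha'',\beta'')$.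 3. The $A$-algebra map $\Phi\colon \mathcal S_A[L]\to C^\infty(\mathcal L^*)$ from the symmetric $A$-algebra on $L$ given by $a\mapsto\pi^*a$, $\alpha\mapsto\ell_\alpha$ is injective, its image consists of the smooth functions which are polynomial on the fibres with degree bounded on $N$, and this image is dense in $C^\infty(\mathcal L^*)$ for the Fréchet topology (uniform convergence of all derivatives on compact subsets of charts). 4. There is a Poisson bracket on $\mathcal S_A[L]$, the tautological one, which is the unique alternating $\mathbb R$-bilinear biderivation with $\{\alpha,\beta\}=[\alpha,\beta]$, $\{\alpha,a\}=\alpha(a)$, $\{a,b\}=0$ for $\alpha,\beta\in L$, $a,b\in A$. For every connection $\omega$ with curvature $\Omega$, this bracket is also the unique alternating $\mathbb R$-bilinear biderivation on $\mathcal S_A[L]$ with $$\{\alpha',\beta'\}=[\alpha',\beta'],\qquad \{\omega\alpha'',\omega\beta''\}=\omega[\alpha'',\beta'']+\Omega(\alpha'',\beta''),\qquad \{\omega\alpha'',\beta'\}=[\omega\alpha'',\beta'],$$ $$\{\omega\alpha'',a\}=\alpha''(a),\qquad \{\alpha',a\}=0,\qquad \{a,b\}=0$$ for $\alpha',\beta'\in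 L'$, $\alpha'',\beta''\in L''$, $a,b\in A$. 5. There is a Poisson bracket on $C^\infty(\mathcal L^*)$ which is the unique alternating $\mathbb R$-bilinear biderivation with $\{\ell_\alpha,\ell_\beta\}=\ell_{[\alpha,\beta]}$, $\{\ell_\alpha,\pi^*a\}=\pi^*(\alpha(a))$, $\{\pi^*a,\pi^*b\}=0$. For every connection $\omega$ with curvature $\Omega$, it is also the unique alternating $\mathbb R$-bilinear biderivation on $C^\infty(\mathcal L^*)$ which satisfies the identities displayed in 4, read in $C^\infty(\mathcal L^*)$ through $\alpha\mapsto\ell_\alpha$ and $a\mapsto\pi^*a$. Moreover $\Phi$ is a morphism of Poisson algebras, the bracket on $C^\infty(\mathcal L^*)$ is separately continuous for the Fréchet topology, and it is the only separately continuous $\mathbb R$-bilinear operation on $C^\infty(\mathcal L^*)$ which extends the tautological bracket along $\Phi$. -/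

import Mathlib

open scoped Manifold ContDiff

noncomputable section

namespace LieAlgd

/-! ### Poisson brackets on commutative algebras -/

/-- An alternating biderivation of a commutative `R`-algebra `P`. -/
structure SkewBiderivation (R P : Type*) [CommRing R] [CommRing P] [Algebra R P] where
  toFun : P →ₗ[R] P →ₗ[R] P
  alternating (u : P) : toFun u u = 0
  leibniz (u v w : P) : toFun u (v * w) = toFun u v * w + v * toFun u w

/-- A Poisson bracket: an alternating biderivation which satisfies the Jacobi identity. -/
structure PoissonBracket (R P : Type*) [CommRing R] [CommRing P] [Algebra R P]
    extends SkewBiderivation R P where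
  jacobi (u v w : P) :
    toFun u (toFun v w) + toFun v (toFun w u) + toFun w (toFun u v) = 0

/-! ### Extensions of Lie-Rinehart algebras, connections, curvature -/

section LieRinehart

open LieRinehartAlgebra

variable {R A L M P : Type*} [CommRing R] [CommRing A] [Algebra R A]
  [LieRing L] [LieAlgebra R L] [Module A L] [LieRingModule L A]
  [LieRing M] [LieAlgebra R M] [Module A M] [LieRingModule M A]
  [CommRing P] [Algebra R P]

/-- The kernel of a morphism of `(R, A)`-Lie algebras. -/
def ker (p : L →ₗ⁅AlgHom.id R A⁆ M) : LieRinehartSubalgebra A L where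
  carrier := {x | p x = 0}
  zero_mem' := p.toLieHom.map_zero
  add_mem' {x y} (hx : p x = 0) (hy : p y = 0) := by
    have h : p (x + y) = p x + p y := p.toLieHom.map_add x y
    change p (x + y) = 0
    rw [h, hx, hy, add_zero]
  smul_mem' a x (hx : p x = 0) := by
    have h : p (a • x) = a • p x := p.map_smul_apply a x
    change p (a • x) = 0
    rw [h, hx, smul_zero]
  lie_mem' {x y} (hx : p x = 0) (hy : p y = 0) := by
    have h : p ⁅x, y⁆ = ⁅p x, p y⁆ := p.toLieHom.map_lie x y
    change p ⁅x, y⁆ = 0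
    rw [h, hx, zero_lie]

/-- The image of a morphism of `(R, A)`-Lie algebras. -/
def range (p : L →ₗ⁅AlgHom.id R A⁆ M) : LieRinehartSubalgebra A M where
  carrier := Set.range p
  zero_mem' := ⟨0, p.toLieHom.map_zero⟩
  add_mem' := by
    rintro _ _ ⟨x, rfl⟩ ⟨y, rfl⟩
    exact ⟨x + y, p.toLieHom.map_add x y⟩
  smul_mem' := by
    rintro a _ ⟨x, rfl⟩
    exact ⟨a • x, p.map_smul_apply a x⟩
  lie_mem' := by
    rintro _ _ ⟨x, rfl⟩ ⟨y, rfl⟩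
    exact ⟨⁅x, y⁆, p.toLieHom.map_lie x y⟩

/-- A morphism `p : L → M` of `(R, A)`-Lie algebras determines the extension
`0 → ker p → L → range p → 0`. A connection for this extension is an `A`-linear section of the
projection `L → range p`. -/
def IsConnection (p : L →ₗ⁅AlgHom.id R A⁆ M) (σ : range p →ₗ[A] L) : Prop :=
  ∀ x : range p, p (σ x) = x

/-- `Ω` is the curvature of the connection `σ`: the alternating `A`-bilinear form on `range p` with
values in `ker p` such that `[σ x, σ y] = σ [x, y] + Ω (x, y)`. -/
def IsCurvature (p : L →ₗ⁅AlgHom.id R A⁆ M) (σ : range p →ₗ[A] L)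
    (Ω : range p →ₗ[A] range p →ₗ[A] ker p) : Prop :=
  (∀ x, Ω x x = 0) ∧ ∀ x y : range p, ⁅σ x, σ y⁆ = σ ⁅x, y⁆ + (Ω x y : L)

/-- Let `i : A → P` and `j : L → P` be the canonical maps into a commutative algebra `P`. The
identities which define the Poisson structure on `P` induced by the Lie-Rinehart algebra `(A, L)`. For the symmetric algebra `P = S_A[L]` this is the tautological
Poisson structure. -/
structure IsInducedBracket (i : A → P) (j : L → P) (B : SkewBiderivation R P) : Prop where
  lie_lie (x y : L) : B.toFun (j x) (j y) = j ⁅x, y⁆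
  lie_base (x : L) (a : A) : B.toFun (j x) (i a) = i ⁅x, a⁆
  base_base (a b : A) : B.toFun (i a) (i b) = 0

/-- The description of a bracket on `P` through the extension `0 → ker p → L → range p → 0`, a
connection `σ` and its curvature `Ω`. Elements `x''` of `range p` are viewed in `P` through the
connection, as `j (σ x'')`. -/
structure IsBracketOfExtension (p : L →ₗ⁅AlgHom.id R A⁆ M) (σ : range p →ₗ[A] L)
    (Ω : range p →ₗ[A] range p →ₗ[A] ker p) (i : A → P) (j : L → P)
    (B : SkewBiderivation R P) : Prop where
  ker_ker (x y : ker p) : B.toFun (j x) (j y) = j (⁅x, y⁆ : ker p)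
  range_range (x y : range p) : B.toFun (j (σ x)) (j (σ y)) = j (σ ⁅x, y⁆) + j (Ω x y)
  range_ker (x : range p) (y : ker p) : B.toFun (j (σ x)) (j y) = j ⁅σ x, (y : L)⁆
  range_base (x : range p) (a : A) : B.toFun (j (σ x)) (i a) = i ⁅x, a⁆
  ker_base (x : ker p) (a : A) : B.toFun (j x) (i a) = 0
  base_base (a b : A) : B.toFun (i a) (i b) = 0

end LieRinehart

/-! ### Sections of vector bundles -/

section Sections

variable {E : Type*} [NormedAddCommGroup E] [NormedSpace ℝ E]
  {N : Type*} [TopologicalSpace N] [ChartedSpace E N]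
  {F : Type*} [NormedAddCommGroup F] [NormedSpace ℝ F]
  {V : N → Type*} [TopologicalSpace (Bundle.TotalSpace F V)] [∀ x, TopologicalSpace (V x)]
  [∀ x, AddCommGroup (V x)] [∀ x, Module ℝ (V x)] [FiberBundle F V] [VectorBundle ℝ F V]

instance : SMul C^∞⟮𝓘(ℝ, E), N; ℝ⟯ Cₛ^∞⟮𝓘(ℝ, E); F, V⟯ :=
  ⟨fun f s => ⟨fun x => f x • s x, f.contMDiff.smul_section s.contMDiff⟩⟩

@[simp]
theorem section_smul_apply (f : C^∞⟮𝓘(ℝ, E), N; ℝ⟯) (s : Cₛ^∞⟮𝓘(ℝ, E); F, V⟯) (x : N) :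
    (f • s) x = f x • s x := rfl

/-- Smooth sections form a module over the smooth functions, by pointwise operations. -/
instance : Module C^∞⟮𝓘(ℝ, E), N; ℝ⟯ Cₛ^∞⟮𝓘(ℝ, E); F, V⟯ where
  one_smul s := by ext x; exact one_smul ℝ (s x)
  mul_smul f g s := by ext x; exact mul_smul (f x) (g x) (s x)
  smul_zero f := by ext x; exact smul_zero (f x)
  smul_add f s t := by ext x; exact smul_add (f x) (s x) (t x)
  add_smul f g s := by ext x; exact add_smul (f x) (g x) (s x)
  zero_smul s := by ext x; exact zero_smul ℝ (s x)

instance : IsScalarTower ℝ C^∞⟮𝓘(ℝ, E), N; ℝ⟯ Cₛ^∞⟮𝓘(ℝ, E); F, V⟯ where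
  smul_assoc c f s := by ext x; exact smul_assoc c (f x) (s x)

end Sections

section VectorFields

variable {E : Type*} [NormedAddCommGroup E] [NormedSpace ℝ E]
  {N : Type*} [TopologicalSpace N] [ChartedSpace E N] [IsManifold 𝓘(ℝ, E) ∞ N]

/-- The derivative of a smooth function along a smooth vector field. -/
def derivAlong (X : Cₛ^∞⟮𝓘(ℝ, E); E, (TangentSpace 𝓘(ℝ, E) : N → Type _)⟯)
    (f : C^∞⟮𝓘(ℝ, E), N; ℝ⟯) : C^∞⟮𝓘(ℝ, E), N; ℝ⟯ :=
  ⟨fun x => mvfderiv 𝓘(ℝ, E) f x (X x), by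
    have h1 : ContMDiff 𝓘(ℝ, E).tangent 𝓘(ℝ, ℝ).tangent ∞ (tangentMap 𝓘(ℝ, E) 𝓘(ℝ, ℝ) f) :=
      f.contMDiff.contMDiff_tangentMap (by simp)
    exact ((contMDiff_snd_tangentBundle_modelSpace ℝ 𝓘(ℝ, ℝ)).comp h1).comp X.contMDiff⟩

theorem derivAlong_apply (X : Cₛ^∞⟮𝓘(ℝ, E); E, (TangentSpace 𝓘(ℝ, E) : N → Type _)⟯)
    (f : C^∞⟮𝓘(ℝ, E), N; ℝ⟯) (x : N) : derivAlong X f x = mvfderiv 𝓘(ℝ, E) f x (X x) := rfl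

end VectorFields


section LieAlgebroids

variable (E : Type*) [NormedAddCommGroup E] [NormedSpace ℝ E]
  {N : Type*} [TopologicalSpace N] [ChartedSpace E N] [IsManifold 𝓘(ℝ, E) ∞ N]
  (F : Type*) [NormedAddCommGroup F] [NormedSpace ℝ F]
  (V : N → Type*) [TopologicalSpace (Bundle.TotalSpace F V)] [∀ x, TopologicalSpace (V x)]
  [∀ x, AddCommGroup (V x)] [∀ x, Module ℝ (V x)] [FiberBundle F V] [VectorBundle ℝ F V]

/-- A Lie algebroid structure on the vector bundle `V` over the manifold `N` (modelled on `E`):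
a smooth bundle map `V → TN`, the anchor, and a Lie bracket on the smooth sections of `V`, such
that the anchor is compatible with the brackets and the Leibniz rule holds. -/
class LieAlgebroid where
  anchor : Cₛ^∞⟮𝓘(ℝ, E); F →L[ℝ] E, fun x : N => V x →L[ℝ] TangentSpace 𝓘(ℝ, E) x⟯
  bracket : Cₛ^∞⟮𝓘(ℝ, E); F, V⟯ →ₗ[ℝ] Cₛ^∞⟮𝓘(ℝ, E); F, V⟯ →ₗ[ℝ] Cₛ^∞⟮𝓘(ℝ, E); F, V⟯
  bracket_self (s : Cₛ^∞⟮𝓘(ℝ, E); F, V⟯) : bracket s s = 0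
  jacobi (s t u : Cₛ^∞⟮𝓘(ℝ, E); F, V⟯) :
    bracket s (bracket t u) = bracket (bracket s t) u + bracket t (bracket s u)
  anchor_bracket (s t : Cₛ^∞⟮𝓘(ℝ, E); F, V⟯) (x : N) :
    anchor x (bracket s t x) =
      VectorField.mlieBracket 𝓘(ℝ, E) (fun y => anchor y (s y)) (fun y => anchor y (t y)) x
  leibniz (s t : Cₛ^∞⟮𝓘(ℝ, E); F, V⟯) (f : C^∞⟮𝓘(ℝ, E), N; ℝ⟯) (x : N) :
    bracket s (f • t) x = f x • bracket s t x + mvfderiv 𝓘(ℝ, E) f x (anchor x (s x)) • t x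

variable {E}

/-- The commutator formula `[X, Y] f = X (Y f) - Y (X f)` for smooth vector fields. -/
theorem mvfderiv_mlieBracket [FiniteDimensional ℝ E]
    (X Y : Cₛ^∞⟮𝓘(ℝ, E); E, (TangentSpace 𝓘(ℝ, E) : N → Type _)⟯)
    (f : C^∞⟮𝓘(ℝ, E), N; ℝ⟯) (x : N) :
    mvfderiv 𝓘(ℝ, E) f x (VectorField.mlieBracket 𝓘(ℝ, E) X Y x) =
      derivAlong X (derivAlong Y f) x - derivAlong Y (derivAlong X f) x := by
  have : CompleteSpace E := FiniteDimensional.complete ℝ E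
  have : IsManifold 𝓘(ℝ, E) (minSmoothness ℝ 3) N := by
    simp only [minSmoothness_of_isRCLikeNormedField]; infer_instance
  have : IsManifold 𝓘(ℝ, E) (minSmoothness ℝ 2) N := by
    simp only [minSmoothness_of_isRCLikeNormedField]; infer_instance
  have h2 : minSmoothness ℝ 2 ≤ ∞ := by
    simp only [minSmoothness_of_isRCLikeNormedField]; exact ENat.LEInfty.out
  by_cases hE : ∃ v : TangentSpace 𝓘(ℝ, E) x, v ≠ 0
  · obtain ⟨v, hv⟩ := hE
    -- a vector field `W`, smooth near `x`, with `W x = v`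
    let W : Π y : N, TangentSpace 𝓘(ℝ, E) y := FiberBundle.extend E v
    have hWx : W x = v := by simp [W]
    have hW : ∀ᶠ y in nhds x, CMDiffAt ∞ (T% W) y := by
      obtain ⟨u, hu, hWu⟩ := FiberBundle.exists_contMDiffOn_extend 𝓘(ℝ, E) E (k := ∞) v
      filter_upwards [eventually_mem_nhds_iff.2 hu] with y hy
      exact hWu.contMDiffAt hy
    have hf (g : C^∞⟮𝓘(ℝ, E), N; ℝ⟯) (y : N) : MDifferentiableAt 𝓘(ℝ, E) 𝓘(ℝ, ℝ) g y :=
      g.contMDiff.mdifferentiable (by simp) y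
    have hbr (Z : Cₛ^∞⟮𝓘(ℝ, E); E, (TangentSpace 𝓘(ℝ, E) : N → Type _)⟯)
        (U : Π y : N, TangentSpace 𝓘(ℝ, E) y) (y : N) (hU : CMDiffAt ∞ (T% U) y) :
        CMDiffAt ∞ (T% (VectorField.mlieBracket 𝓘(ℝ, E) Z U)) y := by
      have : IsManifold 𝓘(ℝ, E) (((⊤ : ℕ∞) : WithTop ℕ∞) + 1) N :=
        inferInstanceAs (IsManifold 𝓘(ℝ, E) ∞ N)
      exact ContMDiffAt.mlieBracket_vectorField (m := ⊤) (n := ⊤) (Z.contMDiff y) hU (by simp)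
    have key (Z Z' : Cₛ^∞⟮𝓘(ℝ, E); E, (TangentSpace 𝓘(ℝ, E) : N → Type _)⟯) :
        VectorField.mlieBracket 𝓘(ℝ, E) Z (VectorField.mlieBracket 𝓘(ℝ, E) Z' ((f : N → ℝ) • W)) x
          = derivAlong Z (derivAlong Z' f) x • v
            + derivAlong Z' f x • VectorField.mlieBracket 𝓘(ℝ, E) Z W x
            + (derivAlong Z f x • VectorField.mlieBracket 𝓘(ℝ, E) Z' W x
              + f x • VectorField.mlieBracket 𝓘(ℝ, E) Z
                  (VectorField.mlieBracket 𝓘(ℝ, E) Z' W) x) := by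
      have e : VectorField.mlieBracket 𝓘(ℝ, E) Z' ((f : N → ℝ) • W) =ᶠ[nhds x]
          ((derivAlong Z' f : N → ℝ) • W
            + (f : N → ℝ) • VectorField.mlieBracket 𝓘(ℝ, E) Z' W) := by
        filter_upwards [hW] with y hy
        exact VectorField.mlieBracket_smul_right (hf f y) (hy.mdifferentiableAt (by simp))
      have hWx' := hW.self_of_nhds
      have hd1 := hWx'.mdifferentiableAt (by simp)
      have hd2 := (hbr Z' W x hWx').mdifferentiableAt (by simp)
      refine (Filter.EventuallyEq.mlieBracket_vectorField_eq (I := 𝓘(ℝ, E)) (V := Z) (V₁ := Z)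
        (Filter.EventuallyEq.refl _ _) e).trans ?_
      rw [VectorField.mlieBracket_add_right
          (((derivAlong Z' f).contMDiff x).smul_section hWx' |>.mdifferentiableAt (by simp))
          ((f.contMDiff x).smul_section (hbr Z' W x hWx') |>.mdifferentiableAt (by simp)),
        VectorField.mlieBracket_smul_right (hf _ x) hd1,
        VectorField.mlieBracket_smul_right (hf _ x) hd2, hWx]
      rfl
    have hs (Z : Π y : N, TangentSpace 𝓘(ℝ, E) y) (hZ : CMDiffAt ∞ (T% Z) x) :
        CMDiffAt (minSmoothness ℝ 2) (T% Z) x := hZ.of_le h2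
    have hWx' := hW.self_of_nhds
    have j1 := VectorField.leibniz_identity_mlieBracket_apply (hs _ (X.contMDiff x))
      (hs _ (Y.contMDiff x)) (hs _ ((f.contMDiff x).smul_section hWx'))
    have j2 := VectorField.leibniz_identity_mlieBracket_apply (hs _ (X.contMDiff x))
      (hs _ (Y.contMDiff x)) (hs _ hWx')
    rw [key X Y, key Y X, VectorField.mlieBracket_smul_right (hf _ x)
      (hWx'.mdifferentiableAt (by simp)), hWx, j2] at j1
    have h0 : (mvfderiv 𝓘(ℝ, E) f x (VectorField.mlieBracket 𝓘(ℝ, E) X Y x) -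
      (derivAlong X (derivAlong Y f) x - derivAlong Y (derivAlong X f) x)) • v = 0 := by
      rw [sub_smul, sub_smul, sub_eq_zero]
      have := sub_eq_zero.2 j1
      rw [← sub_eq_zero, ← neg_eq_zero, ← this]
      module
    exact sub_eq_zero.1 ((smul_eq_zero.1 h0).resolve_right hv)
  · push Not at hE
    have h (g : C^∞⟮𝓘(ℝ, E), N; ℝ⟯) (v : TangentSpace 𝓘(ℝ, E) x) :
        mvfderiv 𝓘(ℝ, E) g x v = 0 := by rw [hE v, map_zero]
    rw [derivAlong_apply, derivAlong_apply, h, h, h, sub_zero]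

/-- The Lie bracket of smooth vector fields. -/
def vectorFieldBracket [FiniteDimensional ℝ E]
    (X Y : Cₛ^∞⟮𝓘(ℝ, E); E, (TangentSpace 𝓘(ℝ, E) : N → Type _)⟯) :
    Cₛ^∞⟮𝓘(ℝ, E); E, (TangentSpace 𝓘(ℝ, E) : N → Type _)⟯ :=
  ⟨VectorField.mlieBracket 𝓘(ℝ, E) X Y, by
    have : CompleteSpace E := FiniteDimensional.complete ℝ E
    have : IsManifold 𝓘(ℝ, E) (minSmoothness ℝ 2) N := by
      simp only [minSmoothness_of_isRCLikeNormedField]; infer_instance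
    have : IsManifold 𝓘(ℝ, E) (minSmoothness ℝ 3) N := by
      simp only [minSmoothness_of_isRCLikeNormedField]; infer_instance
    have : IsManifold 𝓘(ℝ, E) (((⊤ : ℕ∞) : WithTop ℕ∞) + 1) N :=
      inferInstanceAs (IsManifold 𝓘(ℝ, E) ∞ N)
    exact ContDiff.mlieBracket_vectorField (m := ⊤) (n := ⊤) X.contMDiff Y.contMDiff (by simp)⟩

/-- The tangent bundle with the Lie bracket of vector fields and with the identity as anchor. -/
instance tangentLieAlgebroid [FiniteDimensional ℝ E] :
    LieAlgebroid E E (TangentSpace 𝓘(ℝ, E) : N → Type _) where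
  anchor := ⟨fun x => ContinuousLinearMap.id ℝ (TangentSpace 𝓘(ℝ, E) x), by
    intro x
    refine (contMDiffAt_hom_bundle _).2 ⟨contMDiffAt_id, ?_⟩
    apply (contMDiffAt_const (c := ContinuousLinearMap.id ℝ E)).congr_of_eventuallyEq
    filter_upwards [(trivializationAt E (TangentSpace 𝓘(ℝ, E)) x).open_baseSet.mem_nhds
      (FiberBundle.mem_baseSet_trivializationAt' x)] with y hy
    rw [ContinuousLinearMap.inCoordinates_eq hy hy]
    ext v
    simp⟩
  bracket := LinearMap.mk₂ ℝ vectorFieldBracket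
    (fun X X' Y => by
      ext x
      exact VectorField.mlieBracket_add_left X.mdifferentiableAt X'.mdifferentiableAt)
    (fun c X Y => by
      ext x
      exact VectorField.mlieBracket_const_smul_left X.mdifferentiableAt)
    (fun X Y Y' => by
      ext x
      exact VectorField.mlieBracket_add_right Y.mdifferentiableAt Y'.mdifferentiableAt)
    (fun c X Y => by
      ext x
      exact VectorField.mlieBracket_const_smul_right Y.mdifferentiableAt)
  bracket_self X := by
    ext x
    simp [vectorFieldBracket]
  jacobi X Y Z := by
    have : CompleteSpace E := FiniteDimensional.complete ℝ E
    have : IsManifold 𝓘(ℝ, E) (minSmoothness ℝ 3) N := by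
      simp only [minSmoothness_of_isRCLikeNormedField]; infer_instance
    have h2 : minSmoothness ℝ 2 ≤ ∞ := by
      simp only [minSmoothness_of_isRCLikeNormedField]; exact ENat.LEInfty.out
    have h (W : Cₛ^∞⟮𝓘(ℝ, E); E, (TangentSpace 𝓘(ℝ, E) : N → Type _)⟯) (x : N) :=
      (W.contMDiff x).of_le h2
    ext x
    exact VectorField.leibniz_identity_mlieBracket_apply (h X x) (h Y x) (h Z x)
  anchor_bracket X Y x := rfl
  leibniz X Y f x := by
    have hf : MDifferentiableAt 𝓘(ℝ, E) 𝓘(ℝ, ℝ) f x := f.contMDiff.mdifferentiable (by simp) x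
    have : CompleteSpace E := FiniteDimensional.complete ℝ E
    exact (VectorField.mlieBracket_smul_right hf Y.mdifferentiableAt).trans (add_comm _ _)

variable {F V} [LieAlgebroid E F V]

variable (E F V) in
/-- The anchor at the point `x`. -/
def anchorAt (x : N) : V x →L[ℝ] TangentSpace 𝓘(ℝ, E) x := LieAlgebroid.anchor (F := F) x

/-- The vector field obtained from a section by applying the anchor. -/
def anchorSection (s : Cₛ^∞⟮𝓘(ℝ, E); F, V⟯) :
    Cₛ^∞⟮𝓘(ℝ, E); E, (TangentSpace 𝓘(ℝ, E) : N → Type _)⟯ :=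
  ⟨fun x => anchorAt E F V x (s x),
    ContMDiff.clm_bundle_apply (LieAlgebroid.anchor (E := E) (F := F) (V := V)).contMDiff
      s.contMDiff⟩

theorem anchorSection_apply (s : Cₛ^∞⟮𝓘(ℝ, E); F, V⟯) (x : N) :
    anchorSection s x = anchorAt E F V x (s x) := rfl

/-- The Lie ring of smooth sections of a Lie algebroid. For the tangent bundle this is the Lie ring
of smooth vector fields. -/
instance : LieRing Cₛ^∞⟮𝓘(ℝ, E); F, V⟯ where
  bracket s t := LieAlgebroid.bracket s t
  add_lie s t u := by simp
  lie_add s t u := by simp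
  lie_self s := LieAlgebroid.bracket_self s
  leibniz_lie s t u := LieAlgebroid.jacobi s t u

theorem section_lie_def (s t : Cₛ^∞⟮𝓘(ℝ, E); F, V⟯) : ⁅s, t⁆ = LieAlgebroid.bracket s t := rfl

instance : LieAlgebra ℝ Cₛ^∞⟮𝓘(ℝ, E); F, V⟯ where
  lie_smul c s t := by simp [section_lie_def]

theorem anchorSection_lie [FiniteDimensional ℝ E] (s t : Cₛ^∞⟮𝓘(ℝ, E); F, V⟯) :
    anchorSection ⁅s, t⁆ = ⁅anchorSection s, anchorSection t⁆ := by
  ext x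
  exact LieAlgebroid.anchor_bracket s t x

theorem derivAlong_lie [FiniteDimensional ℝ E]
    (X Y : Cₛ^∞⟮𝓘(ℝ, E); E, (TangentSpace 𝓘(ℝ, E) : N → Type _)⟯)
    (f : C^∞⟮𝓘(ℝ, E), N; ℝ⟯) :
    derivAlong ⁅X, Y⁆ f = derivAlong X (derivAlong Y f) - derivAlong Y (derivAlong X f) := by
  ext x
  exact mvfderiv_mlieBracket X Y f x

/-- Sections of a Lie algebroid act on smooth functions through the anchor. -/
instance [FiniteDimensional ℝ E] :
    LieRingModule Cₛ^∞⟮𝓘(ℝ, E); F, V⟯ C^∞⟮𝓘(ℝ, E), N; ℝ⟯ where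
  bracket s f := derivAlong (anchorSection s) f
  add_lie s t f := by
    ext x
    simp [derivAlong_apply, anchorSection_apply]
  lie_add s f g := by
    ext x
    have hf : MDifferentiableAt 𝓘(ℝ, E) 𝓘(ℝ, ℝ) f x := f.contMDiff.mdifferentiable (by simp) x
    have hg : MDifferentiableAt 𝓘(ℝ, E) 𝓘(ℝ, ℝ) g x := g.contMDiff.mdifferentiable (by simp) x
    exact congrArg (fun φ => φ (anchorSection s x)) (mvfderiv_add hf hg)
  leibniz_lie s t f := by
    rw [anchorSection_lie, derivAlong_lie]
    abel

theorem section_lie_apply [FiniteDimensional ℝ E] (s : Cₛ^∞⟮𝓘(ℝ, E); F, V⟯)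
    (f : C^∞⟮𝓘(ℝ, E), N; ℝ⟯) (x : N) :
    (⁅s, f⁆ : C^∞⟮𝓘(ℝ, E), N; ℝ⟯) x = mvfderiv 𝓘(ℝ, E) f x (anchorAt E F V x (s x)) := rfl

instance [FiniteDimensional ℝ E] :
    LieRinehartRing C^∞⟮𝓘(ℝ, E), N; ℝ⟯ Cₛ^∞⟮𝓘(ℝ, E); F, V⟯ where
  lie_smul_eq_mul' f g s := by
    ext x
    simp [section_lie_apply]
  leibniz_mul_right' s f g := by
    ext x
    have hf : MDifferentiableAt 𝓘(ℝ, E) 𝓘(ℝ, ℝ) f x := f.contMDiff.mdifferentiable (by simp) x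
    have hg : MDifferentiableAt 𝓘(ℝ, E) 𝓘(ℝ, ℝ) g x := g.contMDiff.mdifferentiable (by simp) x
    refine (congrArg (fun φ => φ (anchorSection s x)) (mvfderiv_mul hf hg)).trans ?_
    simp [section_lie_apply, anchorSection_apply, mul_comm]
  leibniz_smul_right' s t f := by
    ext x
    exact LieAlgebroid.leibniz s t f x

instance [FiniteDimensional ℝ E] :
    LieRinehartAlgebra ℝ C^∞⟮𝓘(ℝ, E), N; ℝ⟯ Cₛ^∞⟮𝓘(ℝ, E); F, V⟯ where
  smul_lie c s f := by
    ext x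
    simp [section_lie_apply]
  lie_smul c s f := by
    ext x
    have hf : MDifferentiableAt 𝓘(ℝ, E) 𝓘(ℝ, ℝ) f x := f.contMDiff.mdifferentiable (by simp) x
    have h := congrArg (fun φ => φ (anchorSection s x))
      (mvfderiv_smul (mdifferentiableAt_const (c := c)) hf)
    rw [mvfderiv_const] at h
    refine h.trans ?_
    simp [section_lie_apply, anchorSection_apply]

open LieRinehartAlgebra in
variable (E F V) in
/-- The anchor as a morphism from the sections of a Lie algebroid to the vector fields. -/
def anchorHom [FiniteDimensional ℝ E] : Cₛ^∞⟮𝓘(ℝ, E); F, V⟯ →ₗ⁅AlgHom.id ℝ C^∞⟮𝓘(ℝ, E), N; ℝ⟯⁆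
    Cₛ^∞⟮𝓘(ℝ, E); E, (TangentSpace 𝓘(ℝ, E) : N → Type _)⟯ where
  toFun := anchorSection
  map_add' s t := by ext x; exact map_add (anchorAt E F V x) (s x) (t x)
  map_smul' c s := by ext x; exact map_smul (anchorAt E F V x) c (s x)
  map_lie' {s t} := anchorSection_lie s t
  map_smul_apply' f s := by ext x; exact map_smul (anchorAt E F V x) (f x) (s x)
  apply_lie' f s := rfl

end LieAlgebroids

/-! ### The Fréchet topology on smooth functions -/

section Topology

variable {E : Type*} [NormedAddCommGroup E] [NormedSpace ℝ E] {H : Type*} [TopologicalSpace H]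
  {I : ModelWithCorners ℝ E H} {M : Type*} [TopologicalSpace M] [ChartedSpace H M]

/-- The Fréchet topology on the smooth functions on a manifold: uniform convergence on compact sets
in the charts, for the derivatives of all orders. -/
instance : TopologicalSpace C^∞⟮I, M; ℝ⟯ :=
  ⨅ (x : M) (k : ℕ), TopologicalSpace.induced
    (fun f => UniformOnFun.ofFun {K : Set (extChartAt I x).target | IsCompact K}
      (fun y : (extChartAt I x).target =>
        iteratedFDerivWithin ℝ k (f ∘ (extChartAt I x).symm) (extChartAt I x).target y))
    inferInstance

end Topology

/-! ### Functions on the dual of a vector bundle -/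

section Dual

variable {E : Type*} [NormedAddCommGroup E] [NormedSpace ℝ E]
  {N : Type*} [TopologicalSpace N] [ChartedSpace E N]
  {F : Type*} [NormedAddCommGroup F] [NormedSpace ℝ F]
  {V : N → Type*} [TopologicalSpace (Bundle.TotalSpace F V)] [∀ x, TopologicalSpace (V x)]
  [∀ x, AddCommGroup (V x)] [∀ x, Module ℝ (V x)] [FiberBundle F V] [VectorBundle ℝ F V]

variable (F V) in
/-- The total space of the dual of the vector bundle `V`. -/
abbrev DualBundle : Type _ :=
  Bundle.TotalSpace (F →L[ℝ] ℝ) (fun x : N => V x →L[ℝ] Bundle.Trivial N ℝ x)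

variable (E F V) in
/-- The algebra of smooth functions on the total space of the dual of the vector bundle `V`. -/
abbrev DualFunctions : Type _ :=
  C^∞⟮𝓘(ℝ, E).prod 𝓘(ℝ, F →L[ℝ] ℝ), DualBundle F V; ℝ⟯

/-- The pullback of functions along the projection of the dual bundle to the base. -/
def pullback [ContMDiffVectorBundle ∞ F V 𝓘(ℝ, E)] :
    C^∞⟮𝓘(ℝ, E), N; ℝ⟯ →ₐ[ℝ] DualFunctions E F V where
  toFun f := ⟨fun ξ => f ξ.proj, f.contMDiff.comp (Bundle.contMDiff_proj _)⟩
  map_one' := rfl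
  map_mul' _ _ := rfl
  map_zero' := rfl
  map_add' _ _ := rfl
  commutes' _ := rfl

theorem pullback_apply [ContMDiffVectorBundle ∞ F V 𝓘(ℝ, E)] (f : C^∞⟮𝓘(ℝ, E), N; ℝ⟯)
    (ξ : DualBundle F V) : pullback f ξ = f ξ.proj := rfl

/-- The fibrewise linear function on the dual bundle defined by a section. -/
def linearFunction [ContMDiffVectorBundle ∞ F V 𝓘(ℝ, E)] (s : Cₛ^∞⟮𝓘(ℝ, E); F, V⟯) :
    DualFunctions E F V :=
  ⟨fun ξ => ξ.2 (s ξ.proj), by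
    have h := ContMDiff.clm_bundle_apply (F₁ := F) (F₂ := ℝ) (E₁ := V) (E₂ := Bundle.Trivial N ℝ)
      (IM := 𝓘(ℝ, E).prod 𝓘(ℝ, F →L[ℝ] ℝ)) (IB := 𝓘(ℝ, E)) (n := ∞)
      (b := fun ξ : DualBundle F V => ξ.proj) (ϕ := fun ξ => ξ.2) (v := fun ξ => s ξ.proj)
      contMDiff_id (s.contMDiff.comp (Bundle.contMDiff_proj _))
    intro ξ
    exact (Bundle.contMDiffAt_totalSpace.1 (h ξ)).2⟩

theorem linearFunction_apply [ContMDiffVectorBundle ∞ F V 𝓘(ℝ, E)]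
    (s : Cₛ^∞⟮𝓘(ℝ, E); F, V⟯) (ξ : DualBundle F V) : linearFunction s ξ = ξ.2 (s ξ.proj) := rfl

variable (E F V) in
/-- The canonical map from the symmetric algebra of the module of sections of `V` to the smooth
functions on the dual bundle: functions on the base are pulled back, and sections are sent to the
corresponding fibrewise linear functions. -/
def symToFunctions [ContMDiffVectorBundle ∞ F V 𝓘(ℝ, E)] :
    SymmetricAlgebra C^∞⟮𝓘(ℝ, E), N; ℝ⟯ Cₛ^∞⟮𝓘(ℝ, E); F, V⟯ →ₐ[ℝ] DualFunctions E F V :=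
  letI : Algebra C^∞⟮𝓘(ℝ, E), N; ℝ⟯ (DualFunctions E F V) :=
    (pullback (E := E) (F := F) (V := V)).toRingHom.toAlgebra
  haveI : IsScalarTower ℝ C^∞⟮𝓘(ℝ, E), N; ℝ⟯ (DualFunctions E F V) :=
    IsScalarTower.of_algebraMap_eq fun _ => rfl
  AlgHom.restrictScalars ℝ (SymmetricAlgebra.lift
    { toFun := linearFunction
      map_add' := fun s t => by
        ext ξ
        exact map_add ξ.2 (s ξ.proj) (t ξ.proj)
      map_smul' := fun f s => by
        ext ξ
        exact map_smul ξ.2 (f ξ.proj) (s ξ.proj) })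

theorem symToFunctions_algebraMap [ContMDiffVectorBundle ∞ F V 𝓘(ℝ, E)]
    (f : C^∞⟮𝓘(ℝ, E), N; ℝ⟯) :
    symToFunctions E F V (algebraMap _ _ f) = pullback f := by
  let _ : Algebra C^∞⟮𝓘(ℝ, E), N; ℝ⟯ (DualFunctions E F V) :=
    (pullback (E := E) (F := F) (V := V)).toRingHom.toAlgebra
  exact AlgHom.commutes (SymmetricAlgebra.lift _) f

theorem symToFunctions_ι [ContMDiffVectorBundle ∞ F V 𝓘(ℝ, E)] (s : Cₛ^∞⟮𝓘(ℝ, E); F, V⟯) :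
    symToFunctions E F V (SymmetricAlgebra.ι _ _ s) = linearFunction s := by
  let _ : Algebra C^∞⟮𝓘(ℝ, E), N; ℝ⟯ (DualFunctions E F V) :=
    (pullback (E := E) (F := F) (V := V)).toRingHom.toAlgebra
  exact SymmetricAlgebra.lift_ι_apply _ s

/-- A smooth function on the dual bundle which is polynomial on the fibres, of bounded degree:
for some `d`, on each fibre it is a sum of homogeneous polynomials of degrees `0, …, d`. -/
def IsFibrewisePolynomial (f : DualFunctions E F V) : Prop :=
  ∃ d : ℕ, ∀ x : N, ∃ q : (k : ℕ) → MultilinearMap ℝ (fun _ : Fin k => V x →L[ℝ] ℝ) ℝ,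
    ∀ ξ : V x →L[ℝ] ℝ, f ⟨x, ξ⟩ = ∑ k ∈ Finset.range (d + 1), q k (fun _ => ξ)

end Dual

end LieAlgd

end

/-! The geometric input is that finitely many global sections span every fibre of a smooth vector
bundle over `N` (`exists_finite_spanning`). A Gram operator turns such sections s_k into smooth dual
forms c_k with α = ∑ c_k(α) s_k (`exists_dual_family`). Hence L is a retract of the free module A^J,
and the total space of the dual bundle is a smooth retract of N × ℝ^J through `covector` and
`components`. Most of the theorem is read off from this retraction.

Transitivity makes the anchors of the s_k span TN. The forms dual to them give an A-linear right
inverse of the anchor, so the image is Vect(N) and a connection exists. Curvature is tensorial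
because [ωx, ωy] and ω[x, y] have the same Leibniz defect.

The symmetric algebra embeds into A[X_k], where Φ becomes evaluation of polynomials; this gives
injectivity. A fibrewise polynomial function of bounded degree is recovered by interpolation at
finitely many fixed points of ℝ^J, so its coefficients are smooth on the base. For density, a
partition of unity reduces to functions with small compact support; a Weierstrass theorem for all
derivatives approximates these by polynomials in bundle coordinates, and such coordinates are
locally of the form π^*a + ℓ_s.

The bracket on the dual bundle is given by a global formula. Let ∇_α β = ∑ α(c_k β) s_k, with
torsion T. Then {f, g} = ∑_k (D_k f · D'_k g − D'_k f · D_k g) + ∑_{k,l} ℓ_{T(s_k, s_l)} D_k f · D_l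
g, with D_k vertical and D'_k lifting the anchor of s_k (`exists_isInducedBracket`). This bracket
preserves the image of Φ and restricts to the tautological one.

By Hadamard's lemma, a derivation of smooth functions is a first-order operator in coordinates. So a
derivation which kills all π^*a and ℓ_α is zero, which reduces uniqueness and the Jacobi identity to
generators. The same local formula makes derivations continuous, hence the bracket separately
continuous, and density then gives uniqueness of the extension. The description through a connection
is equivalent to the induced one because L = ω(L'') ⊕ L'. -/

noncomputable section

namespace LieAlgd

/-! ### Biderivations and generators -/

section Biderivations

variable {R P : Type*} [CommRing R] [CommRing P] [Algebra R P]

namespace SkewBiderivation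

theorem toFun_injective {B B' : SkewBiderivation R P} (h : B.toFun = B'.toFun) : B = B' := by
  cases B; cases B'; congr

theorem skew (B : SkewBiderivation R P) (u v : P) : B.toFun u v = -B.toFun v u := by
  have h := B.alternating (u + v)
  simp only [map_add, LinearMap.add_apply, B.alternating, zero_add, add_zero] at h
  exact eq_neg_of_add_eq_zero_right h

/-- The derivation `B u` attached to an element by a biderivation. -/
def derivation (B : SkewBiderivation R P) (u : P) : Derivation R P P :=
  Derivation.mk' (B.toFun u) fun v w => by
    rw [B.leibniz, smul_eq_mul, smul_eq_mul]; ring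

@[simp]
theorem derivation_apply (B : SkewBiderivation R P) (u v : P) :
    B.derivation u v = B.toFun u v := rfl

variable {G : Set P} (hG : ∀ D : Derivation R P P, (∀ g ∈ G, D g = 0) → D = 0)
include hG

/-- The difference of the two brackets with a fixed first argument is a derivation. Agreement on `G`
therefore spreads to the second argument, and then, by skew-symmetry, to the first. -/
theorem ext_of_generators {B B' : SkewBiderivation R P}
    (h : ∀ g ∈ G, ∀ g' ∈ G, B.toFun g g' = B'.toFun g g') : B = B' := by
  have h1 (g) (hg : g ∈ G) (v : P) : B.toFun g v = B'.toFun g v := by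
    have := hG (B.derivation g - B'.derivation g) fun g' hg' => by
      simp [h g hg g' hg']
    have := congrArg (fun D : Derivation R P P => D v) this
    simpa [sub_eq_zero] using this
  refine toFun_injective (LinearMap.ext fun u => LinearMap.ext fun v => ?_)
  have := hG (B.derivation u - B'.derivation u) fun g hg => by
    simp [B.skew u g, B'.skew u g, h1 g hg u]
  have := congrArg (fun D : Derivation R P P => D v) this
  simpa [sub_eq_zero] using this

/-- The Jacobiator is a derivation in its last argument, being the commutator of two derivations
minus a third one, and it is invariant under cyclic permutations. It can thus be killed one argument
at a time. -/
theorem jacobi_of_generators (B : SkewBiderivation R P)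
    (h : ∀ u ∈ G, ∀ v ∈ G, ∀ w ∈ G,
      B.toFun u (B.toFun v w) + B.toFun v (B.toFun w u) + B.toFun w (B.toFun u v) = 0)
    (u v w : P) :
    B.toFun u (B.toFun v w) + B.toFun v (B.toFun w u) + B.toFun w (B.toFun u v) = 0 := by
  let D (u v : P) : Derivation R P P :=
    ⁅B.derivation u, B.derivation v⁆ - B.derivation (B.toFun u v)
  have hD (u v w : P) : D u v w =
      B.toFun u (B.toFun v w) + B.toFun v (B.toFun w u) + B.toFun w (B.toFun u v) := by
    simp only [D, Derivation.sub_apply, Derivation.commutator_apply, derivation_apply]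
    rw [B.skew w u, B.skew w (B.toFun u v), map_neg]
    ring
  have hcyc (u v w : P) : D u v w = D v w u := by
    rw [hD, hD]; ring
  have h1 (u) (hu : u ∈ G) (v) (hv : v ∈ G) : D u v = 0 :=
    hG _ fun w hw => by rw [hD, h u hu v hv w hw]
  have h2 (u) (hu : u ∈ G) (w : P) : D w u = 0 :=
    hG _ fun v hv => by rw [hcyc, h1 u hu v hv]; rfl
  have h3 (v w : P) : D v w = 0 :=
    hG _ fun u hu => by rw [hcyc, h2 u hu w]; rfl
  rw [← hD, h3]; rfl

end SkewBiderivation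

end Biderivations

/-! ### Curvature and the decomposition along a connection -/

section LieRinehart

open LieRinehartAlgebra

variable {R A L M P : Type*} [CommRing R] [CommRing A] [Algebra R A]
  [LieRing L] [LieAlgebra R L] [Module A L] [LieRingModule L A]
  [LieRing M] [LieAlgebra R M] [Module A M] [LieRingModule M A]
  [CommRing P] [Algebra R P]

/-- The defining identity forces Ω(x, y) = [σx, σy] − σ[x, y], which `p` kills since it preserves
brackets. Bilinearity over `A` holds because `σ x` and `x` act alike on `A`, so the derivative terms
of the two brackets cancel. -/
theorem existsUnique_curvature [LieRinehartRing A L] [LieRinehartRing A M]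
    (p : L →ₗ⁅AlgHom.id R A⁆ M) (σ : range p →ₗ[A] L) (hσ : IsConnection p σ) :
    ∃! Ω, IsCurvature p σ Ω := by
  have hact (x : range p) (a : A) : ⁅σ x, a⁆ = ⁅x, a⁆ := by
    have := p.apply_lie a (σ x)
    rw [hσ] at this
    simpa using this
  have hker (x y : range p) : ⁅σ x, σ y⁆ - σ ⁅x, y⁆ ∈ ker p := by
    change p (⁅σ x, σ y⁆ - σ ⁅x, y⁆) = 0
    have h1 : p (⁅σ x, σ y⁆ - σ ⁅x, y⁆) = ⁅p (σ x), p (σ y)⁆ - p (σ ⁅x, y⁆) := by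
      rw [← p.toLieHom.map_lie]
      exact p.toLieHom.map_sub _ _
    rw [h1, hσ, hσ, hσ, LieRinehartSubalgebra.coe_bracket, sub_self]
  let Ω : range p →ₗ[A] range p →ₗ[A] ker p := LinearMap.mk₂ A
    (fun x y => ⟨⁅σ x, σ y⁆ - σ ⁅x, y⁆, hker x y⟩)
    (fun x x' y => Subtype.ext <| by
      simp only [map_add, add_lie, AddMemClass.coe_add]; abel)
    (fun a x y => Subtype.ext <| by
      change ⁅σ (a • x), σ y⁆ - σ ⁅a • x, y⁆ = a • (⁅σ x, σ y⁆ - σ ⁅x, y⁆)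
      -- The Leibniz rule concerns the second slot, so the brackets are reversed first.
      rw [← lie_skew (σ (a • x)), ← lie_skew (a • x), map_smul,
        LieRinehartRing.leibniz_smul_right, LieRinehartRing.leibniz_smul_right, hact,
        ← lie_skew (σ x), ← lie_skew x]
      simp only [map_neg, map_add, map_smul]
      module)
    (fun x y y' => Subtype.ext <| by
      simp only [map_add, lie_add, AddMemClass.coe_add]; abel)
    (fun a x y => Subtype.ext <| by
      change ⁅σ x, σ (a • y)⁆ - σ ⁅x, a • y⁆ = a • (⁅σ x, σ y⁆ - σ ⁅x, y⁆)
      rw [map_smul, LieRinehartRing.leibniz_smul_right, LieRinehartRing.leibniz_smul_right, hact]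
      simp only [map_add, map_smul]
      module)
  refine ⟨Ω, ⟨fun x => Subtype.ext ?_, fun x y => ?_⟩, fun Ω' h => ?_⟩
  · change ⁅σ x, σ x⁆ - σ ⁅x, x⁆ = 0
    simp
  · change _ = _ + (⁅σ x, σ y⁆ - σ ⁅x, y⁆)
    abel
  · refine LinearMap.ext fun x => LinearMap.ext fun y => Subtype.ext ?_
    change _ = ⁅σ x, σ y⁆ - σ ⁅x, y⁆
    rw [h.2]; abel

/-- Every x in `L` is σ(px) + (x − σ(px)) with the second term in the kernel. The kernel acts
trivially on `A`, and σx'' acts as x''. By additivity the six identities are the components of the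
three intrinsic ones. -/
theorem isBracketOfExtension_iff (p : L →ₗ⁅AlgHom.id R A⁆ M) (σ : range p →ₗ[A] L)
    (hσ : IsConnection p σ) (Ω : range p →ₗ[A] range p →ₗ[A] ker p) (hΩ : IsCurvature p σ Ω)
    (i : A →+ P) (j : L →+ P) (B : SkewBiderivation R P) :
    IsBracketOfExtension p σ Ω i j B ↔ IsInducedBracket i j B := by
  have hp (x : L) (a : A) : ⁅x, a⁆ = ⁅p x, a⁆ := by simpa using p.apply_lie a x
  have hact (x : range p) (a : A) : ⁅σ x, a⁆ = ⁅x, a⁆ := by rw [hp, hσ]; rfl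
  have hact' (x : ker p) (a : A) : ⁅(x : L), a⁆ = 0 := by
    rw [hp, show p x = 0 from x.2, zero_lie]
  constructor
  · intro h
    have hdec (x : L) : ∃ (x'' : range p) (x' : ker p), x = σ x'' + x' := by
      refine ⟨⟨p x, x, rfl⟩, ⟨x - σ ⟨p x, x, rfl⟩, ?_⟩, by simp⟩
      have := p.toLieHom.map_sub x (σ ⟨p x, x, rfl⟩)
      change p (x - _) = 0
      exact this.trans (sub_eq_zero.2 (hσ ⟨p x, x, rfl⟩).symm)
    have hrk := h.range_ker
    refine ⟨fun x y => ?_, fun x a => ?_, h.base_base⟩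
    · obtain ⟨x'', x', rfl⟩ := hdec x
      obtain ⟨y'', y', rfl⟩ := hdec y
      simp only [map_add, LinearMap.add_apply, add_lie, lie_add, hΩ.2]
      rw [h.range_range, h.range_ker, h.ker_ker, B.skew (j x'), h.range_ker,
        ← lie_skew (x' : L) (σ y''), map_neg]
      rfl
    · obtain ⟨x'', x', rfl⟩ := hdec x
      rw [map_add, map_add, LinearMap.add_apply, add_lie, map_add, h.range_base, h.ker_base,
        hact, hact', map_zero]
  · intro h
    refine ⟨fun x y => h.lie_lie x y, fun x y => ?_, fun x y => h.lie_lie _ _, fun x a => ?_,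
      fun x a => ?_, h.base_base⟩
    · rw [h.lie_lie, hΩ.2, map_add]
    · rw [h.lie_base, hact]
    · rw [h.lie_base, hact', map_zero]

end LieRinehart

/-! ### Uniqueness and the Jacobi identity for induced brackets -/

section Generators

variable {R A L P : Type*} [CommRing R] [CommRing A] [LieRing L] [LieRingModule L A]
  [CommRing P] [Algebra R P] (i : A →+ P) (j : L →+ P)
  (hG : ∀ D : Derivation R P P, (∀ a, D (i a) = 0) → (∀ x, D (j x) = 0) → D = 0)
include hG

theorem IsInducedBracket.unique {B B' : SkewBiderivation R P} (h : IsInducedBracket i j B)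
    (h' : IsInducedBracket i j B') : B = B' := by
  refine SkewBiderivation.ext_of_generators (G := Set.range i ∪ Set.range j)
    (fun D hD => hG D (fun a => hD _ (.inl ⟨a, rfl⟩)) fun x => hD _ (.inr ⟨x, rfl⟩)) ?_
  rintro _ (⟨a, rfl⟩ | ⟨x, rfl⟩) _ (⟨b, rfl⟩ | ⟨y, rfl⟩)
  · rw [h.base_base, h'.base_base]
  · rw [B.skew, B'.skew, h.lie_base, h'.lie_base]
  · rw [h.lie_base, h'.lie_base]
  · rw [h.lie_lie, h'.lie_lie]

theorem IsInducedBracket.jacobi {B : SkewBiderivation R P}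
    (h : IsInducedBracket i j B) (u v w : P) :
    B.toFun u (B.toFun v w) + B.toFun v (B.toFun w u) + B.toFun w (B.toFun u v) = 0 := by
  refine SkewBiderivation.jacobi_of_generators (G := Set.range i ∪ Set.range j)
    (fun D hD => hG D (fun a => hD _ (.inl ⟨a, rfl⟩)) fun x => hD _ (.inr ⟨x, rfl⟩)) B ?_ u v w
  have hb (a : A) (x : L) : B.toFun (i a) (j x) = -i ⁅x, a⁆ := by rw [B.skew, h.lie_base]
  have hxy (x y : L) (a : A) : ⁅x, ⁅y, a⁆⁆ = ⁅⁅x, y⁆, a⁆ + ⁅y, ⁅x, a⁆⁆ := leibniz_lie x y a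
  -- All terms vanish if at least two arguments come from `A`. With one function, what remains is
  -- that `L` acts on `A` by a Lie action; with none, it is the Jacobi identity of `L`.
  rintro _ (⟨a, rfl⟩ | ⟨x, rfl⟩) _ (⟨b, rfl⟩ | ⟨y, rfl⟩) _ (⟨c, rfl⟩ | ⟨z, rfl⟩) <;>
    simp only [h.base_base, h.lie_base, h.lie_lie, hb, map_neg, map_zero,
      neg_zero, add_zero]
  · rw [hxy y z, map_add]; abel
  · rw [hxy z x, map_add]; abel
  · rw [hxy x y, map_add]; abel
  · rw [← map_add, ← map_add, lie_jacobi, map_zero]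

end Generators

end LieAlgd

end

noncomputable section

namespace LieAlgd

open Filter Topology Set

/-! ### The Fréchet topology as a group topology -/

section FrechetTopology

variable {E : Type*} [NormedAddCommGroup E] [NormedSpace ℝ E] {H : Type*} [TopologicalSpace H]
  {I : ModelWithCorners ℝ E H} {M : Type*} [TopologicalSpace M] [ChartedSpace H M]

/-- The expression of a smooth function in the preferred chart at a point. -/
def chartRep (I : ModelWithCorners ℝ E H) (x : M) (f : C^∞⟮I, M; ℝ⟯) : E → ℝ :=
  f ∘ (extChartAt I x).symm

theorem chartRep_apply (x : M) (f : C^∞⟮I, M; ℝ⟯) (y : E) :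
    chartRep I x f y = f ((extChartAt I x).symm y) := rfl

theorem contDiffOn_chartRep [IsManifold I ∞ M] (x : M) (f : C^∞⟮I, M; ℝ⟯) :
    ContDiffOn ℝ ∞ (chartRep I x f) (extChartAt I x).target :=
  (f.contMDiff.comp_contMDiffOn (contMDiffOn_extChartAt_symm x)).contDiffOn

theorem iteratedFDerivWithin_chartRep_add [IsManifold I ∞ M] (x : M) (k : ℕ)
    (f g : C^∞⟮I, M; ℝ⟯) {y : E} (hy : y ∈ (extChartAt I x).target) :
    iteratedFDerivWithin ℝ k (chartRep I x (f + g)) (extChartAt I x).target y =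
      iteratedFDerivWithin ℝ k (chartRep I x f) (extChartAt I x).target y +
      iteratedFDerivWithin ℝ k (chartRep I x g) (extChartAt I x).target y :=
  iteratedFDerivWithin_add_apply
    ((contDiffOn_chartRep x f y hy).of_le (by exact_mod_cast le_top))
    ((contDiffOn_chartRep x g y hy).of_le (by exact_mod_cast le_top))
    (uniqueDiffOn_extChartAt_target x) hy

/-- The maps which induce the Fréchet topology, as additive homomorphisms. -/
def jetHom [IsManifold I ∞ M] (x : M) (k : ℕ) : C^∞⟮I, M; ℝ⟯ →+
    UniformOnFun (extChartAt I x).target (E [×k]→L[ℝ] ℝ)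
      {K : Set (extChartAt I x).target | IsCompact K} :=
  AddMonoidHom.mk' (fun f => UniformOnFun.ofFun _ fun y : (extChartAt I x).target =>
      iteratedFDerivWithin ℝ k (chartRep I x f) (extChartAt I x).target y)
    fun f g => congrArg (UniformOnFun.ofFun _) <|
      funext fun y => iteratedFDerivWithin_chartRep_add x k f g y.2

instance [IsManifold I ∞ M] : IsTopologicalAddGroup C^∞⟮I, M; ℝ⟯ :=
  topologicalAddGroup_iInf fun x => topologicalAddGroup_iInf fun k =>
    topologicalAddGroup_induced (jetHom x k)

section Boundaryless

variable [I.Boundaryless] [IsManifold I ∞ M]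

/-- Chart targets are open in a finite-dimensional space, hence locally compact, so uniform
convergence on compact sets is locally uniform convergence. Since the limit is zero, the latter is a
limit along `l ×ˢ 𝓝 y`, and derivatives within the open target are plain derivatives. Later
estimates use only this form. -/
theorem tendsto_zero_iff [FiniteDimensional ℝ E] {ι : Type*} {l : Filter ι}
    {u : ι → C^∞⟮I, M; ℝ⟯} :
    Tendsto u l (𝓝 0) ↔ ∀ (x : M), ∀ y ∈ (extChartAt I x).target, ∀ k : ℕ,
      Tendsto (fun p : ι × E => iteratedFDeriv ℝ k (chartRep I x (u p.1)) p.2) (l ×ˢ 𝓝 y)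
        (𝓝 0) := by
  have hopen (x : M) : IsOpen (extChartAt I x).target := isOpen_extChartAt_target x
  have hzero (x : M) (k : ℕ) (y : E) : iteratedFDeriv ℝ k (chartRep I x (0 : C^∞⟮I, M; ℝ⟯)) y = 0 :=
    congrFun (iteratedFDeriv_fun_zero (𝕜 := ℝ) (E := E) (F := ℝ) (n := k)) y
  have key (x : M) (k : ℕ) : Tendsto (fun i => jetHom x k (u i)) l (𝓝 (jetHom x k 0)) ↔
      ∀ y ∈ (extChartAt I x).target, Tendsto
        (fun p : ι × E => iteratedFDeriv ℝ k (chartRep I x (u p.1)) p.2) (l ×ˢ 𝓝 y) (𝓝 0) := by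
    have : ProperSpace E := FiniteDimensional.proper ℝ E
    have : LocallyCompactSpace (extChartAt I x).target := (hopen x).locallyCompactSpace
    rw [UniformOnFun.tendsto_iff_tendstoUniformlyOn]
    change (∀ K : Set (extChartAt I x).target, IsCompact K → TendstoUniformlyOn
      (fun i (y : (extChartAt I x).target) =>
        iteratedFDerivWithin ℝ k (chartRep I x (u i)) (extChartAt I x).target y)
      (fun y : (extChartAt I x).target =>
        iteratedFDerivWithin ℝ k (chartRep I x (0 : C^∞⟮I, M; ℝ⟯)) (extChartAt I x).target y)
      l K) ↔ _
    rw [← tendstoLocallyUniformly_iff_forall_isCompact, Metric.tendstoLocallyUniformly_iff]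
    have hd (i : ι) (y : (extChartAt I x).target) :
        dist (iteratedFDerivWithin ℝ k (chartRep I x (0 : C^∞⟮I, M; ℝ⟯)) (extChartAt I x).target y)
        (iteratedFDerivWithin ℝ k (chartRep I x (u i)) (extChartAt I x).target y) =
        ‖iteratedFDeriv ℝ k (chartRep I x (u i)) y‖ := by
      rw [iteratedFDerivWithin_of_isOpen k (hopen x) y.2,
        iteratedFDerivWithin_of_isOpen k (hopen x) y.2, hzero, dist_zero_left]
    simp only [hd]
    constructor
    · intro h y hy
      rw [Metric.tendsto_nhds]
      intro ε hε
      obtain ⟨t, ht, hu⟩ := h ε hε ⟨y, hy⟩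
      have ht' : (Subtype.val '' t) ∈ 𝓝 y := by
        have := (hopen x).isOpenEmbedding_subtypeVal.image_mem_nhds (x := ⟨y, hy⟩) |>.2 ht
        exact this
      filter_upwards [prod_mem_prod hu ht'] with p hp
      obtain ⟨h1, z, hz, hz'⟩ := hp
      rw [dist_zero_right, ← hz']
      exact h1 z hz
    · intro h ε hε y
      have := Metric.tendsto_nhds.1 (h y y.2) ε hε
      obtain ⟨pa, ha, pb, hb, hab⟩ := eventually_prod_iff.1 this
      refine ⟨Subtype.val ⁻¹' {z | pb z}, continuous_subtype_val.continuousAt hb, ?_⟩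
      filter_upwards [ha] with i hi z hz
      simpa using hab hi hz
  have hind (x : M) (k : ℕ) : Tendsto u l (@nhds _ (TopologicalSpace.induced (jetHom (I := I) x k)
      inferInstance) 0) ↔ Tendsto (fun i => jetHom x k (u i)) l (𝓝 (jetHom x k 0)) := by
    rw [nhds_induced, tendsto_comap_iff]; rfl
  have htop : 𝓝 (0 : C^∞⟮I, M; ℝ⟯) = ⨅ (x : M) (k : ℕ),
      @nhds _ (TopologicalSpace.induced (jetHom (I := I) x k) inferInstance) 0 := by
    exact nhds_iInf.trans (iInf_congr fun x => nhds_iInf)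
  rw [htop]
  simp only [tendsto_iInf, hind, key]
  exact forall_congr' fun x => ⟨fun h y hy k => h k y hy, fun h k y hy => h y hy k⟩

/-- For a topological group it is enough that {0} is closed. The jets of order zero control the
values at points, so a function in the closure of {0} vanishes everywhere. -/
instance [FiniteDimensional ℝ E] : T2Space C^∞⟮I, M; ℝ⟯ := by
  have : T1Space C^∞⟮I, M; ℝ⟯ := by
    refine IsTopologicalAddGroup.t1Space _ ?_
    rw [← closure_subset_iff_isClosed]
    intro f hf
    rw [mem_closure_iff_nhdsWithin_neBot] at hf
    have h0 : Tendsto (fun g : C^∞⟮I, M; ℝ⟯ => g - f) (𝓝[{0}] f) (𝓝 0) :=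
      tendsto_sub_nhds_zero_iff.2 (tendsto_id.mono_left nhdsWithin_le_nhds)
    have h1 : Tendsto (fun _ : C^∞⟮I, M; ℝ⟯ => -f) (𝓝[{0}] f) (𝓝 0) := by
      refine h0.congr' ?_
      filter_upwards [self_mem_nhdsWithin] with g hg
      rw [mem_singleton_iff.1 hg, zero_sub]
    rw [mem_singleton_iff, ← neg_eq_zero]
    ext x
    have h2 := tendsto_zero_iff.1 h1 x _ (mem_extChartAt_target x) 0
    have h3 : Tendsto (fun g : C^∞⟮I, M; ℝ⟯ => (g, extChartAt I x x)) (𝓝[{0}] f)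
        (𝓝[{0}] f ×ˢ 𝓝 (extChartAt I x x)) :=
      tendsto_id.prodMk (tendsto_const_pure.mono_right (pure_le_nhds _))
    have h4 := (h2.comp h3).norm
    simp only [Function.comp_def, norm_iteratedFDeriv_zero, norm_zero, tendsto_const_nhds_iff,
      chartRep_apply, extChartAt_to_inv] at h4
    simpa using h4
  infer_instance

end Boundaryless

end FrechetTopology

/-! ### Calculus of locally uniform convergence of all derivatives -/

section JetConvergence

variable {E : Type*} [NormedAddCommGroup E] [NormedSpace ℝ E]
  {E' : Type*} [NormedAddCommGroup E'] [NormedSpace ℝ E'] {ι : Type*}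

/-- The derivatives of all orders of the functions `v i` converge to zero along `l`, locally
uniformly at the point `y`. -/
def JetTendstoZero (v : ι → E → ℝ) (l : Filter ι) (y : E) : Prop :=
  ∀ k : ℕ, Tendsto (fun p : ι × E => iteratedFDeriv ℝ k (v p.1) p.2) (l ×ˢ 𝓝 y) (𝓝 0)

namespace JetTendstoZero

variable {v w : ι → E → ℝ} {l : Filter ι} {y : E} {T : Set E}

theorem congr (h : JetTendstoZero v l y) (hT : T ∈ 𝓝 y)
    (hvw : ∀ᶠ i in l, ∀ z ∈ T, v i z = w i z) : JetTendstoZero w l y := fun k => by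
  refine (h k).congr' ?_
  filter_upwards [prod_mem_prod hvw (interior_mem_nhds.2 hT)] with p hp
  have : v p.1 =ᶠ[𝓝 p.2] w p.1 := by
    filter_upwards [isOpen_interior.mem_nhds hp.2] with z hz
    exact hp.1 z (interior_subset hz)
  exact (this.iteratedFDeriv ℝ k).eq_of_nhds

theorem zero : JetTendstoZero (fun _ _ => 0 : ι → E → ℝ) l y := fun k => by
  simp only [iteratedFDeriv_fun_zero]
  exact tendsto_const_nhds

theorem add (h : JetTendstoZero v l y) (h' : JetTendstoZero w l y) (hT : IsOpen T) (hy : y ∈ T)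
    (hv : ∀ i, ContDiffOn ℝ ∞ (v i) T) (hw : ∀ i, ContDiffOn ℝ ∞ (w i) T) :
    JetTendstoZero (fun i z => v i z + w i z) l y := fun k => by
  have := (h k).add (h' k)
  rw [add_zero] at this
  refine this.congr' ?_
  filter_upwards [prod_mem_prod univ_mem (hT.mem_nhds hy)] with p hp
  exact (iteratedFDeriv_add_apply
    (((hv p.1).contDiffAt (hT.mem_nhds hp.2)).of_le (by exact_mod_cast le_top))
    (((hw p.1).contDiffAt (hT.mem_nhds hp.2)).of_le (by exact_mod_cast le_top))).symm

theorem sum {J : Type*} (s : Finset J) {v : J → ι → E → ℝ}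
    (h : ∀ j ∈ s, JetTendstoZero (v j) l y) (hT : IsOpen T)
    (hy : y ∈ T) (hv : ∀ j i, ContDiffOn ℝ ∞ (v j i) T) :
    JetTendstoZero (fun i z => ∑ j ∈ s, v j i z) l y := by
  classical
  induction s using Finset.induction_on with
  | empty => simpa using zero
  | insert j s hj ih =>
    simp only [Finset.sum_insert hj]
    exact (h j (by simp)).add (ih fun j' hj' => h j' (by simp [hj'])) hT hy (hv j)
      fun i => ContDiffOn.sum fun j _ => hv j i

theorem mul (h : JetTendstoZero v l y) (hT : IsOpen T) (hy : y ∈ T)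
    (hv : ∀ i, ContDiffOn ℝ ∞ (v i) T) {g : E → ℝ} (hg : ContDiffOn ℝ ∞ g T) :
    JetTendstoZero (fun i z => g z * v i z) l y := fun k => by
  -- Leibniz bound: each summand is a derivative of `g`, continuous at `y`, times a derivative of
  -- `v` which tends to zero.
  have hb : Tendsto (fun p : ι × E => ∑ a ∈ Finset.range (k + 1), (k.choose a : ℝ) *
      ‖iteratedFDeriv ℝ a g p.2‖ * ‖iteratedFDeriv ℝ (k - a) (v p.1) p.2‖) (l ×ˢ 𝓝 y)
      (𝓝 (∑ a ∈ Finset.range (k + 1), (k.choose a : ℝ) *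
      ‖iteratedFDeriv ℝ a g y‖ * ‖(0 : E [×(k - a)]→L[ℝ] ℝ)‖)) := by
    refine tendsto_finsetSum _ fun a _ => Tendsto.mul (Tendsto.mul tendsto_const_nhds ?_)
      (h _).norm
    have hc : ContinuousAt (iteratedFDeriv ℝ a g) y :=
      (hg.contDiffAt (hT.mem_nhds hy)).continuousAt_iteratedFDeriv (by exact_mod_cast le_top)
    exact (hc.tendsto.comp tendsto_snd).norm
  simp only [norm_zero, mul_zero, Finset.sum_const_zero] at hb
  refine squeeze_zero_norm' ?_ hb
  filter_upwards [prod_mem_prod univ_mem (hT.mem_nhds hy)] with p hp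
  have := norm_iteratedFDerivWithin_mul_le hg (hv p.1) hT.uniqueDiffOn hp.2
    (n := k) (by exact_mod_cast le_top)
  simpa only [iteratedFDerivWithin_of_isOpen _ hT hp.2] using this

theorem fderiv_apply (h : JetTendstoZero v l y) (hT : IsOpen T) (hy : y ∈ T)
    (hv : ∀ i, ContDiffOn ℝ ∞ (v i) T) (e : E) :
    JetTendstoZero (fun i z => fderiv ℝ (v i) z e) l y := fun k => by
  have hb := (tendsto_const_nhds (x := ‖e‖)).mul (h (k + 1)).norm
  rw [norm_zero, mul_zero] at hb
  refine squeeze_zero_norm' ?_ hb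
  filter_upwards [prod_mem_prod univ_mem (hT.mem_nhds hy)] with p hp
  have h1 : ContDiffAt ℝ k (fderiv ℝ (v p.1)) p.2 :=
    ((hv p.1).contDiffAt (hT.mem_nhds hp.2)).fderiv_right (m := k) (by exact_mod_cast le_top)
  have h2 := (ContinuousLinearMap.apply ℝ ℝ e).iteratedFDeriv_comp_left h1 (i := k) le_rfl
  have h3 : ‖ContinuousLinearMap.apply ℝ ℝ e‖ ≤ ‖e‖ :=
    ContinuousLinearMap.opNorm_le_bound _ (norm_nonneg _) fun φ => by
      rw [mul_comm]; exact φ.le_opNorm e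
  change ‖iteratedFDeriv ℝ k (ContinuousLinearMap.apply ℝ ℝ e ∘ fderiv ℝ (v p.1)) p.2‖ ≤ _
  rw [h2, ← norm_iteratedFDeriv_fderiv]
  exact (ContinuousLinearMap.norm_compContinuousMultilinearMap_le _ _).trans
    (mul_le_mul_of_nonneg_right h3 (norm_nonneg _))

/-- By the Faà di Bruno estimate, the derivative of order k of the composite is at most k! · C ·
D^k. Here C sums the derivatives of `v` and tends to zero, while D depends on `τ` only and is
continuous at `y`. -/
theorem comp {v : ι → E' → ℝ} {τ : E → E'} (h : JetTendstoZero v l (τ y)) (hT : IsOpen T)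
    (hy : y ∈ T) {T' : Set E'} (hT' : IsOpen T') (hτ : ContDiffOn ℝ ∞ τ T) (hm : MapsTo τ T T')
    (hv : ∀ i, ContDiffOn ℝ ∞ (v i) T') :
    JetTendstoZero (fun i => v i ∘ τ) l y := fun k => by
  let C (p : ι × E) : ℝ := ∑ a ∈ Finset.range (k + 1), ‖iteratedFDeriv ℝ a (v p.1) (τ p.2)‖
  -- The summand 1 gives D ≥ 1, hence D ≤ D^a for a ≥ 1, the form which the estimate requires.
  let D (z : E) : ℝ := 1 + ∑ a ∈ Finset.range (k + 1), ‖iteratedFDeriv ℝ a τ z‖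
  have hτy := hτ.contDiffAt (hT.mem_nhds hy)
  have hC : Tendsto C (l ×ˢ 𝓝 y) (𝓝 (∑ a ∈ Finset.range (k + 1), ‖(0 : E' [×a]→L[ℝ] ℝ)‖)) := by
    refine tendsto_finsetSum _ fun a _ => ((h a).comp (?_ : Tendsto (fun p : ι × E =>
      (p.1, τ p.2)) (l ×ˢ 𝓝 y) (l ×ˢ 𝓝 (τ y)))).norm
    exact tendsto_fst.prodMk (hτy.continuousAt.tendsto.comp tendsto_snd)
  have hD : Tendsto (fun p : ι × E => D p.2) (l ×ˢ 𝓝 y) (𝓝 (D y)) := by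
    have : ContinuousAt D y := continuousAt_const.add <| tendsto_finsetSum _ fun a _ =>
      (hτy.continuousAt_iteratedFDeriv (k := a) (by exact_mod_cast le_top)).norm
    exact this.tendsto.comp tendsto_snd
  have hb := ((tendsto_const_nhds (x := (k.factorial : ℝ))).mul hC).mul (hD.pow k)
  simp only [norm_zero, Finset.sum_const_zero, mul_zero, zero_mul] at hb
  refine squeeze_zero_norm' ?_ hb
  filter_upwards [prod_mem_prod univ_mem (hT.mem_nhds hy)] with p hp
  have hp' := hm hp.2
  rw [← iteratedFDerivWithin_of_isOpen _ hT hp.2]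
  refine norm_iteratedFDerivWithin_comp_le (hv p.1) hτ (n := k) (by exact_mod_cast le_top)
    hT'.uniqueDiffOn hT.uniqueDiffOn hm hp.2 (fun a ha => ?_) fun a h1 ha => ?_
  · rw [iteratedFDerivWithin_of_isOpen _ hT' hp']
    exact Finset.single_le_sum (f := fun a => ‖iteratedFDeriv ℝ a (v p.1) (τ p.2)‖)
      (fun _ _ => norm_nonneg _) (by simpa [Nat.lt_succ_iff] using ha)
  · rw [iteratedFDerivWithin_of_isOpen _ hT hp.2]
    have h2 := Finset.single_le_sum (f := fun a => ‖iteratedFDeriv ℝ a τ p.2‖)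
      (s := Finset.range (k + 1)) (fun _ _ => norm_nonneg _)
      (by simpa [Nat.lt_succ_iff] using ha)
    have h3 : (1 : ℝ) ≤ D p.2 := le_add_of_nonneg_right (Finset.sum_nonneg fun _ _ => norm_nonneg _)
    exact (h2.trans (le_add_of_nonneg_left zero_le_one)).trans (le_self_pow₀ h3 (by omega))

end JetTendstoZero

end JetConvergence

/-! ### Hadamard's lemma -/

section Hadamard

variable {E : Type*} [NormedAddCommGroup E] [NormedSpace ℝ E] 

/-- Hadamard's lemma. -/
theorem exists_eq_add_clm_apply_sub {f : E → ℝ} (hf : ContDiff ℝ ∞ f) (y₀ : E) :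
    ∃ h : E → E →L[ℝ] ℝ, ContDiff ℝ ∞ h ∧ ∀ y, f y = f y₀ + h y (y - y₀) := by
  obtain ⟨χ, hin, hout⟩ : ∃ χ : ContDiffBump (0 : ℝ), χ.rIn = 1 ∧ χ.rOut = 2 :=
    ⟨⟨1, 2, one_pos, one_lt_two⟩, rfl, rfl⟩
  -- The coefficient is ∫₀¹ Df(y₀ + t(y − y₀)) dt. It is written as the convolution at 0 of the
  -- indicator of [0, 1] with `g y`, so that smoothness in `y` follows from convolution with
  -- parameters. The convolution samples s = −t, hence the sign; `χ` is 1 on [−1, 1] and provides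
  -- compact support in s.
  let g (y : E) (s : ℝ) : E →L[ℝ] ℝ := χ s • fderiv ℝ f (y₀ - s • (y - y₀))
  have hdf : ContDiff ℝ ∞ (fderiv ℝ f) := hf.fderiv_right (by simp)
  have hconv := MeasureTheory.contDiffOn_convolution_right_with_param (μ := MeasureTheory.volume)
    (f := indicator (Icc (0 : ℝ) 1) fun _ => (1 : ℝ)) (n := ⊤)
    (ContinuousLinearMap.lsmul ℝ ℝ) (g := g) (s := univ) (k := Metric.closedBall 0 2)
    isOpen_univ (isCompact_closedBall _ _) (fun y s _ hs => by
      have h2 : 2 < dist s 0 := not_le.1 hs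
      have : χ s = 0 := χ.zero_of_le_dist (hout ▸ h2.le)
      exact (congrArg (· • _) this).trans (zero_smul ℝ _))
    ((MeasureTheory.integrable_indicator_iff measurableSet_Icc).2
      (by simp) |>.locallyIntegrable)
    (by
      refine ContDiff.contDiffOn ?_
      have h1 : ContDiff ℝ ∞ fun p : E × ℝ => χ p.2 := χ.contDiff.comp contDiff_snd
      exact h1.smul (hdf.comp (by fun_prop)))
  refine ⟨fun y => MeasureTheory.convolution (indicator (Icc (0 : ℝ) 1) fun _ => (1 : ℝ)) (g y)
    (ContinuousLinearMap.lsmul ℝ ℝ) MeasureTheory.volume 0, ?_, fun y => ?_⟩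
  · rw [univ_prod_univ, contDiffOn_univ] at hconv
    have hp : ContDiff ℝ ∞ fun y : E => ((y, 0) : E × ℝ) := contDiff_id.prodMk contDiff_const
    have := ContDiff.comp hconv hp
    exact this
  · let G (t : ℝ) : E →L[ℝ] ℝ := fderiv ℝ f (y₀ + t • (y - y₀))
    have hpt (t : ℝ) : ContinuousLinearMap.lsmul ℝ ℝ (indicator (Icc (0 : ℝ) 1) (fun _ => (1 : ℝ)) t)
        (g y (0 - t)) = indicator (Icc (0 : ℝ) 1) G t := by
      by_cases ht : t ∈ Icc (0 : ℝ) 1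
      · have : χ (0 - t) = 1 := χ.one_of_mem_closedBall (by
          rw [zero_sub, mem_closedBall_zero_iff, norm_neg, Real.norm_eq_abs, abs_of_nonneg ht.1,
            hin]
          exact ht.2)
        rw [indicator_of_mem ht, indicator_of_mem ht, ContinuousLinearMap.lsmul_apply, one_smul]
        simp only [g, G]
        rw [this, one_smul, zero_sub, neg_smul, sub_neg_eq_add]
      · have h1 : indicator (Icc (0 : ℝ) 1) (fun _ => (1 : ℝ)) t = 0 := indicator_of_notMem ht _
        have h2 : indicator (Icc (0 : ℝ) 1) G t = 0 := indicator_of_notMem ht G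
        exact (congrArg (fun c : ℝ => c • g y (0 - t)) h1).trans ((zero_smul ℝ _).trans h2.symm)
    have h1 : MeasureTheory.convolution (indicator (Icc (0 : ℝ) 1) fun _ => (1 : ℝ)) (g y)
        (ContinuousLinearMap.lsmul ℝ ℝ) MeasureTheory.volume 0 =
        ∫ t in (0 : ℝ)..1, G t := by
      rw [intervalIntegral.integral_of_le zero_le_one, ← MeasureTheory.integral_Icc_eq_integral_Ioc,
        ← MeasureTheory.integral_indicator measurableSet_Icc]
      exact MeasureTheory.integral_congr_ae (.of_forall hpt)
    have hcont : Continuous G :=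
      hdf.continuous.comp (by fun_prop)
    have h2 (t : ℝ) : HasDerivAt (fun t : ℝ => f (y₀ + t • (y - y₀)))
        (fderiv ℝ f (y₀ + t • (y - y₀)) (y - y₀)) t := by
      have h3 : HasDerivAt (fun t : ℝ => y₀ + t • (y - y₀)) (y - y₀) t := by
        simpa using ((hasDerivAt_id t).smul_const (y - y₀)).const_add y₀
      exact ((hf.differentiable (by simp)) _).hasFDerivAt.comp_hasDerivAt t h3
    have h4 := intervalIntegral.integral_eq_sub_of_hasDerivAt (fun t _ => h2 t)
      ((hcont.clm_apply continuous_const).intervalIntegrable 0 1)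
    beta_reduce
    rw [h1, ContinuousLinearMap.intervalIntegral_apply (hcont.intervalIntegrable 0 1), h4]
    simp

end Hadamard

theorem contMDiffMap_sum_apply {E : Type*} [NormedAddCommGroup E] [NormedSpace ℝ E]
    {H : Type*} [TopologicalSpace H] {I : ModelWithCorners ℝ E H} {M : Type*} [TopologicalSpace M]
    [ChartedSpace H M] {J : Type*} (s : Finset J) (f : J → C^∞⟮I, M; ℝ⟯) (x : M) :
    (∑ j ∈ s, f j) x = ∑ j ∈ s, f j x :=
  map_sum (Pi.evalRingHom (fun _ : M => ℝ) x |>.comp ContMDiffMap.coeFnRingHom) f s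

/-! ### Derivations of smooth functions are first-order operators -/

section Derivations

variable {E : Type*} [NormedAddCommGroup E] [NormedSpace ℝ E] [FiniteDimensional ℝ E]
  {H : Type*} [TopologicalSpace H]
  {I : ModelWithCorners ℝ E H} {M : Type*} [TopologicalSpace M] [ChartedSpace H M]
  [T2Space M] [IsManifold I ∞ M]

variable (I) in
theorem exists_smooth_bump {m : M} {U : Set M} (hU : U ∈ 𝓝 m) :
    ∃ χ : C^∞⟮I, M; ℝ⟯, (∀ᶠ x in 𝓝 m, χ x = 1) ∧ tsupport χ ⊆ U := by
  obtain ⟨χ, -, hχ⟩ := (SmoothBumpFunction.nhds_basis_tsupport (I := I) m).mem_iff.1 hU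
  exact ⟨⟨χ, χ.contMDiff⟩, χ.eventuallyEq_one, hχ⟩

/-- A cut-off makes functions of the chart coordinates global. The set `O` is chosen before `ψ`, so
all coordinate functions and coefficients are available on one common neighbourhood. -/
theorem exists_chart_functions {x m : M} (hm : m ∈ (extChartAt I x).source) :
    ∃ O : Set M, IsOpen O ∧ m ∈ O ∧ O ⊆ (extChartAt I x).source ∧
      ∀ ψ : E → ℝ, ContDiff ℝ ∞ ψ →
        ∃ c : C^∞⟮I, M; ℝ⟯, ∀ m' ∈ O, c m' = ψ (extChartAt I x m') := by
  obtain ⟨χ, h1, hχ⟩ := exists_smooth_bump I ((isOpen_extChartAt_source x).mem_nhds hm)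
  obtain ⟨O, hO, hOo, hmO⟩ := mem_nhds_iff.1
    (inter_mem h1 ((isOpen_extChartAt_source x).mem_nhds hm))
  refine ⟨O, hOo, hmO, fun y hy => (hO hy).2, fun ψ hψ => ?_⟩
  refine ⟨⟨fun y => χ y * ψ (extChartAt I x y), contMDiff_of_tsupport fun y hy => ?_⟩,
    fun y hy => ?_⟩
  · have hy' := hχ (closure_mono (Function.support_mul_subset_left _ _) hy)
    exact χ.contMDiff.contMDiffAt.mul
      (hψ.contMDiff.contMDiffAt.comp y (contMDiffAt_extChartAt' (by simpa using hy')))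
  · exact (congrArg (· * _) (hO hy).1).trans (one_mul _)

/-- Locality: for a bump `χ` equal to 1 at `m` and supported where f = g, the product χ(f − g) is
zero; the Leibniz rule at `m` leaves D f m − D g m. -/
theorem derivation_congr (D : Derivation ℝ C^∞⟮I, M; ℝ⟯ C^∞⟮I, M; ℝ⟯) {f g : C^∞⟮I, M; ℝ⟯} {m : M}
    (h : f =ᶠ[𝓝 m] g) : D f m = D g m := by
  obtain ⟨χ, h1, hχ⟩ := exists_smooth_bump I h
  have h0 : χ * (f - g) = 0 := by
    ext y
    change χ y * (f y - g y) = 0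
    by_cases hy : y ∈ tsupport χ
    · have : f y = g y := hχ hy
      rw [this, sub_self, mul_zero]
    · rw [image_eq_zero_of_notMem_tsupport hy, zero_mul]
  have h2 := congrArg (fun F : C^∞⟮I, M; ℝ⟯ => F m) (D.leibniz χ (f - g))
  rw [h0, map_zero, map_sub] at h2
  replace h2 : (0 : ℝ) = χ m * (D f m - D g m) + (f m - g m) * D χ m := h2
  rw [h1.self_of_nhds, h.self_of_nhds, sub_self, zero_mul, add_zero, one_mul] at h2
  exact (sub_eq_zero.1 h2.symm)

/-- By Hadamard's lemma f = f(m) + ∑ a_j c_j near `m`, where the centred coordinates c_j vanish at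
`m`, and so do the a_j because the differential of f does. The Leibniz rule then gives zero at `m`.
-/
theorem derivation_apply_eq_zero [I.Boundaryless] (D : Derivation ℝ C^∞⟮I, M; ℝ⟯ C^∞⟮I, M; ℝ⟯)
    {f : C^∞⟮I, M; ℝ⟯}
    {x m : M} (hm : m ∈ (extChartAt I x).source)
    (hf : fderiv ℝ (chartRep I x f) (extChartAt I x m) = 0) : D f m = 0 := by
  obtain ⟨O, hO, hmO, hOs, hc⟩ := exists_chart_functions hm
  set y₀ := extChartAt I x m with hy₀
  have ht : (extChartAt I x).target ∈ 𝓝 y₀ :=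
    (isOpen_extChartAt_target x).mem_nhds ((extChartAt I x).map_source hm)
  -- a globally smooth function which agrees with the chart representation near `y₀`
  obtain ⟨b, hb1, hb⟩ := exists_smooth_bump 𝓘(ℝ, E) ht
  let g : E → ℝ := fun y => b y * chartRep I x f y
  have hg : ContDiff ℝ ∞ g := by
    refine (contMDiff_of_tsupport (I := 𝓘(ℝ, E)) fun y hy => ?_).contDiff
    have hy' := hb (closure_mono (Function.support_mul_subset_left _ _) hy)
    exact (b.contMDiff.contDiff.contDiffAt.mul ((contDiffOn_chartRep x f).contDiffAt
      ((isOpen_extChartAt_target x).mem_nhds hy'))).contMDiffAt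
  have hgf : g =ᶠ[𝓝 y₀] chartRep I x f := by
    filter_upwards [hb1] with y hy
    change b y * _ = _
    rw [hy, one_mul]
  obtain ⟨h, hh, hgh⟩ := exists_eq_add_clm_apply_sub hg y₀
  have hh0 : h y₀ = 0 := by
    have h1 : HasFDerivAt g (h y₀) y₀ := by
      have h2 := (hh.differentiable (by simp) y₀).hasFDerivAt.clm_apply
        ((hasFDerivAt_id y₀).sub_const y₀)
      have h3 := h2.const_add (g y₀)
      convert! h3 using 1
      · ext y; exact hgh y
      · ext v; simp
    rw [← h1.fderiv, hgf.fderiv_eq, hf]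
  let B := Module.finBasis ℝ E
  have hcoord (j) : ∃ c : C^∞⟮I, M; ℝ⟯, ∀ m' ∈ O, c m' = B.repr (extChartAt I x m' - y₀) j :=
    hc (fun y => B.repr (y - y₀) j) (by
      have : ContDiff ℝ ∞ (B.equivFunL : E → _) := B.equivFunL.contDiff
      exact (contDiff_pi.1 this j).comp (contDiff_id.sub contDiff_const))
  choose c hc' using hcoord
  have hcoef (j) : ∃ c : C^∞⟮I, M; ℝ⟯, ∀ m' ∈ O, c m' = h (extChartAt I x m') (B j) :=
    hc (fun y => h y (B j)) (hh.clm_apply contDiff_const)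
  choose a ha using hcoef
  have hloc : f =ᶠ[𝓝 m] (algebraMap ℝ C^∞⟮I, M; ℝ⟯ (f m) + ∑ j, a j * c j : C^∞⟮I, M; ℝ⟯) := by
    have hcont := (continuousAt_extChartAt' (I := I) hm)
    filter_upwards [hO.mem_nhds hmO, hcont.eventually hgf] with y hy hyg
    have h1 : (algebraMap ℝ C^∞⟮I, M; ℝ⟯ (f m) + ∑ j, a j * c j : C^∞⟮I, M; ℝ⟯) y =
        f m + ∑ j, a j y * c j y := by
      have : (∑ j, a j * c j : C^∞⟮I, M; ℝ⟯) y = ∑ j, a j y * c j y := by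
        rw [contMDiffMap_sum_apply]; rfl
      rw [← this]; rfl
    have h2 : f y = g (extChartAt I x y) := by
      rw [hyg, chartRep_apply, (extChartAt I x).left_inv (hOs hy)]
    have h3 : g y₀ = f m := by
      rw [hgf.self_of_nhds, chartRep_apply, (extChartAt I x).left_inv hm]
    rw [h1, h2, hgh, h3]
    congr 1
    conv_lhs => rw [← B.sum_repr (extChartAt I x y - y₀), map_sum]
    refine Finset.sum_congr rfl fun j _ => ?_
    rw [ha j y hy, hc' j y hy, map_smul, smul_eq_mul, mul_comm]
  rw [derivation_congr D hloc, map_add, D.map_algebraMap, zero_add, map_sum,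
    contMDiffMap_sum_apply]
  refine Finset.sum_eq_zero fun j _ => ?_
  rw [D.leibniz]
  change a j m * D (c j) m + c j m * D (a j) m = 0
  rw [ha j m hmO, hc' j m hmO, ← hy₀, hh0, sub_self]
  simp

/-- Subtracting from f the combination of coordinates with the same differential at `m` reduces to
the preceding lemma. -/
theorem derivation_apply_eq_sum [I.Boundaryless] (D : Derivation ℝ C^∞⟮I, M; ℝ⟯ C^∞⟮I, M; ℝ⟯)
    {x m : M} (hm : m ∈ (extChartAt I x).source) {J : Type*} [Fintype J] (B : Module.Basis J ℝ E)
    (c : J → C^∞⟮I, M; ℝ⟯)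
    (hc : ∀ j, ∀ᶠ y in 𝓝 m, c j y = B.repr (extChartAt I x y) j) (f : C^∞⟮I, M; ℝ⟯) :
    D f m = ∑ j, fderiv ℝ (chartRep I x f) (extChartAt I x m) (B j) * D (c j) m := by
  set y₀ := extChartAt I x m with hy₀
  have hyt := (extChartAt I x).map_source hm
  have ht : (extChartAt I x).target ∈ 𝓝 y₀ := (isOpen_extChartAt_target x).mem_nhds hyt
  have hdiff (g : C^∞⟮I, M; ℝ⟯) : DifferentiableAt ℝ (chartRep I x g) y₀ :=
    ((contDiffOn_chartRep x g).contDiffAt ht).differentiableAt (by simp)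
  have hcj (j) : HasFDerivAt (chartRep I x (c j))
      ((ContinuousLinearMap.proj j).comp (B.equivFunL : E →L[ℝ] J → ℝ)) y₀ := by
    refine ((ContinuousLinearMap.proj (R := ℝ) (φ := fun _ : J => ℝ) j).comp
      (B.equivFunL : E →L[ℝ] J → ℝ)).hasFDerivAt.congr_of_eventuallyEq ?_
    have h1 : Tendsto (extChartAt I x).symm (𝓝 y₀) (𝓝 m) := by
      have := continuousAt_extChartAt_symm'' hyt
      rwa [ContinuousAt, (extChartAt I x).left_inv hm] at this
    filter_upwards [ht, h1.eventually (hc j)] with y hy hy'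
    rw [chartRep_apply, hy', (extChartAt I x).right_inv hy]
    rfl
  let df (j : J) : ℝ := fderiv ℝ (chartRep I x f) y₀ (B j)
  have key : D (f - ∑ j, df j • c j) m = 0 := by
    refine derivation_apply_eq_zero D hm ?_
    have h1 : chartRep I x (f - ∑ j, df j • c j) =
        fun y => chartRep I x f y - ∑ j, df j * chartRep I x (c j) y := by
      ext y
      have : (∑ j, df j • c j : C^∞⟮I, M; ℝ⟯) ((extChartAt I x).symm y) =
          ∑ j, df j * c j ((extChartAt I x).symm y) := by
        rw [contMDiffMap_sum_apply]; rfl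
      simp only [chartRep_apply]
      rw [← this]; rfl
    rw [h1]
    have h2 : HasFDerivAt (fun y => chartRep I x f y - ∑ j, df j * chartRep I x (c j) y)
        (fderiv ℝ (chartRep I x f) y₀ - ∑ j, df j •
          ((ContinuousLinearMap.proj j).comp (B.equivFunL : E →L[ℝ] J → ℝ))) y₀ :=
      (hdiff f).hasFDerivAt.sub (HasFDerivAt.fun_sum fun j _ => (hcj j).const_mul (df j))
    rw [h2.fderiv, sub_eq_zero]
    ext v
    conv_lhs => rw [← B.sum_repr v, map_sum]
    rw [_root_.sum_apply]
    refine Finset.sum_congr rfl fun j _ => ?_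
    rw [map_smul, smul_eq_mul, mul_comm]
    rfl
  rw [map_sub] at key
  have h3 : D f m - D (∑ j, df j • c j) m = 0 := key
  rw [sub_eq_zero.1 h3, map_sum, contMDiffMap_sum_apply]
  refine Finset.sum_congr rfl fun j _ => ?_
  rw [D.map_smul]
  rfl

/-- Derivations of the algebra of smooth functions are continuous for the Fréchet topology. -/
theorem continuous_derivation [I.Boundaryless]
    (D : Derivation ℝ C^∞⟮I, M; ℝ⟯ C^∞⟮I, M; ℝ⟯) : Continuous D := by
  refine continuous_of_continuousAt_zero D.toLinearMap.toAddMonoidHom ?_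
  change Tendsto D (𝓝 0) (𝓝 (D 0))
  rw [map_zero, tendsto_zero_iff]
  intro x y hy
  have hid : ∀ y ∈ (extChartAt I x).target, JetTendstoZero
      (fun f : C^∞⟮I, M; ℝ⟯ => chartRep I x f) (𝓝 0) y := tendsto_zero_iff.1 tendsto_id x
  set m := (extChartAt I x).symm y with hm
  have hms : m ∈ (extChartAt I x).source := (extChartAt I x).map_target hy
  obtain ⟨O, hO, hmO, hOs, hc⟩ := exists_chart_functions hms
  let B := Module.finBasis ℝ E
  have hcoord (j) : ∃ c : C^∞⟮I, M; ℝ⟯, ∀ m' ∈ O, c m' = B.repr (extChartAt I x m') j :=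
    hc (fun y => B.repr y j) (by
      have : ContDiff ℝ ∞ (B.equivFunL : E → _) := B.equivFunL.contDiff
      exact contDiff_pi.1 this j)
  choose c hc' using hcoord
  have hopen := isOpen_extChartAt_target (I := I) x
  have hsmooth (j) (f : C^∞⟮I, M; ℝ⟯) : ContDiffOn ℝ ∞
      (fun z => fderiv ℝ (chartRep I x f) z (B j)) (extChartAt I x).target :=
    ((contDiffOn_chartRep x f).fderiv_of_isOpen hopen (by simp)).clm_apply contDiffOn_const
  -- In the chart, D f = ∑ D(c_j) ∂_j f with coefficients independent of f, so jets of f tending to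
  -- zero force those of D f to do the same.
  have h1 : JetTendstoZero (fun (f : C^∞⟮I, M; ℝ⟯) z =>
      ∑ j, chartRep I x (D (c j)) z * fderiv ℝ (chartRep I x f) z (B j)) (𝓝 0) y := by
    refine JetTendstoZero.sum Finset.univ (fun j _ => ?_) hopen hy fun j f => ?_
    · exact ((hid y hy).fderiv_apply hopen hy (contDiffOn_chartRep x) (B j)).mul hopen hy
        (hsmooth j) (contDiffOn_chartRep x _)
    · exact (contDiffOn_chartRep x _).mul (hsmooth j f)
  have hT : (extChartAt I x).symm ⁻¹' O ∩ (extChartAt I x).target ∈ 𝓝 y :=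
    inter_mem ((continuousAt_extChartAt_symm'' hy).preimage_mem_nhds (hO.mem_nhds hmO))
      (hopen.mem_nhds hy)
  suffices h2 : JetTendstoZero (fun f => chartRep I x (D f)) (𝓝 0) y from h2
  refine h1.congr hT (.of_forall fun f z hz => ?_)
  have hz' := (extChartAt I x).map_target hz.2
  rw [chartRep_apply, derivation_apply_eq_sum D hz' B c
    (fun j => by filter_upwards [hO.mem_nhds hz.1] with w hw using hc' j w hw) f,
    (extChartAt I x).right_inv hz.2]
  exact Finset.sum_congr rfl fun j _ => mul_comm _ _

end Derivations

end LieAlgd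

end

noncomputable section

namespace LieAlgd

open Filter Topology Set Bundle

/-! ### Topology of the total space -/

section TotalSpace

variable {N : Type*} [TopologicalSpace N] {F : Type*} [TopologicalSpace F]
  {V : N → Type*} [TopologicalSpace (TotalSpace F V)] [∀ x, TopologicalSpace (V x)]
  [FiberBundle F V]

variable (F V) in
theorem t2Space_totalSpace [T2Space N] [T2Space F] : T2Space (TotalSpace F V) := by
  refine ⟨fun p q hpq => ?_⟩
  by_cases h : p.proj = q.proj
  · let e := trivializationAt F V p.proj
    have hp : p ∈ e.source := FiberBundle.mem_trivializationAt_proj_source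
    have hq : q ∈ e.source := by
      rw [e.mem_source, ← h]; exact FiberBundle.mem_baseSet_trivializationAt' _
    have hne : e p ≠ e q := fun h' => hpq (e.injOn hp hq h')
    obtain ⟨u, v, hu, hv, hpu, hqv, huv⟩ := t2_separation hne
    have hcont := e.continuousOn_toFun
    refine ⟨e.source ∩ e ⁻¹' u, e.source ∩ e ⁻¹' v, hcont.isOpen_inter_preimage e.open_source hu,
      hcont.isOpen_inter_preimage e.open_source hv, ⟨hp, hpu⟩, ⟨hq, hqv⟩, ?_⟩
    exact (huv.preimage e).mono inter_subset_right inter_subset_right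
  · obtain ⟨u, v, hu, hv, hpu, hqv, huv⟩ := t2_separation h
    have hcont := FiberBundle.continuous_proj F V
    exact ⟨_, _, hu.preimage hcont, hv.preimage hcont, hpu, hqv, huv.preimage _⟩

variable (F V) in
theorem sigmaCompactSpace_totalSpace [SigmaCompactSpace N] [LocallyCompactSpace N]
    [SigmaCompactSpace F] : SigmaCompactSpace (TotalSpace F V) := by
  have h (x : N) : ∃ K ∈ 𝓝 x, K ⊆ (trivializationAt F V x).baseSet ∧ IsCompact K :=
    local_compact_nhds ((trivializationAt F V x).open_baseSet.mem_nhds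
      (FiberBundle.mem_baseSet_trivializationAt' x))
  choose K hK hKb hKc using h
  obtain ⟨s, hs, hsK⟩ := countable_cover_nhds_of_sigmaCompact hK
  rw [← isSigmaCompact_univ_iff]
  have hcover : (univ : Set (TotalSpace F V)) = ⋃ x ∈ s,
      (trivializationAt F V x).toOpenPartialHomeomorph.symm '' (K x ×ˢ univ) := by
    refine (eq_univ_of_forall fun p => ?_).symm
    have hp : p.proj ∈ ⋃ x ∈ s, K x := hsK ▸ mem_univ _
    simp only [mem_iUnion] at hp ⊢
    obtain ⟨x, hx, hpx⟩ := hp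
    have hps : p ∈ (trivializationAt F V x).source :=
      (trivializationAt F V x).mem_source.2 (hKb x hpx)
    refine ⟨x, hx, trivializationAt F V x p, ⟨?_, mem_univ _⟩,
      (trivializationAt F V x).left_inv hps⟩
    rw [(trivializationAt F V x).coe_fst hps]
    exact hpx
  rw [hcover]
  refine isSigmaCompact_biUnion hs fun x _ => ?_
  refine IsSigmaCompact.image_of_continuousOn ?_
    ((trivializationAt F V x).toOpenPartialHomeomorph.continuousOn_symm.mono fun p hp => ?_)
  · have : (K x ×ˢ univ : Set (N × F)) = ⋃ n, K x ×ˢ compactCovering F n := by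
      rw [← prod_iUnion, iUnion_compactCovering]
    rw [this]
    exact isSigmaCompact_iUnion_of_isCompact _ fun n =>
      (hKc x).prod (isCompact_compactCovering F n)
  · exact (trivializationAt F V x).mem_target.2 (hKb x hp.1)

end TotalSpace

/-! ### Global sections and functions extending local ones -/

section Sections

variable {E : Type*} [NormedAddCommGroup E] [NormedSpace ℝ E] [FiniteDimensional ℝ E]
  {N : Type*} [TopologicalSpace N] [T2Space N] [ChartedSpace E N] [IsManifold 𝓘(ℝ, E) ∞ N]
  {F : Type*} [NormedAddCommGroup F] [NormedSpace ℝ F]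
  {V : N → Type*} [TopologicalSpace (Bundle.TotalSpace F V)] [∀ x, TopologicalSpace (V x)]
  [∀ x, AddCommGroup (V x)] [∀ x, Module ℝ (V x)] [FiberBundle F V] [VectorBundle ℝ F V]
  [ContMDiffVectorBundle ∞ F V 𝓘(ℝ, E)]

variable (E F V) in
theorem exists_local_sections (x₀ : N) : ∃ O : Set N, IsOpen O ∧ x₀ ∈ O ∧
    O ⊆ (trivializationAt F V x₀).baseSet ∧ O ⊆ (extChartAt 𝓘(ℝ, E) x₀).source ∧
    (∀ e : F, ∃ s : Cₛ^∞⟮𝓘(ℝ, E); F, V⟯, ∀ x ∈ O, s x = (trivializationAt F V x₀).symm x e) ∧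
    ∀ ψ : E → ℝ, ContDiff ℝ ∞ ψ →
        ∃ c : C^∞⟮𝓘(ℝ, E), N; ℝ⟯, ∀ x ∈ O, c x = ψ (extChartAt 𝓘(ℝ, E) x₀ x) := by
  let e := trivializationAt F V x₀
  have hb := e.open_baseSet.mem_nhds (FiberBundle.mem_baseSet_trivializationAt' (F := F) (E := V) x₀)
  obtain ⟨χ, h1, hχ⟩ := exists_smooth_bump 𝓘(ℝ, E) hb
  obtain ⟨O', hO', hxO', hOs, hc⟩ := exists_chart_functions (mem_extChartAt_source (I := 𝓘(ℝ, E)) x₀)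
  obtain ⟨O, hO, hOo, hmO⟩ := mem_nhds_iff.1 (inter_mem (inter_mem h1 hb) (hO'.mem_nhds hxO'))
  refine ⟨O, hOo, hmO, fun x hx => (hO hx).1.2, fun x hx => hOs (hO hx).2, fun v => ?_,
    fun ψ hψ => ?_⟩
  · have hs : CMDiff[e.baseSet] ∞ (T% fun x => e.symm x v) := by
      rw [e.contMDiffOn_section_baseSet_iff]
      refine (contMDiffOn_const (c := v)).congr fun x hx => ?_
      rw [e.apply_mk_symm hx]
    refine ⟨⟨fun x => χ x • e.symm x v, ?_⟩, fun x hx => ?_⟩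
    · exact ContMDiffOn.smul_section_of_tsupport χ.contMDiff.contMDiffOn e.open_baseSet hχ hs
    · exact (congrArg (· • _) (hO hx).1.1).trans (one_smul ℝ _)
  · obtain ⟨c, hc⟩ := hc ψ hψ
    exact ⟨c, fun x hx => hc x (hO hx).2⟩

end Sections

section FiniteDimensional

variable {F : Type*} [NormedAddCommGroup F] [NormedSpace ℝ F] [FiniteDimensional ℝ F]

theorem clm_eq_sum_smul {G J : Type*} [NormedAddCommGroup G] [NormedSpace ℝ G] [Fintype J]
    (b : Module.Basis J ℝ F) (η : F →L[ℝ] G) :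
    η = ∑ j, (LinearMap.toContinuousLinearMap (b.coord j)).smulRight (η (b j)) := by
  ext v
  rw [_root_.sum_apply]
  conv_lhs => rw [← b.sum_repr v, map_sum]
  exact Finset.sum_congr rfl fun j _ => by rw [map_smul]; rfl

theorem exists_eq_eval (κ : (F →L[ℝ] ℝ) →L[ℝ] ℝ) : ∃ v : F, ∀ η, κ η = η v := by
  let b := Module.finBasis ℝ F
  refine ⟨∑ j, κ (LinearMap.toContinuousLinearMap (b.coord j)) • b j, fun η => ?_⟩
  conv_lhs => rw [clm_eq_sum_smul b η]
  rw [map_sum, map_sum]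
  refine Finset.sum_congr rfl fun j _ => ?_
  have : (LinearMap.toContinuousLinearMap (b.coord j)).smulRight (η (b j)) =
      η (b j) • LinearMap.toContinuousLinearMap (b.coord j) := by
    ext v; simp [mul_comm]
  rw [this, map_smul, map_smul, smul_eq_mul, smul_eq_mul, mul_comm]

theorem contMDiffAt_clm_of_apply {G : Type*} [NormedAddCommGroup G] [NormedSpace ℝ G]
    {E' : Type*} [NormedAddCommGroup E'] [NormedSpace ℝ E']
    {H' : Type*} [TopologicalSpace H'] {I' : ModelWithCorners ℝ E' H'} {Q : Type*}
    [TopologicalSpace Q] [ChartedSpace H' Q] {η : Q → F →L[ℝ] G} {q : Q} {n : WithTop ℕ∞}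
    (h : ∀ v, ContMDiffAt I' 𝓘(ℝ, G) n (fun y => η y v) q) :
    ContMDiffAt I' 𝓘(ℝ, F →L[ℝ] G) n η q := by
  let b := Module.finBasis ℝ F
  have h1 (y : Q) : η y =
      ∑ j, (LinearMap.toContinuousLinearMap (b.coord j)).smulRight (η y (b j)) :=
    clm_eq_sum_smul b (η y)
  have h2 : ContMDiffAt I' 𝓘(ℝ, F →L[ℝ] G) n (fun y =>
      ∑ j, ContinuousLinearMap.smulRightL ℝ F G
        (LinearMap.toContinuousLinearMap (b.coord j)) (η y (b j))) q :=
    contMDiffAt_finsetSum fun j _ =>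
      (ContinuousLinearMap.contMDiffAt _).comp q (h (b j))
  exact h2.congr_of_eventuallyEq (.of_forall h1)

end FiniteDimensional

/-! ### Coordinates and derivations on the dual bundle -/

section Dual

variable {E : Type*} [NormedAddCommGroup E] [NormedSpace ℝ E]
  {N : Type*} [TopologicalSpace N] [ChartedSpace E N]
  {F : Type*} [NormedAddCommGroup F] [NormedSpace ℝ F]
  {V : N → Type*} [TopologicalSpace (Bundle.TotalSpace F V)] [∀ x, TopologicalSpace (V x)]
  [∀ x, AddCommGroup (V x)] [∀ x, Module ℝ (V x)] [FiberBundle F V] [VectorBundle ℝ F V]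

theorem dual_trivializationAt_apply {x₀ : N} {m : DualBundle F V}
    (hm : m.proj ∈ (trivializationAt F V x₀).baseSet) (v : F) :
    (trivializationAt (F →L[ℝ] ℝ) (fun x : N => V x →L[ℝ] Trivial N ℝ x) x₀ m).2 v =
      m.2 ((trivializationAt F V x₀).symm m.proj v) := by
  rw [hom_trivializationAt_apply]
  have h2 : m.proj ∈ (trivializationAt ℝ (Trivial N ℝ) x₀).baseSet := mem_univ _
  change ContinuousLinearMap.inCoordinates F V ℝ (Trivial N ℝ) x₀ m.proj x₀ m.proj m.2 v = _
  rw [ContinuousLinearMap.inCoordinates_eq hm h2]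
  rfl

theorem dual_trivializationAt_baseSet (x₀ : N) :
    (trivializationAt (F →L[ℝ] ℝ) (fun x : N => V x →L[ℝ] Trivial N ℝ x) x₀).baseSet =
      (trivializationAt F V x₀).baseSet := by
  rw [hom_trivializationAt_baseSet]
  exact inter_univ _

theorem mem_extChartAt_source_dual {m₀ m : DualBundle F V} :
    m ∈ (extChartAt (𝓘(ℝ, E).prod 𝓘(ℝ, F →L[ℝ] ℝ)) m₀).source ↔
      m.proj ∈ (trivializationAt F V m₀.proj).baseSet ∧
        m.proj ∈ (extChartAt 𝓘(ℝ, E) m₀.proj).source := by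
  rw [FiberBundle.extChartAt, PartialEquiv.trans_source]
  rw [mem_inter_iff, mem_preimage, PartialEquiv.prod_source, mem_prod, PartialEquiv.refl_source]
  have h := Trivialization.mem_source
    (trivializationAt (F →L[ℝ] ℝ) (fun x : N => V x →L[ℝ] Trivial N ℝ x) m₀.proj) (x := m)
  rw [dual_trivializationAt_baseSet] at h
  constructor
  · rintro ⟨h1, h2, -⟩
    refine ⟨h.1 h1, ?_⟩
    have h3 := Trivialization.coe_fst _ h1
    rw [← h3]; exact h2
  · rintro ⟨h1, h2⟩
    refine ⟨h.2 h1, ?_, mem_univ _⟩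
    have h3 := Trivialization.coe_fst _ (h.2 h1)
    rw [← h3] at h2; exact h2

theorem extChartAt_dual_fst {m₀ m : DualBundle F V}
    (hm : m.proj ∈ (trivializationAt F V m₀.proj).baseSet) :
    (extChartAt (𝓘(ℝ, E).prod 𝓘(ℝ, F →L[ℝ] ℝ)) m₀ m).1 = extChartAt 𝓘(ℝ, E) m₀.proj m.proj := by
  rw [FiberBundle.extChartAt]
  have h := Trivialization.mem_source
    (trivializationAt (F →L[ℝ] ℝ) (fun x : N => V x →L[ℝ] Trivial N ℝ x) m₀.proj) (x := m)
  rw [dual_trivializationAt_baseSet] at h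
  exact congrArg (extChartAt 𝓘(ℝ, E) m₀.proj) (Trivialization.coe_fst _ (h.2 hm))

theorem extChartAt_dual_snd {m₀ m : DualBundle F V}
    (hm : m.proj ∈ (trivializationAt F V m₀.proj).baseSet) (v : F) :
    (extChartAt (𝓘(ℝ, E).prod 𝓘(ℝ, F →L[ℝ] ℝ)) m₀ m).2 v =
      m.2 ((trivializationAt F V m₀.proj).symm m.proj v) := by
  rw [FiberBundle.extChartAt]
  exact dual_trivializationAt_apply hm v

variable [ContMDiffVectorBundle ∞ F V 𝓘(ℝ, E)] [FiniteDimensional ℝ E] [T2Space N]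
  [IsManifold 𝓘(ℝ, E) ∞ N] [FiniteDimensional ℝ F]

/-- A map to the dual bundle is smooth if its composites with the projection and the fibrewise
linear functions are smooth. -/
theorem contMDiffAt_dual {E' : Type*} [NormedAddCommGroup E'] [NormedSpace ℝ E']
    {H' : Type*} [TopologicalSpace H'] {I' : ModelWithCorners ℝ E' H'} {Q : Type*}
    [TopologicalSpace Q] [ChartedSpace H' Q] {h : Q → DualBundle F V} {q : Q}
    (h1 : ContMDiffAt I' 𝓘(ℝ, E) ∞ (fun y => (h y).proj) q)
    (h2 : ∀ s : Cₛ^∞⟮𝓘(ℝ, E); F, V⟯,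
      ContMDiffAt I' 𝓘(ℝ, ℝ) ∞ (fun y => (h y).2 (s (h y).proj)) q) :
    ContMDiffAt I' (𝓘(ℝ, E).prod 𝓘(ℝ, F →L[ℝ] ℝ)) ∞ h q := by
  rw [contMDiffAt_totalSpace]
  refine ⟨h1, ?_⟩
  obtain ⟨O, hO, hxO, hOb, -, hs, -⟩ := exists_local_sections E F V (h q).proj
  refine contMDiffAt_clm_of_apply fun v => ?_
  obtain ⟨s, hs⟩ := hs v
  refine (h2 s).congr_of_eventuallyEq ?_
  filter_upwards [h1.continuousAt.preimage_mem_nhds (hO.mem_nhds hxO)] with y hy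
  rw [dual_trivializationAt_apply (hOb hy), hs _ hy]

variable (E) in
/-- Near any fibre, the coordinates on the dual bundle are sums of functions on the base and of
fibrewise linear functions. -/
theorem exists_dual_coordinates (m₀ : DualBundle F V) : ∃ O : Set N, IsOpen O ∧ m₀.proj ∈ O ∧
    (∀ m : DualBundle F V, m.proj ∈ O →
      m ∈ (extChartAt (𝓘(ℝ, E).prod 𝓘(ℝ, F →L[ℝ] ℝ)) m₀).source) ∧
    ∀ θ : E × (F →L[ℝ] ℝ) →L[ℝ] ℝ, ∃ (a : C^∞⟮𝓘(ℝ, E), N; ℝ⟯) (s : Cₛ^∞⟮𝓘(ℝ, E); F, V⟯),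
      ∀ m : DualBundle F V, m.proj ∈ O →
        θ (extChartAt (𝓘(ℝ, E).prod 𝓘(ℝ, F →L[ℝ] ℝ)) m₀ m) =
          (pullback a + linearFunction s : DualFunctions E F V) m := by
  obtain ⟨O, hO, hxO, hOb, hOs, hs, hc⟩ := exists_local_sections E F V m₀.proj
  refine ⟨O, hO, hxO, fun m hm => mem_extChartAt_source_dual.2 ⟨hOb hm, hOs hm⟩, fun θ => ?_⟩
  -- The fibre part of `θ` is a functional on F*, hence evaluation at a vector `v` by reflexivity.
  -- It becomes the fibrewise linear function of a section constant equal to `v` in the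
  -- trivialization.
  obtain ⟨v, hv⟩ := exists_eq_eval (θ.comp (ContinuousLinearMap.inr ℝ E (F →L[ℝ] ℝ)))
  obtain ⟨a, ha⟩ := hc (θ.comp (ContinuousLinearMap.inl ℝ E (F →L[ℝ] ℝ)))
    (ContinuousLinearMap.contDiff _)
  obtain ⟨s, hs⟩ := hs v
  refine ⟨a, s, fun m hm => ?_⟩
  have h1 := extChartAt_dual_fst (E := E) (hOb hm)
  have h2 := extChartAt_dual_snd (E := E) (hOb hm) v
  change _ = a m.proj + m.2 (s m.proj)
  rw [ha _ hm, hs _ hm, ← h2, ← h1, ← hv]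
  exact (congrArg θ (Prod.fst_add_snd _).symm).trans (map_add θ _ _)

/-- A derivation of the smooth functions on the dual bundle is determined by its values on
functions on the base and on fibrewise linear functions. -/
theorem dual_derivation_eq_zero (D : Derivation ℝ (DualFunctions E F V) (DualFunctions E F V))
    (h1 : ∀ a, D (pullback a) = 0) (h2 : ∀ s, D (linearFunction s) = 0) : D = 0 := by
  have : T2Space (DualBundle F V) := t2Space_totalSpace _ _
  ext f m
  obtain ⟨O, hO, hmO, hOs, hθ⟩ := exists_dual_coordinates E m
  let B := Module.finBasis ℝ (E × (F →L[ℝ] ℝ))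
  choose a s has using fun j => hθ (LinearMap.toContinuousLinearMap (B.coord j))
  refine (derivation_apply_eq_sum D (mem_extChartAt_source m) B
    (fun j => pullback (a j) + linearFunction (s j)) (fun j => ?_) f).trans ?_
  · filter_upwards [(FiberBundle.continuous_proj (F →L[ℝ] ℝ)
      (fun x : N => V x →L[ℝ] Trivial N ℝ x)).continuousAt.preimage_mem_nhds
        (hO.mem_nhds hmO)] with y hy
    exact (has j y hy).symm
  · refine Finset.sum_eq_zero fun j _ => ?_
    rw [D.map_add, h1, h2, add_zero]
    exact mul_zero _

end Dual

/-! ### Hausdorff dimension and finitely many spanning sections -/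

theorem dimH_range_le_of_contMDiff {E : Type*} [NormedAddCommGroup E] [NormedSpace ℝ E]
    [FiniteDimensional ℝ E] {H : Type*} [TopologicalSpace H] {I : ModelWithCorners ℝ E H}
    [I.Boundaryless] {M : Type*} [TopologicalSpace M] [ChartedSpace H M] [IsManifold I ∞ M]
    [SigmaCompactSpace M] {G : Type*} [NormedAddCommGroup G] [NormedSpace ℝ G] {f : M → G}
    (hf : ContMDiff I 𝓘(ℝ, G) ∞ f) : dimH (Set.range f) ≤ Module.finrank ℝ E := by
  obtain ⟨s, hs, hcover⟩ := countable_cover_nhds_of_sigmaCompact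
    (fun x : M => extChartAt_source_mem_nhds (I := I) x)
  have hrange : Set.range f ⊆ ⋃ x ∈ s, (f ∘ (extChartAt I x).symm) '' (extChartAt I x).target := by
    rintro _ ⟨m, rfl⟩
    have hm : m ∈ ⋃ x ∈ s, (extChartAt I x).source := hcover ▸ mem_univ m
    simp only [mem_iUnion] at hm ⊢
    obtain ⟨x, hx, hmx⟩ := hm
    exact ⟨x, hx, extChartAt I x m, (extChartAt I x).map_source hmx,
      congrArg f ((extChartAt I x).left_inv hmx)⟩
  refine (dimH_mono hrange).trans ?_
  rw [dimH_bUnion hs]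
  refine iSup₂_le fun x _ => ?_
  have hopen := isOpen_extChartAt_target (I := I) x
  have hsm : ContDiffOn ℝ ∞ (f ∘ (extChartAt I x).symm) (extChartAt I x).target :=
    (hf.comp_contMDiffOn (contMDiffOn_extChartAt_symm x)).contDiffOn
  -- Each chart expression is locally Lipschitz, so it does not raise Hausdorff dimension; countably
  -- many charts suffice.
  refine (dimH_image_le_of_locally_lipschitzOn fun y hy => ?_).trans
    ((dimH_mono (subset_univ _)).trans (Real.dimH_univ_eq_finrank E).le)
  obtain ⟨C, t, ht, hC⟩ := ((hsm.contDiffAt (hopen.mem_nhds hy)).of_le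
    (by simp)).exists_lipschitzOnWith
  exact ⟨C, t, nhdsWithin_le_nhds ht, hC⟩

theorem exists_functional_of_ne_top {N : Type*} [TopologicalSpace N]
    (F : Type*) [NormedAddCommGroup F] [NormedSpace ℝ F] [FiniteDimensional ℝ F]
    {V : N → Type*} [TopologicalSpace (Bundle.TotalSpace F V)] [∀ x, TopologicalSpace (V x)]
    [∀ x, AddCommGroup (V x)] [∀ x, Module ℝ (V x)] [FiberBundle F V] [VectorBundle ℝ F V] {x : N} {S : Submodule ℝ (V x)} (hS : S ≠ ⊤) :
    ∃ ξ : V x →L[ℝ] ℝ, ξ ≠ 0 ∧ ∀ v ∈ S, ξ v = 0 := by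
  let e := (trivializationAt F V x).continuousLinearEquivAt ℝ x
    (FiberBundle.mem_baseSet_trivializationAt' x)
  obtain ⟨f, hf, hS'⟩ := Submodule.exists_le_ker_of_lt_top _ hS.lt_top
  let g : F →L[ℝ] ℝ := LinearMap.toContinuousLinearMap (f ∘ₗ e.symm.toLinearEquiv.toLinearMap)
  have hg (v : V x) : g.comp (e : V x →L[ℝ] F) v = f v :=
    congrArg f (e.symm_apply_apply v)
  refine ⟨g.comp (e : V x →L[ℝ] F), fun h => hf ?_, fun v hv => ?_⟩
  · ext v
    rw [← hg v, h]; rfl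
  · rw [hg]; exact hS' hv

section Generation

variable {E : Type*} [NormedAddCommGroup E] [NormedSpace ℝ E]
  {N : Type*} [TopologicalSpace N] [ChartedSpace E N]
  {F : Type*} [NormedAddCommGroup F] [NormedSpace ℝ F]
  {V : N → Type*} [TopologicalSpace (Bundle.TotalSpace F V)] [∀ x, TopologicalSpace (V x)]
  [∀ x, AddCommGroup (V x)] [∀ x, Module ℝ (V x)] [FiberBundle F V] [VectorBundle ℝ F V]
  

/-- The sections in the subspace `W` span the fibres of the bundle over the set `K`. -/
def SpansOn (W : Submodule ℝ Cₛ^∞⟮𝓘(ℝ, E); F, V⟯) (K : Set N) : Prop :=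
  ∀ x ∈ K, ∀ v : V x, ∃ s ∈ W, s x = v

theorem SpansOn.mono {W W' : Submodule ℝ Cₛ^∞⟮𝓘(ℝ, E); F, V⟯} {K K' : Set N} (h : SpansOn W K)
    (hW : W ≤ W') (hK : K' ⊆ K) : SpansOn W' K' := fun x hx v =>
  let ⟨s, hs, hv⟩ := h x (hK hx) v
  ⟨s, hW hs, hv⟩

variable (E) in
/-- Evaluation of sections at a point. -/
def evalSection (x : N) : Cₛ^∞⟮𝓘(ℝ, E); F, V⟯ →ₗ[ℝ] V x where
  toFun s := s x
  map_add' _ _ := rfl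
  map_smul' _ _ := rfl

variable [FiniteDimensional ℝ E] [IsManifold 𝓘(ℝ, E) ∞ N] [FiniteDimensional ℝ F]
  [ContMDiffVectorBundle ∞ F V 𝓘(ℝ, E)]

/-- A space of sections which spans the fibres over `K` and whose dimension is larger than the one
of the dual bundle contains a smaller space with the same property. -/
theorem SpansOn.exists_smaller [SigmaCompactSpace N]
    {W : Submodule ℝ Cₛ^∞⟮𝓘(ℝ, E); F, V⟯} [FiniteDimensional ℝ W]
    {K : Set N} (h : SpansOn W K)
    (hd : Module.finrank ℝ (E × (F →L[ℝ] ℝ)) < Module.finrank ℝ W) :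
    ∃ W' : Submodule ℝ Cₛ^∞⟮𝓘(ℝ, E); F, V⟯, FiniteDimensional ℝ W' ∧
      Module.finrank ℝ W' < Module.finrank ℝ W ∧ SpansOn W' K := by
  rcases K.eq_empty_or_nonempty with rfl | ⟨x₀, hx₀⟩
  · exact ⟨⊥, inferInstance, by simpa using (Nat.zero_le _).trans_lt hd, fun x hx => hx.elim⟩
  have : LocallyCompactSpace N := Manifold.locallyCompact_of_finiteDimensional 𝓘(ℝ, E)
  have : SigmaCompactSpace (DualBundle F V) := sigmaCompactSpace_totalSpace _ _
  let b := Module.finBasis ℝ W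
  -- Dimension count in place of Sard's theorem: Ψ records ξ ∘ ev_x as a functional on `W`. Its
  -- image has Hausdorff dimension less than dim W, so some functional Λ on `W` is not of this form.
  -- The kernel of Λ still spans.
  let Ψ : DualBundle F V → Fin (Module.finrank ℝ W) → ℝ :=
    fun m i => linearFunction (b i : Cₛ^∞⟮𝓘(ℝ, E); F, V⟯) m
  have hΨ : ContMDiff (𝓘(ℝ, E).prod 𝓘(ℝ, F →L[ℝ] ℝ)) 𝓘(ℝ, Fin (Module.finrank ℝ W) → ℝ) ∞ Ψ :=
    contMDiff_pi_space.2 fun i => (linearFunction _).contMDiff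
  have hdim : dimH (Set.range Ψ) < Module.finrank ℝ (Fin (Module.finrank ℝ W) → ℝ) := by
    refine (dimH_range_le_of_contMDiff hΨ).trans_lt ?_
    rw [Module.finrank_fin_fun]
    exact_mod_cast hd
  obtain ⟨lam, hlam⟩ := (dense_compl_of_dimH_lt_finrank hdim).nonempty
  let Λ : W →ₗ[ℝ] ℝ := b.constr ℝ lam
  have hΛb (i) : Λ (b i) = lam i := b.constr_basis ℝ lam i
  -- The zero functional comes from the zero covector over `x₀`; this is why empty `K` is treated
  -- apart.
  have hΛ : Λ ≠ 0 := fun h0 => hlam ⟨⟨x₀, 0⟩, funext fun i => by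
    rw [← hΛb, h0]; rfl⟩
  refine ⟨(LinearMap.ker Λ).map W.subtype, inferInstance, ?_, ?_⟩
  · rw [Submodule.finrank_map_subtype_eq]
    exact Submodule.finrank_lt (fun h0 => hΛ (LinearMap.ker_eq_top.1 h0))
  · intro x hx
    by_contra! hcon
    obtain ⟨v, hv⟩ := hcon
    have hne : ((LinearMap.ker Λ).map W.subtype).map (evalSection E x) ≠ ⊤ := fun htop => by
      obtain ⟨s, hs, hsv⟩ : v ∈ ((LinearMap.ker Λ).map W.subtype).map (evalSection E x) :=
        htop ▸ Submodule.mem_top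
      exact hv s hs hsv
    obtain ⟨ξ, hξ, hξ0⟩ := exists_functional_of_ne_top F hne
    let f : W →ₗ[ℝ] ℝ := ξ.toLinearMap ∘ₗ evalSection E x ∘ₗ W.subtype
    -- If the values of ker Λ at `x` were annihilated by ξ ≠ 0, then ξ ∘ ev_x would be a multiple c
    -- Λ. Since `W` spans at `x`, c ≠ 0, and Λ would be the functional of c⁻¹ξ, against its choice.
    have hker : ⨅ _ : Unit, LinearMap.ker Λ ≤ LinearMap.ker f := by
      rw [iInf_const]
      intro w hw
      exact hξ0 _ ⟨w, ⟨w, hw, rfl⟩, rfl⟩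
    have hmem := mem_span_of_iInf_ker_le_ker (L := fun _ : Unit => Λ) hker
    rw [range_const, Submodule.mem_span_singleton] at hmem
    obtain ⟨c, hc⟩ := hmem
    have hc0 : c ≠ 0 := by
      rintro rfl
      refine hξ ?_
      ext v
      obtain ⟨s, hs, rfl⟩ := h x hx v
      have := LinearMap.congr_fun hc ⟨s, hs⟩
      rw [zero_smul] at this
      exact this.symm
    refine hlam ⟨⟨x, c⁻¹ • ξ⟩, funext fun i => ?_⟩
    change c⁻¹ * f (b i) = lam i
    rw [← hc, ← hΛb]
    exact inv_mul_cancel_left₀ hc0 _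

variable [T2Space N]

theorem exists_spansOn_nhds (x₀ : N) : ∃ O ∈ 𝓝 x₀,
    ∃ W : Submodule ℝ Cₛ^∞⟮𝓘(ℝ, E); F, V⟯, FiniteDimensional ℝ W ∧ SpansOn W O := by
  obtain ⟨O, hO, hxO, hOb, -, hs, -⟩ := exists_local_sections E F V x₀
  choose s hs using hs
  let b := Module.finBasis ℝ F
  refine ⟨O, hO.mem_nhds hxO, Submodule.span ℝ (Set.range fun j => s (b j)),
    FiniteDimensional.span_of_finite ℝ (finite_range _), fun x hx v => ?_⟩
  let e := trivializationAt F V x₀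
  refine ⟨∑ j, b.repr (e ⟨x, v⟩).2 j • s (b j), Submodule.sum_mem _ fun j _ =>
    Submodule.smul_mem _ _ (Submodule.subset_span ⟨j, rfl⟩), ?_⟩
  have h1 : (∑ j, b.repr (e ⟨x, v⟩).2 j • s (b j)) x =
      ∑ j, b.repr (e ⟨x, v⟩).2 j • e.symm x (b j) := by
    refine (map_sum (evalSection E x) _ _).trans (Finset.sum_congr rfl fun j _ => ?_)
    rw [map_smul, ← hs (b j) x hx]; rfl
  have h2 : ∑ j, b.repr (e ⟨x, v⟩).2 j • e.symm x (b j) = e.symmL ℝ x (e ⟨x, v⟩).2 := by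
    conv_rhs => rw [← b.sum_repr (e ⟨x, v⟩).2, map_sum]
    exact Finset.sum_congr rfl fun j _ => by rw [map_smul, e.symmL_apply (hOb hx)]
  rw [h1, h2, e.symmL_apply (hOb hx)]
  exact e.symm_apply_apply_mk (hOb hx) v

theorem exists_spansOn_of_isCompact {K : Set N} (hK : IsCompact K) :
    ∃ W : Submodule ℝ Cₛ^∞⟮𝓘(ℝ, E); F, V⟯, FiniteDimensional ℝ W ∧ SpansOn W K := by
  refine hK.induction_on (p := fun K => ∃ W : Submodule ℝ Cₛ^∞⟮𝓘(ℝ, E); F, V⟯,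
    FiniteDimensional ℝ W ∧ SpansOn W K) ⟨⊥, inferInstance, fun x hx => hx.elim⟩ ?_ ?_ ?_
  · rintro s t hst ⟨W, hW, h⟩
    exact ⟨W, hW, h.mono le_rfl hst⟩
  · rintro s t ⟨W, hW, h⟩ ⟨W', hW', h'⟩
    refine ⟨W ⊔ W', inferInstance, ?_⟩
    rintro x (hx | hx)
    · exact h.mono le_sup_left subset_rfl x hx
    · exact h'.mono le_sup_right subset_rfl x hx
  · intro x _
    obtain ⟨O, hO, W, hW, h⟩ := exists_spansOn_nhds (E := E) (F := F) (V := V) x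
    exact ⟨O, nhdsWithin_le_nhds hO, W, hW, h⟩

variable [SigmaCompactSpace N]

/-- The number of sections does not depend on `K`. This uniform bound is what permits gluing over an
exhaustion. -/
theorem exists_spansOn_finrank_le {K : Set N} (hK : IsCompact K) :
    ∃ t : Fin (Module.finrank ℝ (E × (F →L[ℝ] ℝ))) → Cₛ^∞⟮𝓘(ℝ, E); F, V⟯,
      SpansOn (Submodule.span ℝ (Set.range t)) K := by
  obtain ⟨W₀, hW₀, h₀⟩ := exists_spansOn_of_isCompact (E := E) (F := F) (V := V) hK
  have key (n : ℕ) : ∀ W : Submodule ℝ Cₛ^∞⟮𝓘(ℝ, E); F, V⟯, FiniteDimensional ℝ W →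
      Module.finrank ℝ W = n → SpansOn W K → ∃ W' : Submodule ℝ Cₛ^∞⟮𝓘(ℝ, E); F, V⟯,
        FiniteDimensional ℝ W' ∧
        Module.finrank ℝ W' ≤ Module.finrank ℝ (E × (F →L[ℝ] ℝ)) ∧ SpansOn W' K := by
    induction n using Nat.strong_induction_on with
    | _ n ih =>
      intro W hW hn h
      by_cases hd : Module.finrank ℝ (E × (F →L[ℝ] ℝ)) < Module.finrank ℝ W
      · obtain ⟨W', hW', hlt, h'⟩ := h.exists_smaller hd
        exact ih _ (hn ▸ hlt) W' hW' rfl h'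
      · exact ⟨W, hW, not_lt.1 hd, h⟩
  obtain ⟨W, hW, hd, h⟩ := key _ W₀ hW₀ rfl h₀
  let b := Module.finBasis ℝ W
  refine ⟨fun i => if hi : (i : ℕ) < Module.finrank ℝ W then b ⟨i, hi⟩ else 0,
    h.mono (fun w hw => ?_) subset_rfl⟩
  have h1 : w = ∑ i, b.repr ⟨w, hw⟩ i • (b i : Cₛ^∞⟮𝓘(ℝ, E); F, V⟯) := by
    have := congrArg W.subtype (b.sum_repr ⟨w, hw⟩)
    rw [map_sum] at this
    exact this.symm
  rw [h1]
  refine Submodule.sum_mem _ fun i _ => Submodule.smul_mem _ _ (Submodule.subset_span ?_)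
  exact ⟨⟨i, i.2.trans_le hd⟩, by simp⟩

variable (E F V) in
/-- The sections of a vector bundle over a `σ`-compact manifold are spanned pointwise by finitely
many of them. -/
theorem exists_finite_spanning : ∃ (n : ℕ) (s : Fin n → Cₛ^∞⟮𝓘(ℝ, E); F, V⟯),
    ∀ (x : N) (v : V x), ∃ c : Fin n → ℝ, v = ∑ i, c i • s i x := by
  have : LocallyCompactSpace N := Manifold.locallyCompact_of_finiteDimensional 𝓘(ℝ, E)
  -- The shifted exhaustion starts with the empty set, so every point lies in some K (n + 1) \ K n.
  let K : CompactExhaustion N := (default : CompactExhaustion N).shiftr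
  have hKx (x : N) : ∃ n, x ∈ K (n + 1) \ K n := ⟨_, CompactExhaustion.mem_sdiff_shiftr_find _ x⟩
  let U (n : ℕ) : Set N := interior (K (n + 2)) \ K n
  have hU (n) : IsOpen (U n) := isOpen_interior.sdiff (K.isCompact n).isClosed
  have hcover : univ ⊆ ⋃ n, U n := fun x _ => by
    obtain ⟨n, h1, h2⟩ := hKx x
    exact mem_iUnion.2 ⟨n, K.subset_interior_succ _ h1, h2⟩
  -- Shells with distinct indices of the same parity are disjoint. Summing the sections ρ_j t_{j,k}
  -- over one parity class therefore keeps a single term at each point, and 2d sections are enough.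
  have hdisj {x : N} {i j : ℕ} (hi : x ∈ U i) (hj : x ∈ U j) (hij : i % 2 = j % 2) : i = j := by
    by_contra hne
    wlog hlt : i < j generalizing i j
    · exact this hj hi hij.symm (Ne.symm hne) (by omega)
    exact hj.2 (K.subset (by omega : i + 2 ≤ j) (interior_subset hi.1))
  obtain ⟨ρ, hρ⟩ := SmoothPartitionOfUnity.exists_isSubordinate 𝓘(ℝ, E) isClosed_univ U hU hcover
  choose t ht using fun n => exists_spansOn_finrank_le (E := E) (F := F) (V := V)
    (K.isCompact (n + 2))
  let d := Module.finrank ℝ (E × (F →L[ℝ] ℝ))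
  let τ (p : Fin 2) (k : Fin d) (j : ℕ) (x : N) : V x :=
    (if j % 2 = p then ρ j x else 0) • t j k x
  have hne {p k j x} (h : τ p k j x ≠ 0) : j % 2 = p ∧ x ∈ U j := by
    have h1 : (if j % 2 = p then ρ j x else 0) ≠ 0 := fun h0 => h (by
      simp only [τ]; rw [h0, zero_smul])
    have h2 : j % 2 = p := by by_contra h2; simp [h2] at h1
    rw [if_pos h2] at h1
    exact ⟨h2, hρ j (subset_tsupport _ h1)⟩
  have hfin (p k) : LocallyFinite fun j => {x | τ p k j x ≠ 0} := by
    refine ρ.locallyFinite.subset fun j x (hx : τ p k j x ≠ 0) => ?_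
    intro h0
    refine hx ?_
    simp only [τ]
    rw [h0, ite_self, zero_smul]
  have hsm (p k j) : CMDiff ∞ (T% (τ p k j)) := by
    by_cases h : j % 2 = (p : ℕ)
    · have : τ p k j = (ρ j : N → ℝ) • ⇑(t j k) := by
        funext x; simp only [τ, if_pos h]; rfl
      rw [this]
      exact (ρ j).contMDiff.smul_section (t j k).contMDiff
    · have : τ p k j = ⇑(0 : Cₛ^∞⟮𝓘(ℝ, E); F, V⟯) := by
        funext x; simp only [τ, if_neg h]; exact zero_smul _ _
      rw [this]
      exact (0 : Cₛ^∞⟮𝓘(ℝ, E); F, V⟯).contMDiff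
  let s (q : Fin 2 × Fin d) : Cₛ^∞⟮𝓘(ℝ, E); F, V⟯ :=
    ⟨fun x => ∑ᶠ j, τ q.1 q.2 j x, ContMDiff.finsum_section_of_locallyFinite (hfin _ _) (hsm _ _)⟩
  refine ⟨2 * d, fun i => s (finProdFinEquiv.symm i), fun x v => ?_⟩
  suffices hq : ∃ c : Fin 2 × Fin d → ℝ, v = ∑ q, c q • s q x by
    obtain ⟨c, hc⟩ := hq
    refine ⟨c ∘ finProdFinEquiv.symm, hc.trans ?_⟩
    exact (Equiv.sum_comp finProdFinEquiv.symm (fun q => c q • s q x)).symm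
  obtain ⟨j, hj⟩ := ρ.exists_pos_of_mem (mem_univ x)
  have hxU : x ∈ U j := hρ j (subset_tsupport _ hj.ne')
  obtain ⟨w, hw, hwv⟩ := ht j x (interior_subset hxU.1) v
  obtain ⟨c, rfl⟩ := (Submodule.mem_span_range_iff_exists_fun ℝ).1 hw
  let p₀ : Fin 2 := ⟨j % 2, Nat.mod_lt _ two_pos⟩
  have hs (k : Fin d) : s (p₀, k) x = ρ j x • t j k x := by
    change ∑ᶠ j, τ p₀ k j x = _
    rw [finsum_eq_single _ j fun j' hj' => ?_]
    · simp [τ, p₀]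
    · by_contra h0
      obtain ⟨h1, h2⟩ := hne h0
      exact hj' (hdisj h2 hxU h1)
  refine ⟨fun q => if q.1 = p₀ then (ρ j x)⁻¹ * c q.2 else 0, ?_⟩
  rw [Fintype.sum_prod_type, Finset.sum_eq_single p₀ (fun p _ hp => by simp [hp]) (by simp)]
  rw [← hwv]
  refine (map_sum (evalSection E x) _ _).trans (Finset.sum_congr rfl fun k _ => ?_)
  beta_reduce
  rw [if_pos rfl, hs, smul_smul, mul_comm, ← mul_assoc, mul_inv_cancel₀ hj.ne', one_mul]
  rfl

end Generation

/-! ### Gram operators and dual families -/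

section Gram

variable {F : Type*} [NormedAddCommGroup F] [NormedSpace ℝ F]
  {J : Type*} [Fintype J]

/-- The operator `η ↦ ∑ i, η (w i) • w i` from the dual space attached to a finite family. -/
def gramOperator (w : J → F) : (F →L[ℝ] ℝ) →L[ℝ] F :=
  ∑ i, (ContinuousLinearMap.apply ℝ ℝ (w i)).smulRight (w i)

theorem gramOperator_apply (w : J → F) (η : F →L[ℝ] ℝ) :
    gramOperator w η = ∑ i, η (w i) • w i := by
  rw [gramOperator, _root_.sum_apply]; rfl

theorem contDiff_gramOperator : ContDiff ℝ ∞ (gramOperator : (J → F) → _) := by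
  refine ContDiff.sum fun i _ => ?_
  have h1 : ContDiff ℝ ∞ fun w : J → F => w i := contDiff_apply ℝ F i
  exact ((ContinuousLinearMap.apply ℝ ℝ : F →L[ℝ] _).contDiff.comp h1).smulRight h1

variable [FiniteDimensional ℝ F]

/-- Pairing η with its image under the Gram operator gives ∑ η(w_i)². If the image is zero, η
vanishes on a spanning set; equality of dimensions turns injectivity into invertibility. -/
theorem exists_gramEquiv {w : J → F} (hw : ⊤ ≤ Submodule.span ℝ (Set.range w)) :
    ∃ e : (F →L[ℝ] ℝ) ≃L[ℝ] F, (e : (F →L[ℝ] ℝ) →L[ℝ] F) = gramOperator w := by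
  have hinj : Function.Injective (gramOperator w).toLinearMap := by
    rw [injective_iff_map_eq_zero]
    intro η hη
    have h1 : ∑ i, η (w i) * η (w i) = 0 := by
      have := congrArg η ((gramOperator_apply w η).symm.trans hη)
      rw [map_sum, map_zero] at this
      simpa using this
    have h2 (i) : η (w i) = 0 := by
      have := (Finset.sum_eq_zero_iff_of_nonneg fun i _ => mul_self_nonneg (η (w i))).1 h1 i
        (Finset.mem_univ i)
      exact mul_self_eq_zero.1 this
    ext v
    have hv : v ∈ Submodule.span ℝ (Set.range w) := hw Submodule.mem_top
    have hle : Submodule.span ℝ (Set.range w) ≤ LinearMap.ker η.toLinearMap :=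
      Submodule.span_le.2 (by rintro _ ⟨i, rfl⟩; exact h2 i)
    exact hle hv
  have hrank : Module.finrank ℝ (F →L[ℝ] ℝ) = Module.finrank ℝ F :=
    (LinearMap.toContinuousLinearMap (𝕜 := ℝ) (E := F) (F' := ℝ)).finrank_eq.symm.trans
      Subspace.dual_finrank_eq
  refine ⟨(LinearEquiv.ofInjectiveOfFinrankEq (gramOperator w).toLinearMap hinj
    hrank).toContinuousLinearEquiv, ?_⟩
  ext η
  rfl

/-- The linear forms dual to a finite spanning family, see `sum_gramDual_smul`. -/
def gramDual (w : J → F) (i : J) (v : F) : ℝ :=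
  (gramOperator w).inverse v (w i)

theorem sum_gramDual_smul {w : J → F} (hw : ⊤ ≤ Submodule.span ℝ (Set.range w)) (v : F) :
    ∑ i, gramDual w i v • w i = v := by
  obtain ⟨e, he⟩ := exists_gramEquiv hw
  simp only [gramDual]
  rw [← gramOperator_apply, ← he, ContinuousLinearMap.inverse_equiv]
  exact e.apply_symm_apply v

/-- The Gram operator of g∘w is g G gᵗ, with G that of w, so the dual forms are natural and do not
depend on a trivialization of the bundle. -/
theorem gramDual_map {w : J → F} (hw : ⊤ ≤ Submodule.span ℝ (Set.range w)) (g : F ≃L[ℝ] F)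
    (i : J) (v : F) : gramDual (fun i => g (w i)) i (g v) = gramDual w i v := by
  have hgw : ⊤ ≤ Submodule.span ℝ (Set.range fun i => g (w i)) := by
    rw [show (fun i => g (w i)) = g.toLinearEquiv.toLinearMap ∘ w from rfl, range_comp,
      Submodule.span_image, top_le_iff.1 hw, Submodule.map_top]
    exact (LinearEquiv.range g.toLinearEquiv).ge
  obtain ⟨e, he⟩ := exists_gramEquiv hw
  obtain ⟨e', he'⟩ := exists_gramEquiv hgw
  simp only [gramDual]
  rw [← he, ← he', ContinuousLinearMap.inverse_equiv, ContinuousLinearMap.inverse_equiv]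
  have h1 (η : F →L[ℝ] ℝ) : e' η = g (e (η.comp (g : F →L[ℝ] F))) := by
    have h2 := gramOperator_apply (fun i => g (w i)) η
    have h3 := gramOperator_apply w (η.comp (g : F →L[ℝ] F))
    rw [← he'] at h2
    rw [← he] at h3
    refine h2.trans ?_
    refine Eq.trans ?_ (congrArg g h3.symm)
    rw [map_sum]
    exact Finset.sum_congr rfl fun i _ => (map_smul g _ _).symm
  have h4 : (e'.symm (g v)).comp (g : F →L[ℝ] F) = e.symm v := by
    rw [e.eq_symm_apply]
    apply g.injective
    rw [← h1, e'.apply_symm_apply]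
  exact congrArg (fun η : F →L[ℝ] ℝ => η (w i)) h4

set_option synthInstance.maxHeartbeats 200000 in
theorem contDiffAt_gramDual {w : J → F} (hw : ⊤ ≤ Submodule.span ℝ (Set.range w)) (i : J) (v : F) :
    ContDiffAt ℝ ∞ (fun p : (J → F) × F => gramDual p.1 i p.2) (w, v) := by
  obtain ⟨e, he⟩ := exists_gramEquiv hw
  have h1 : ContDiffAt ℝ ∞ (fun p : (J → F) × F => (gramOperator p.1).inverse) (w, v) := by
    have h2 : ContDiffAt ℝ ∞ (ContinuousLinearMap.inverse : ((F →L[ℝ] ℝ) →L[ℝ] F) → _)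
        (gramOperator w) := he ▸ contDiffAt_map_inverse e
    exact ContDiffAt.comp (w, v) h2 (contDiff_gramOperator.comp contDiff_fst).contDiffAt
  have h3 : ContDiffAt ℝ ∞ (fun p : (J → F) × F => p.1 i) (w, v) :=
    ((contDiff_apply ℝ F i).comp contDiff_fst).contDiffAt
  exact (h1.clm_apply contDiffAt_snd).clm_apply h3

end Gram

section DualFamily

variable {E : Type*} [NormedAddCommGroup E] [NormedSpace ℝ E]
  {N : Type*} [TopologicalSpace N] [ChartedSpace E N]
  {F : Type*} [NormedAddCommGroup F] [NormedSpace ℝ F] [FiniteDimensional ℝ F]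
  {V : N → Type*} [TopologicalSpace (Bundle.TotalSpace F V)] [∀ x, TopologicalSpace (V x)]
  [∀ x, AddCommGroup (V x)] [∀ x, Module ℝ (V x)] [FiberBundle F V] [VectorBundle ℝ F V]
  [ContMDiffVectorBundle ∞ F V 𝓘(ℝ, E)] {J : Type*} [Fintype J]

/-- Finitely many sections `s i` which span the fibres have a dual family `lam i` of sections of the
dual bundle, such that `v = ∑ i, lam i v • s i`. -/
theorem exists_dual_family (s : J → Cₛ^∞⟮𝓘(ℝ, E); F, V⟯)
    (hs : ∀ (x : N) (v : V x), ∃ c : J → ℝ, v = ∑ i, c i • s i x) :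
    ∃ lam : J → ∀ x, V x →L[ℝ] ℝ,
      (∀ i (α : Cₛ^∞⟮𝓘(ℝ, E); F, V⟯), ContMDiff 𝓘(ℝ, E) 𝓘(ℝ, ℝ) ∞ fun x => lam i x (α x)) ∧
      ∀ (x : N) (v : V x), v = ∑ i, lam i x v • s i x := by
  let e (x₀ x : N) (hx : x ∈ (trivializationAt F V x₀).baseSet) : V x ≃L[ℝ] F :=
    (trivializationAt F V x₀).continuousLinearEquivAt ℝ x hx
  have hspan (x₀ x : N) (hx : x ∈ (trivializationAt F V x₀).baseSet) :
      ⊤ ≤ Submodule.span ℝ (Set.range fun i => e x₀ x hx (s i x)) := fun v _ => by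
    obtain ⟨c, hc⟩ := hs x ((e x₀ x hx).symm v)
    have h1 := congrArg (e x₀ x hx) hc
    rw [ContinuousLinearEquiv.apply_symm_apply, map_sum] at h1
    rw [h1]
    refine Submodule.sum_mem _ fun i _ => ?_
    rw [map_smul]
    exact Submodule.smul_mem _ _ (Submodule.subset_span ⟨i, rfl⟩)
  have hmem (x : N) := FiberBundle.mem_baseSet_trivializationAt' (F := F) (E := V) x
  -- Each point uses its own preferred trivialization. By naturality the form is also computed in
  -- any fixed trivialization around the point, where smoothness is visible.
  let lam (i : J) (x : N) : V x →L[ℝ] ℝ :=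
    ((ContinuousLinearMap.apply ℝ ℝ (e x x (hmem x) (s i x))).comp
      (gramOperator fun i => e x x (hmem x) (s i x)).inverse).comp
        (e x x (hmem x) : V x →L[ℝ] F)
  have hlam (i x) (v : V x) (x₀ : N) (hx : x ∈ (trivializationAt F V x₀).baseSet) :
      lam i x v = gramDual (fun i => e x₀ x hx (s i x)) i (e x₀ x hx v) := by
    have h1 := gramDual_map (hspan x x (hmem x)) ((e x x (hmem x)).symm.trans (e x₀ x hx)) i
      (e x x (hmem x) v)
    simp only [ContinuousLinearEquiv.trans_apply, ContinuousLinearEquiv.symm_apply_apply] at h1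
    rw [h1]; rfl
  refine ⟨lam, fun i α x₀ => ?_, fun x v => ?_⟩
  · have hcoord (β : Cₛ^∞⟮𝓘(ℝ, E); F, V⟯) : ContMDiffAt 𝓘(ℝ, E) 𝓘(ℝ, F) ∞
        (fun x => (trivializationAt F V x₀ ⟨x, β x⟩).2) x₀ :=
      ((trivializationAt F V x₀).contMDiffAt_section_iff (hmem x₀)).1 (β.contMDiff x₀)
    have h1 : ContMDiffAt 𝓘(ℝ, E) 𝓘(ℝ, (J → F) × F) ∞
        (fun x => ((fun i => (trivializationAt F V x₀ ⟨x, s i x⟩).2),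
          (trivializationAt F V x₀ ⟨x, α x⟩).2)) x₀ :=
      (contMDiffAt_pi_space.2 fun i => hcoord (s i)).prodMk_space (hcoord α)
    have h2 := (contDiffAt_gramDual (hspan x₀ x₀ (hmem x₀)) i
      (e x₀ x₀ (hmem x₀) (α x₀))).contMDiffAt
    have h3 := ContMDiffAt.comp x₀ h2 h1
    refine h3.congr_of_eventuallyEq ?_
    filter_upwards [(trivializationAt F V x₀).open_baseSet.mem_nhds (hmem x₀)] with x hx
    exact hlam i x (α x) x₀ hx
  · apply (e x x (hmem x)).injective
    rw [map_sum]
    conv_lhs => rw [← sum_gramDual_smul (hspan x x (hmem x)) (e x x (hmem x) v)]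
    refine Finset.sum_congr rfl fun i _ => ?_
    rw [map_smul, hlam i x v x (hmem x)]

end DualFamily

section SpanningData

variable (E : Type*) [NormedAddCommGroup E] [NormedSpace ℝ E]
  {N : Type*} [TopologicalSpace N] [ChartedSpace E N]
  (F : Type*) [NormedAddCommGroup F] [NormedSpace ℝ F]
  (V : N → Type*) [TopologicalSpace (Bundle.TotalSpace F V)] [∀ x, TopologicalSpace (V x)]
  [∀ x, AddCommGroup (V x)] [∀ x, Module ℝ (V x)] [FiberBundle F V] [VectorBundle ℝ F V]

/-- A finite family of sections of a vector bundle together with a dual family of sections of the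
dual bundle: every vector `v` is `∑ i, form i v • sec i`. -/
structure SpanningFamily (J : Type*) [Fintype J] where
  sec : J → Cₛ^∞⟮𝓘(ℝ, E); F, V⟯
  form : J → ∀ x, V x →L[ℝ] ℝ
  smooth (i : J) (α : Cₛ^∞⟮𝓘(ℝ, E); F, V⟯) :
    ContMDiff 𝓘(ℝ, E) 𝓘(ℝ, ℝ) ∞ fun x => form i x (α x)
  sum_form_smul (x : N) (v : V x) : ∑ i, form i x v • sec i x = v

variable {E F V} {J : Type*} [Fintype J]

namespace SpanningFamily

/-- The coefficients of a section with respect to a spanning family. -/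
def coeff (𝓢 : SpanningFamily E F V J) (i : J) :
    Cₛ^∞⟮𝓘(ℝ, E); F, V⟯ →ₗ[C^∞⟮𝓘(ℝ, E), N; ℝ⟯] C^∞⟮𝓘(ℝ, E), N; ℝ⟯ where
  toFun α := ⟨fun x => 𝓢.form i x (α x), 𝓢.smooth i α⟩
  map_add' α β := by ext x; exact map_add (𝓢.form i x) (α x) (β x)
  map_smul' f α := by ext x; exact map_smul (𝓢.form i x) (f x) (α x)

theorem sum_coeff_smul (𝓢 : SpanningFamily E F V J) (α : Cₛ^∞⟮𝓘(ℝ, E); F, V⟯) :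
    ∑ i, 𝓢.coeff i α • 𝓢.sec i = α := by
  ext x
  refine (map_sum (evalSection E x) _ _).trans ?_
  exact 𝓢.sum_form_smul x (α x)

end SpanningFamily

theorem exists_spanningFamily [FiniteDimensional ℝ F] [ContMDiffVectorBundle ∞ F V 𝓘(ℝ, E)]
    (s : J → Cₛ^∞⟮𝓘(ℝ, E); F, V⟯)
    (hs : ∀ (x : N) (v : V x), ∃ c : J → ℝ, v = ∑ i, c i • s i x) :
    ∃ 𝓢 : SpanningFamily E F V J, 𝓢.sec = s := by
  obtain ⟨lam, h1, h2⟩ := exists_dual_family s hs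
  exact ⟨⟨s, lam, h1, fun x v => (h2 x v).symm⟩, rfl⟩

end SpanningData

/-! ### Splitting the anchor -/

section Connection

variable {E : Type*} [NormedAddCommGroup E] [NormedSpace ℝ E] [FiniteDimensional ℝ E]
  {N : Type*} [TopologicalSpace N] [ChartedSpace E N] [IsManifold 𝓘(ℝ, E) ∞ N]
  {F : Type*} [NormedAddCommGroup F] [NormedSpace ℝ F]
  {V : N → Type*} [TopologicalSpace (Bundle.TotalSpace F V)] [∀ x, TopologicalSpace (V x)]
  [∀ x, AddCommGroup (V x)] [∀ x, Module ℝ (V x)] [FiberBundle F V] [VectorBundle ℝ F V]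
  [LieAlgebroid E F V] {J : Type*} [Fintype J]

/-- The anchor of a transitive Lie algebroid has a right inverse which is linear over the smooth
functions. -/
theorem exists_anchor_section (𝓢 : SpanningFamily E F V J)
    (transitive : ∀ x : N, Function.Surjective (anchorAt E F V x)) :
    ∃ σ : Cₛ^∞⟮𝓘(ℝ, E); E, (TangentSpace 𝓘(ℝ, E) : N → Type _)⟯ →ₗ[C^∞⟮𝓘(ℝ, E), N; ℝ⟯]
      Cₛ^∞⟮𝓘(ℝ, E); F, V⟯, ∀ X, anchorHom E F V (σ X) = X := by
  obtain ⟨𝓣, h𝓣⟩ := exists_spanningFamily (E := E) (F := E)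
    (V := (TangentSpace 𝓘(ℝ, E) : N → Type _)) (fun i => anchorSection (𝓢.sec i)) fun x v => by
      obtain ⟨w, rfl⟩ := transitive x v
      refine ⟨fun i => 𝓢.form i x w, ?_⟩
      conv_lhs => rw [← 𝓢.sum_form_smul x w, map_sum]
      exact Finset.sum_congr rfl fun i _ => map_smul _ _ _
  -- With X = ∑ τ_i(X) ρ(s_i), where ρ is the anchor, the lift of X is ∑ τ_i(X) s_i.
  refine ⟨∑ i, (𝓣.coeff i).smulRight (𝓢.sec i), fun X => ?_⟩
  ext x
  have h1 : (∑ i, (𝓣.coeff i).smulRight (𝓢.sec i)) X x = ∑ i, 𝓣.form i x (X x) • 𝓢.sec i x := by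
    rw [LinearMap.sum_apply]
    exact map_sum (evalSection E x) _ _
  change anchorAt E F V x ((∑ i, (𝓣.coeff i).smulRight (𝓢.sec i)) X x) = X x
  rw [h1, map_sum]
  conv_rhs => rw [← 𝓣.sum_form_smul x (X x), h𝓣]
  exact Finset.sum_congr rfl fun i _ => map_smul _ _ _

end Connection

/-! ### Interpolation nodes and monomials -/

section Interpolation

/-- A finite-dimensional space of real functions has finitely many interpolation nodes. -/
theorem exists_interpolation {S : Type*} (W : Submodule ℝ (S → ℝ)) [FiniteDimensional ℝ W] :
    ∃ (t : Finset S) (e : t → W), ∀ w ∈ W, w = ∑ j : t, w j • (e j : S → ℝ) := by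
  let ev : S → Module.Dual ℝ W := fun s => (LinearMap.proj s).comp W.subtype
  -- Finitely many evaluations have the same span as all evaluations, so restriction to their nodes
  -- is injective on `W`. The `e j` are the images of the delta functions under a left inverse.
  obtain ⟨t', ht', hspan⟩ := (Submodule.fg_span_iff_fg_span_finset_subset (Set.range ev)).1
    (IsNoetherian.noetherian (Submodule.span ℝ (Set.range ev)))
  classical
  rw [← image_univ] at ht'
  obtain ⟨t, -, rfl⟩ := Finset.subset_set_image_iff.1 ht'
  let R : W →ₗ[ℝ] (t → ℝ) := LinearMap.pi fun j => ev j
  have hR : LinearMap.ker R = ⊥ := by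
    rw [LinearMap.ker_eq_bot']
    intro w hw
    have h1 : Submodule.span ℝ (Set.range ev) ≤ LinearMap.ker (Module.Dual.eval ℝ W w) := by
      rw [hspan, Submodule.span_le]
      intro η hη
      obtain ⟨j, hj, rfl⟩ := Finset.mem_image.1 hη
      exact congrFun hw ⟨j, hj⟩
    ext s
    exact h1 (Submodule.subset_span ⟨s, rfl⟩)
  obtain ⟨g, hg⟩ := R.exists_leftInverse_of_injective hR
  refine ⟨t, fun j => g (Pi.single j 1), fun w hw => ?_⟩
  have h2 : g (R ⟨w, hw⟩) = ⟨w, hw⟩ := LinearMap.congr_fun hg ⟨w, hw⟩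
  have h3 : R ⟨w, hw⟩ = ∑ j : t, w j • Pi.single (M := fun _ => ℝ) j 1 := by
    ext k
    simp [R, ev, Finset.sum_apply, Pi.single_apply]
  rw [h3, map_sum] at h2
  have h4 := congrArg Subtype.val h2
  rw [AddSubmonoidClass.coe_finsetSum] at h4
  refine h4.symm.trans (Finset.sum_congr rfl fun j _ => ?_)
  rw [map_smul]
  rfl

/-- The functions on `ℝ^J` spanned by the monomials of degree at most `d`. -/
def monomialSpan (J : Type*) (d : ℕ) : Submodule ℝ ((J → ℝ) → ℝ) :=
  Submodule.span ℝ (Set.range fun t : (k : Fin (d + 1)) × (Fin k → J) => fun y => ∏ l, y (t.2 l))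

instance (J : Type*) [Finite J] (d : ℕ) : FiniteDimensional ℝ (monomialSpan J d) :=
  FiniteDimensional.span_of_finite ℝ (Set.finite_range _)

theorem multilinear_mem_monomialSpan {J : Type*} [Fintype J] {d k : ℕ} (hk : k ≤ d) {X : Type*}
    [AddCommGroup X] [Module ℝ X] (q : MultilinearMap ℝ (fun _ : Fin k => X) ℝ) (w : J → X) :
    (fun y : J → ℝ => q fun _ => ∑ j, y j • w j) ∈ monomialSpan J d := by
  classical
  have h : (fun y : J → ℝ => q fun _ => ∑ j, y j • w j) =
      ∑ t : Fin k → J, q (fun l => w (t l)) • fun y : J → ℝ => ∏ l, y (t l) := by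
    ext y
    rw [MultilinearMap.map_sum, Finset.sum_apply]
    refine Finset.sum_congr rfl fun t _ => ?_
    rw [MultilinearMap.map_smul_univ]
    simp [mul_comm]
  rw [h]
  exact Submodule.sum_mem _ fun t _ => Submodule.smul_mem _ _
    (Submodule.subset_span ⟨⟨⟨k, by omega⟩, t⟩, rfl⟩)

/-- Links the exponent vectors of `MvPolynomial` with multilinear maps in `m.degree` arguments. -/
theorem exists_index_of_monomial {J : Type*} (m : J →₀ ℕ) :
    ∃ t : Fin m.degree → J, ∀ y : J → ℝ, ∏ l, y (t l) = m.prod fun j e => y j ^ e := by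
  classical
  have h1 : (Finsupp.toMultiset m).toList.length = m.degree := by
    rw [Multiset.length_toList, Finsupp.card_toMultiset]
    rfl
  refine ⟨fun l => (Finsupp.toMultiset m).toList.get (l.cast h1.symm), fun y => ?_⟩
  have h2 : ∏ l : Fin (Finsupp.toMultiset m).toList.length, y ((Finsupp.toMultiset m).toList.get l)
      = (((Finsupp.toMultiset m).toList).map y).prod := by
    rw [← List.prod_ofFn]
    congr 1
    exact List.ext_get (by simp) fun n _ _ => by simp
  have h3 : (((Finsupp.toMultiset m).toList).map y).prod = ((Finsupp.toMultiset m).map y).prod := by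
    conv_rhs => rw [← Multiset.coe_toList (Finsupp.toMultiset m)]
    rw [Multiset.map_coe, Multiset.prod_coe]
  have h4 : ((Finsupp.toMultiset m).map y).prod = m.prod fun j e => y j ^ e := by
    rw [Finsupp.toMultiset_map, Finsupp.prod_toMultiset, Finsupp.prod_mapDomain_index]
    · exact fun _ => pow_zero _
    · exact fun _ _ _ => pow_add _ _ _
  rw [← h4, ← h3, ← h2]
  exact (finCongr h1.symm).prod_comp fun l => y ((Finsupp.toMultiset m).toList.get l)

end Interpolation

/-! ### The symmetric algebra as fibrewise polynomial functions -/

section Frame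

variable {E : Type*} [NormedAddCommGroup E] [NormedSpace ℝ E]
  {N : Type*} [TopologicalSpace N] [ChartedSpace E N]
  {F : Type*} [NormedAddCommGroup F] [NormedSpace ℝ F]
  {V : N → Type*} [TopologicalSpace (Bundle.TotalSpace F V)] [∀ x, TopologicalSpace (V x)]
  [∀ x, AddCommGroup (V x)] [∀ x, Module ℝ (V x)] [FiberBundle F V] [VectorBundle ℝ F V]
  {J : Type*} [Fintype J]

namespace SpanningFamily

/-- The covector with given components with respect to the dual family. -/
def covector (𝓢 : SpanningFamily E F V J) (p : N × (J → ℝ)) : DualBundle F V :=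
  ⟨p.1, ∑ k, p.2 k • 𝓢.form k p.1⟩

theorem covector_apply (𝓢 : SpanningFamily E F V J) (p : N × (J → ℝ)) (v : V p.1) :
    (𝓢.covector p).2 v = ∑ k, p.2 k * 𝓢.form k p.1 v := by
  refine (_root_.sum_apply _ _ _).trans ?_
  rfl

/-- The components of a covector. -/
def components (𝓢 : SpanningFamily E F V J) (ξ : DualBundle F V) : N × (J → ℝ) :=
  (ξ.proj, fun k => ξ.2 (𝓢.sec k ξ.proj))

/-- The dual bundle is a retract of N × ℝ^J. Polynomials, smooth functions and derivations are
transported along this retraction. -/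
theorem covector_components (𝓢 : SpanningFamily E F V J) (ξ : DualBundle F V) :
    𝓢.covector (𝓢.components ξ) = ξ := by
  obtain ⟨x, η⟩ := ξ
  refine congrArg (fun η => (⟨x, η⟩ : DualBundle F V)) ?_
  refine ContinuousLinearMap.ext fun (v : V x) => ?_
  refine (𝓢.covector_apply (𝓢.components ⟨x, η⟩) v).trans ?_
  have h : η v = η (∑ i, 𝓢.form i x v • 𝓢.sec i x) :=
    congrArg η (𝓢.sum_form_smul x v).symm
  refine Eq.trans ?_ h.symm
  refine Eq.trans ?_ (map_sum η _ _).symm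
  exact Finset.sum_congr rfl fun k _ => (mul_comm _ _).trans (map_smul η _ _).symm

variable [ContMDiffVectorBundle ∞ F V 𝓘(ℝ, E)]

theorem linearFunction_covector (𝓢 : SpanningFamily E F V J) (α : Cₛ^∞⟮𝓘(ℝ, E); F, V⟯)
    (p : N × (J → ℝ)) :
    linearFunction α (𝓢.covector p) = ∑ k, p.2 k * 𝓢.coeff k α p.1 :=
  𝓢.covector_apply p (α p.1)

/-- The embedding of the symmetric algebra on the sections into a polynomial ring. -/
def toPolynomial (𝓢 : SpanningFamily E F V J) :
    SymmetricAlgebra C^∞⟮𝓘(ℝ, E), N; ℝ⟯ Cₛ^∞⟮𝓘(ℝ, E); F, V⟯ →ₐ[C^∞⟮𝓘(ℝ, E), N; ℝ⟯]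
      MvPolynomial J C^∞⟮𝓘(ℝ, E), N; ℝ⟯ :=
  SymmetricAlgebra.lift (∑ k, (𝓢.coeff k).smulRight (MvPolynomial.X k))

theorem toPolynomial_ι (𝓢 : SpanningFamily E F V J) (α : Cₛ^∞⟮𝓘(ℝ, E); F, V⟯) :
    𝓢.toPolynomial (SymmetricAlgebra.ι _ _ α) =
      ∑ k, 𝓢.coeff k α • (MvPolynomial.X k : MvPolynomial J C^∞⟮𝓘(ℝ, E), N; ℝ⟯) := by
  rw [toPolynomial, SymmetricAlgebra.lift_ι_apply, LinearMap.sum_apply]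
  rfl

/-- Since L is a retract of A^J, its symmetric algebra is a retract of the polynomial ring; in
particular `toPolynomial` is injective. -/
theorem aeval_toPolynomial (𝓢 : SpanningFamily E F V J)
    (u : SymmetricAlgebra C^∞⟮𝓘(ℝ, E), N; ℝ⟯ Cₛ^∞⟮𝓘(ℝ, E); F, V⟯) :
    MvPolynomial.aeval (fun k => SymmetricAlgebra.ι _ _ (𝓢.sec k)) (𝓢.toPolynomial u) = u := by
  have h : (MvPolynomial.aeval (fun k => SymmetricAlgebra.ι _ _ (𝓢.sec k))).comp 𝓢.toPolynomial =
      AlgHom.id C^∞⟮𝓘(ℝ, E), N; ℝ⟯ _ := by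
    refine SymmetricAlgebra.algHom_ext (LinearMap.ext fun α => ?_)
    change MvPolynomial.aeval (fun k => SymmetricAlgebra.ι _ _ (𝓢.sec k))
      (𝓢.toPolynomial (SymmetricAlgebra.ι _ _ α)) = SymmetricAlgebra.ι _ _ α
    rw [toPolynomial_ι, map_sum]
    conv_rhs => rw [← 𝓢.sum_coeff_smul α, map_sum]
    refine Finset.sum_congr rfl fun k _ => ?_
    rw [map_smul, map_smul, MvPolynomial.aeval_X]
  exact AlgHom.congr_fun h u

theorem symToFunctions_covector (𝓢 : SpanningFamily E F V J)
    (u : SymmetricAlgebra C^∞⟮𝓘(ℝ, E), N; ℝ⟯ Cₛ^∞⟮𝓘(ℝ, E); F, V⟯) (p : N × (J → ℝ)) :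
    symToFunctions E F V u (𝓢.covector p) =
      MvPolynomial.eval₂ (ContMDiffMap.evalRingHom p.1) p.2 (𝓢.toPolynomial u) := by
  induction u using SymmetricAlgebra.induction with
  | algebraMap a =>
    rw [symToFunctions_algebraMap, AlgHom.commutes]
    exact (MvPolynomial.eval₂_C (ContMDiffMap.evalRingHom p.1) p.2 a).symm
  | ι α =>
    rw [symToFunctions_ι, linearFunction_covector, toPolynomial_ι, MvPolynomial.eval₂_sum]
    refine Finset.sum_congr rfl fun k _ => ?_
    rw [MvPolynomial.smul_eq_C_mul, MvPolynomial.eval₂_mul,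
      MvPolynomial.eval₂_C, MvPolynomial.eval₂_X, mul_comm]
    rfl
  | mul u v hu hv =>
    rw [map_mul, map_mul, MvPolynomial.eval₂_mul, ← hu, ← hv]; rfl
  | add u v hu hv =>
    rw [map_add, map_add, MvPolynomial.eval₂_add, ← hu, ← hv]; rfl

/-- Over each base point the function on ℝ^J given by `covector` is a real polynomial. If it
vanishes, so do its coefficients, as ℝ is infinite; hence `toPolynomial` sends the element to zero.
-/
theorem symToFunctions_injective (𝓢 : SpanningFamily E F V J) :
    Function.Injective (symToFunctions E F V) := by
  rw [injective_iff_map_eq_zero]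
  intro u hu
  have h1 : 𝓢.toPolynomial u = 0 := by
    ext m x
    have h2 : MvPolynomial.map (ContMDiffMap.evalRingHom x) (𝓢.toPolynomial u) = 0 := by
      refine MvPolynomial.funext fun y => ?_
      rw [MvPolynomial.eval_map, map_zero, ← 𝓢.symToFunctions_covector u (x, y), hu]
      rfl
    have h3 := congrArg (MvPolynomial.coeff m) h2
    rw [MvPolynomial.coeff_map, MvPolynomial.coeff_zero] at h3
    exact h3
  rw [← 𝓢.aeval_toPolynomial u, h1, map_zero]

theorem isFibrewisePolynomial_symToFunctions (𝓢 : SpanningFamily E F V J)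
    (u : SymmetricAlgebra C^∞⟮𝓘(ℝ, E), N; ℝ⟯ Cₛ^∞⟮𝓘(ℝ, E); F, V⟯) :
    IsFibrewisePolynomial (symToFunctions E F V u) := by
  classical
  choose t ht using fun m : J →₀ ℕ => exists_index_of_monomial m
  set q := 𝓢.toPolynomial u with hq
  let term (x : N) (m : J →₀ ℕ) : MultilinearMap ℝ (fun _ : Fin m.degree => V x →L[ℝ] ℝ) ℝ :=
    q.coeff m x • (MultilinearMap.mkPiAlgebra ℝ (Fin m.degree) ℝ).compLinearMap
      fun l => (LinearMap.applyₗ (𝓢.sec (t m l) x)).comp (ContinuousLinearMap.coeLM ℝ)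
  -- The component of degree k collects the monomials of that degree; `domDomCongr` only identifies
  -- `Fin m.degree` with `Fin k`.
  refine ⟨q.totalDegree, fun x => ⟨fun k => ∑ m ∈ q.support,
    if h : m.degree = k then (term x m).domDomCongr (finCongr h) else 0, fun ξ => ?_⟩⟩
  have h1 (k : ℕ) : (∑ m ∈ q.support,
      if h : m.degree = k then (term x m).domDomCongr (finCongr h) else 0) (fun _ => ξ) =
      ∑ m ∈ q.support with m.degree = k, term x m (fun _ => ξ) := by
    rw [_root_.sum_apply, Finset.sum_filter]
    refine Finset.sum_congr rfl fun m _ => ?_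
    split_ifs with h
    · rfl
    · rfl
  simp only [h1]
  rw [Finset.sum_fiberwise_of_maps_to fun m hm => Finset.mem_range_succ_iff.2 ?_]
  · have h2 := 𝓢.symToFunctions_covector u (𝓢.components ⟨x, ξ⟩)
    rw [𝓢.covector_components] at h2
    rw [h2, MvPolynomial.eval₂_eq]
    refine Finset.sum_congr rfl fun m _ => ?_
    exact congrArg (q.coeff m x * ·) (ht m (𝓢.components ⟨x, ξ⟩).2).symm
  · exact MvPolynomial.le_totalDegree hm

theorem mem_range_of_mem_monomialSpan (𝓢 : SpanningFamily E F V J) {d : ℕ} {w : (J → ℝ) → ℝ}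
    (hw : w ∈ monomialSpan J d) :
    ∃ u, ∀ ξ : DualBundle F V, symToFunctions E F V u ξ = w (𝓢.components ξ).2 := by
  refine Submodule.span_induction ?_ ?_ ?_ ?_ hw
  · rintro _ ⟨⟨k, t⟩, rfl⟩
    refine ⟨∏ l, SymmetricAlgebra.ι _ _ (𝓢.sec (t l)), fun ξ => ?_⟩
    rw [map_prod]
    refine (map_prod (ContMDiffMap.evalRingHom ξ) _ _).trans ?_
    exact Finset.prod_congr rfl fun l _ => by rw [symToFunctions_ι]; rfl
  · exact ⟨0, fun ξ => by rw [map_zero]; rfl⟩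
  · rintro _ _ _ _ ⟨u, hu⟩ ⟨v, hv⟩
    exact ⟨u + v, fun ξ => by rw [map_add]; exact congrArg₂ (· + ·) (hu ξ) (hv ξ)⟩
  · rintro c _ _ ⟨u, hu⟩
    exact ⟨c • u, fun ξ => by rw [map_smul]; exact congrArg (c * ·) (hu ξ)⟩

variable [FiniteDimensional ℝ E] [T2Space N] [IsManifold 𝓘(ℝ, E) ∞ N] [FiniteDimensional ℝ F]

theorem contMDiff_covector (𝓢 : SpanningFamily E F V J) :
    ContMDiff (𝓘(ℝ, E).prod 𝓘(ℝ, J → ℝ)) (𝓘(ℝ, E).prod 𝓘(ℝ, F →L[ℝ] ℝ)) ∞ 𝓢.covector := by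
  intro p
  refine contMDiffAt_dual contMDiffAt_fst fun s => ?_
  have h1 (q : N × (J → ℝ)) : (𝓢.covector q).2 (s (𝓢.covector q).proj) =
      ∑ k, q.2 k * 𝓢.coeff k s q.1 := 𝓢.covector_apply q (s q.1)
  have h2 : ContMDiff (𝓘(ℝ, E).prod 𝓘(ℝ, J → ℝ)) 𝓘(ℝ, ℝ) ∞
      fun q : N × (J → ℝ) => ∑ k, q.2 k * 𝓢.coeff k s q.1 := by
    refine ContMDiff.sum fun k _ => ?_
    exact ((contDiff_apply ℝ ℝ k).contMDiff.comp contMDiff_snd).mul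
      ((𝓢.coeff k s).contMDiff.comp contMDiff_fst)
  exact (h2 p).congr_of_eventuallyEq (Eventually.of_forall h1)

/-- The hypothesis gives polynomials fibre by fibre, without regularity in the base point.
Interpolation at nodes y_j in ℝ^J independent of x repairs this: the coefficients are the values of
f at `covector (x, y_j)`, smooth in x, and the basis functions are polynomials independent of x. -/
theorem mem_range_of_isFibrewisePolynomial (𝓢 : SpanningFamily E F V J) {f : DualFunctions E F V}
    (hf : IsFibrewisePolynomial f) : f ∈ (symToFunctions E F V).range := by
  obtain ⟨d, hd⟩ := hf
  have h1 (x : N) : (fun y : J → ℝ => f (𝓢.covector (x, y))) ∈ monomialSpan J d := by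
    obtain ⟨q, hq⟩ := hd x
    have h2 : (fun y : J → ℝ => f (𝓢.covector (x, y))) = ∑ k ∈ Finset.range (d + 1),
        fun y => q k fun _ => ∑ j, y j • 𝓢.form j x := by
      ext y
      rw [Finset.sum_apply]
      exact hq _
    rw [h2]
    exact Submodule.sum_mem _ fun k hk =>
      multilinear_mem_monomialSpan (Finset.mem_range_succ_iff.1 hk) _ _
  obtain ⟨t, e, he⟩ := exists_interpolation (monomialSpan J d)
  choose u hu using fun j => 𝓢.mem_range_of_mem_monomialSpan (e j).2
  let a (y : J → ℝ) : C^∞⟮𝓘(ℝ, E), N; ℝ⟯ := ⟨fun x => f (𝓢.covector (x, y)),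
    f.contMDiff.comp (𝓢.contMDiff_covector.comp (contMDiff_id.prodMk contMDiff_const))⟩
  refine ⟨∑ j : t, algebraMap _ _ (a j) * u j, ?_⟩
  ext ξ
  change symToFunctions E F V _ ξ = _
  rw [map_sum, contMDiffMap_sum_apply]
  conv_rhs => rw [← 𝓢.covector_components ξ]
  have h3 := congrFun (he _ (h1 ξ.proj)) (𝓢.components ξ).2
  rw [Finset.sum_apply] at h3
  refine Eq.trans (Finset.sum_congr rfl fun j _ => ?_) h3.symm
  rw [map_mul, symToFunctions_algebraMap]
  exact congrArg (_ * ·) (hu j ξ)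

theorem mem_range_iff (𝓢 : SpanningFamily E F V J) (f : DualFunctions E F V) :
    f ∈ (symToFunctions E F V).range ↔ IsFibrewisePolynomial f := by
  refine ⟨?_, 𝓢.mem_range_of_isFibrewisePolynomial⟩
  rintro ⟨u, rfl⟩
  exact 𝓢.isFibrewisePolynomial_symToFunctions u

end SpanningFamily

end Frame

/-! ### A formula for the bracket through a connection with torsion -/

section InducedBracket

variable {A L P : Type*} [CommRing A] [Algebra ℝ A]
  [LieRing L] [LieAlgebra ℝ L] [Module A L] [LieRingModule L A]
  [LieRinehartRing A L] [CommRing P] [Algebra ℝ P] {J : Type*} [Fintype J]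

/-- The covariant derivative attached to a finite family of elements and a dual family of forms. -/
def frameConnection (s : J → L) (c : J → L →ₗ[A] A) (α β : L) : L :=
  ∑ k, ⁅α, c k β⁆ • s k

/-- The torsion of `frameConnection`. -/
def frameTorsion (s : J → L) (c : J → L →ₗ[A] A) (α β : L) : L :=
  ⁅α, β⁆ - frameConnection s c α β + frameConnection s c β α

section Torsion

variable (s : J → L) (c : J → L →ₗ[A] A) (hc : ∀ α, ∑ k, c k α • s k = α)

theorem frameConnection_add_left (α α' β : L) : frameConnection s c (α + α') β =
    frameConnection s c α β + frameConnection s c α' β := by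
  simp only [frameConnection, add_lie, add_smul, Finset.sum_add_distrib]

theorem frameConnection_add_right (α β β' : L) : frameConnection s c α (β + β') =
    frameConnection s c α β + frameConnection s c α β' := by
  simp only [frameConnection, map_add, lie_add, add_smul, Finset.sum_add_distrib]

theorem frameConnection_smul_left (f : A) (α β : L) :
    frameConnection s c (f • α) β = f • frameConnection s c α β := by
  simp only [frameConnection, Finset.smul_sum, LieRinehartRing.lie_smul_eq_mul, mul_smul]

theorem frameConnection_sum_smul_left (f : J → A) (x : J → L) (β : L) :
    frameConnection s c (∑ k, f k • x k) β = ∑ k, f k • frameConnection s c (x k) β := by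
  let T : L →ₗ[A] L := { toFun := fun α => frameConnection s c α β
                         map_add' := fun α α' => frameConnection_add_left s c α α' β
                         map_smul' := fun f α => frameConnection_smul_left s c f α β }
  refine (map_sum T _ _).trans (Finset.sum_congr rfl fun k _ => map_smul T _ _)

include hc in
theorem frameConnection_smul_right (f : A) (α β : L) :
    frameConnection s c α (f • β) = f • frameConnection s c α β + ⁅α, f⁆ • β := by
  have h : ⁅α, f⁆ • β = ∑ k, (⁅α, f⁆ * c k β) • s k := by
    conv_lhs => rw [← hc β, Finset.smul_sum]
    simp only [mul_smul]
  rw [h, frameConnection, frameConnection, Finset.smul_sum, ← Finset.sum_add_distrib]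
  refine Finset.sum_congr rfl fun k _ => ?_
  rw [map_smul, smul_eq_mul, LieRinehartRing.leibniz_mul_right, add_smul, smul_assoc]

theorem frameTorsion_skew (α β : L) : frameTorsion s c α β = -frameTorsion s c β α := by
  rw [frameTorsion, frameTorsion, ← lie_skew]; abel

theorem frameTorsion_add_right (α β β' : L) :
    frameTorsion s c α (β + β') = frameTorsion s c α β + frameTorsion s c α β' := by
  simp only [frameTorsion, frameConnection_add_left, frameConnection_add_right, lie_add]; abel

-- The derivative term ⁅α, f⁆ • β produced by the bracket cancels the one produced by the covariant
-- derivative. So torsion is tensorial, and it is determined by its values on the frame.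
include hc in
theorem frameTorsion_smul_right (f : A) (α β : L) :
    frameTorsion s c α (f • β) = f • frameTorsion s c α β := by
  simp only [frameTorsion, frameConnection_smul_left, frameConnection_smul_right s c hc,
    LieRinehartRing.leibniz_smul_right, smul_add, smul_sub]
  abel

include hc in
theorem sum_smul_frameTorsion_right (α β : L) :
    ∑ l, c l β • frameTorsion s c α (s l) = frameTorsion s c α β := by
  let T : L →ₗ[A] L := { toFun := frameTorsion s c α, map_add' := frameTorsion_add_right s c α
                         map_smul' := fun f => frameTorsion_smul_right s c hc f α }
  have h := congrArg T (hc β)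
  rw [map_sum] at h
  refine Eq.trans (Finset.sum_congr rfl fun l _ => ?_) h
  exact (map_smul T _ _).symm

include hc in
theorem sum_smul_frameTorsion (α β : L) :
    ∑ k, ∑ l, (c k α * c l β) • frameTorsion s c (s k) (s l) = frameTorsion s c α β := by
  simp only [mul_smul, ← Finset.smul_sum, sum_smul_frameTorsion_right s c hc]
  rw [frameTorsion_skew, ← sum_smul_frameTorsion_right s c hc, ← Finset.sum_neg_distrib]
  exact Finset.sum_congr rfl fun k _ => by rw [frameTorsion_skew, smul_neg]

end Torsion

/-- The `D k` are vertical and the `D' k` horizontal for ∇ = `frameConnection`. On linear functions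
of x and y the first sum gives ∇_x y − ∇_y x and the second gives the torsion, with total [x, y].
Any combination of products of derivations obeys the Leibniz rule, so only the values on generators
require work. -/
theorem exists_isInducedBracket (i : A →ₐ[ℝ] P) (j : L →+ P) (hj : ∀ a x, j (a • x) = i a * j x)
    (s : J → L) (c : J → L →ₗ[A] A) (hc : ∀ α, ∑ k, c k α • s k = α)
    (D D' : J → Derivation ℝ P P)
    (h1 : ∀ k a, D k (i a) = 0) (h2 : ∀ k x, D k (j x) = i (c k x))
    (h3 : ∀ k a, D' k (i a) = i ⁅s k, a⁆)
    (h4 : ∀ k x, D' k (j x) = j (frameConnection s c (s k) x)) :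
    ∃ B : SkewBiderivation ℝ P, IsInducedBracket i j B := by
  let t (k l : J) : P := j (frameTorsion s c (s k) (s l))
  have ht (k l : J) : t k l = -t l k := by
    rw [← map_neg, ← frameTorsion_skew]
  let b (f g : P) : P := ∑ k, (D k f * D' k g - D' k f * D k g) + ∑ k, ∑ l, t k l * D k f * D l g
  let B : SkewBiderivation ℝ P :=
    { toFun := LinearMap.mk₂ ℝ b
        (fun f f' g => by
          simp only [b, map_add, add_mul, mul_add, Finset.sum_add_distrib, Finset.sum_sub_distrib]
          ring)
        (fun r f g => by
          simp only [b, Derivation.map_smul, smul_mul_assoc, mul_smul_comm, ← smul_sub, ← Finset.smul_sum,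
            smul_add])
        (fun f g g' => by
          simp only [b, map_add, mul_add, Finset.sum_add_distrib, Finset.sum_sub_distrib]
          ring)
        (fun r f g => by
          simp only [b, Derivation.map_smul, mul_smul_comm, ← smul_sub, ← Finset.smul_sum,
            smul_add])
      alternating := fun f => by
        change b f f = 0
        have e1 : ∑ k, ∑ l, t k l * D k f * D l f = -∑ k, ∑ l, t k l * D k f * D l f := by
          conv_lhs => rw [Finset.sum_comm]
          rw [← Finset.sum_neg_distrib]
          refine Finset.sum_congr rfl fun k _ => ?_
          rw [← Finset.sum_neg_distrib]
          refine Finset.sum_congr rfl fun l _ => ?_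
          rw [ht l k]; ring
        have e2 : (2 : ℝ) • ∑ k, ∑ l, t k l * D k f * D l f = 0 := by
          rw [two_smul]; nth_rewrite 1 [e1]; exact neg_add_cancel _
        have e3 := (smul_eq_zero_iff_right (two_ne_zero (α := ℝ))).1 e2
        simp only [b, e3, add_zero]
        exact Finset.sum_eq_zero fun k _ => by ring
      leibniz := fun f g h => by
        change b f (g * h) = b f g * h + g * b f h
        simp only [b, Derivation.leibniz, smul_eq_mul]
        rw [add_mul, mul_add, Finset.sum_mul, Finset.sum_mul, Finset.mul_sum, Finset.mul_sum]
        rw [add_add_add_comm]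
        refine congrArg₂ (fun x y : P => x + y) ?_ ?_
        · rw [← Finset.sum_add_distrib]
          exact Finset.sum_congr rfl fun k _ => by ring
        · rw [← Finset.sum_add_distrib]
          refine Finset.sum_congr rfl fun k _ => ?_
          rw [Finset.sum_mul, Finset.mul_sum, ← Finset.sum_add_distrib]
          exact Finset.sum_congr rfl fun l _ => by ring }
  refine ⟨B, ⟨fun x y => ?_, fun x a => ?_, fun a a' => ?_⟩⟩
  · change b (j x) (j y) = _
    have e1 (x y : L) : ∑ k, i (c k x) * j (frameConnection s c (s k) y) =
        j (frameConnection s c x y) := by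
      conv_rhs => rw [← hc x, frameConnection_sum_smul_left, map_sum]
      exact Finset.sum_congr rfl fun k _ => (hj _ _).symm
    have e2 : ∑ k, ∑ l, t k l * i (c k x) * i (c l y) = j (frameTorsion s c x y) := by
      rw [← sum_smul_frameTorsion s c hc x y, map_sum]
      refine Finset.sum_congr rfl fun k _ => ?_
      rw [map_sum]
      refine Finset.sum_congr rfl fun l _ => ?_
      rw [hj, map_mul]; ring
    simp only [b, h2, h4, e2, Finset.sum_sub_distrib, e1]
    simp only [mul_comm (j _), e1, frameTorsion, map_add, map_sub]
    abel
  · change b (j x) (i a) = _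
    simp only [b, h1, h2, h3, mul_zero, sub_zero, Finset.sum_const_zero, add_zero]
    have e1 : ⁅x, a⁆ = ∑ k, c k x * ⁅s k, a⁆ := by
      conv_lhs => rw [← hc x, sum_lie]
      exact Finset.sum_congr rfl fun k _ => LieRinehartRing.lie_smul_eq_mul _ _ _
    rw [e1, map_sum]
    exact Finset.sum_congr rfl fun k _ => (map_mul i _ _).symm
  · change b (i a) (i a') = 0
    simp [b, h1]

end InducedBracket

/-! ### Restriction of the bracket to the symmetric algebra -/

section Transfer

variable {R S P : Type*} [CommRing R] [CommRing S] [Algebra R S] [CommRing P] [Algebra R P]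

/-- A biderivation restricts to a subalgebra which is stable under it. -/
theorem SkewBiderivation.exists_restrict (B : SkewBiderivation R P) (Φ : S →ₐ[R] P)
    (hΦ : Function.Injective Φ) (h : ∀ u v, B.toFun (Φ u) (Φ v) ∈ Φ.range) :
    ∃ T : SkewBiderivation R S, ∀ u v, Φ (T.toFun u v) = B.toFun (Φ u) (Φ v) := by
  choose b hb using h
  replace hb (u v : S) : Φ (b u v) = B.toFun (Φ u) (Φ v) := hb u v
  refine ⟨{ toFun := LinearMap.mk₂ R b
              (fun u u' v => hΦ (by simp only [map_add, hb, LinearMap.add_apply]))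
              (fun r u v => hΦ (by simp only [map_smul, hb, LinearMap.smul_apply]))
              (fun u v v' => hΦ (by simp only [map_add, hb]))
              (fun r u v => hΦ (by simp only [map_smul, hb]))
            alternating := fun u => hΦ ?_
            leibniz := fun u v w => hΦ ?_ }, hb⟩
  · exact (hb u u).trans ((B.alternating _).trans (map_zero Φ).symm)
  · simp only [LinearMap.mk₂_apply, hb, map_mul, map_add, B.leibniz]

variable {A L : Type*} [CommRing A] [Algebra R A] [LieRing L] [LieAlgebra R L] [Module A L]
  [IsScalarTower R A L] [LieRingModule L A] [LieRinehartRing A L]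

/-- Brackets of generators are images of generators, up to sign, or zero; the Leibniz rule
propagates membership to products, one argument at a time. -/
theorem IsInducedBracket.mem_range {B : SkewBiderivation R P} {i : A → P} {j : L → P}
    (hB : IsInducedBracket i j B) (Φ : SymmetricAlgebra A L →ₐ[R] P)
    (h1 : ∀ a, Φ (algebraMap A _ a) = i a) (h2 : ∀ x, Φ (SymmetricAlgebra.ι A L x) = j x)
    (u v : SymmetricAlgebra A L) : B.toFun (Φ u) (Φ v) ∈ Φ.range := by
  have hi (a : A) : i a ∈ Φ.range := ⟨_, h1 a⟩
  have hj (x : L) : j x ∈ Φ.range := ⟨_, h2 x⟩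
  have step {f : P} (ha : ∀ a, B.toFun f (i a) ∈ Φ.range) (hx : ∀ x, B.toFun f (j x) ∈ Φ.range)
      (v : SymmetricAlgebra A L) : B.toFun f (Φ v) ∈ Φ.range := by
    induction v using SymmetricAlgebra.induction with
    | algebraMap a => rw [h1]; exact ha a
    | ι x => rw [h2]; exact hx x
    | mul v w hv hw =>
      rw [map_mul, B.leibniz]
      exact add_mem (mul_mem hv ⟨w, rfl⟩) (mul_mem ⟨v, rfl⟩ hw)
    | add v w hv hw => rw [map_add, map_add]; exact add_mem hv hw
  have hij (x : L) (a : A) : B.toFun (i a) (j x) ∈ Φ.range := by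
    rw [B.skew, hB.lie_base]; exact neg_mem (hi _)
  refine step (fun a => ?_) (fun x => ?_) v
  · rw [B.skew]
    refine neg_mem (step (fun a' => ?_) (fun x => hij x a) u)
    rw [hB.base_base]; exact zero_mem _
  · rw [B.skew]
    refine neg_mem (step (fun a => ?_) (fun y => ?_) u)
    · rw [hB.lie_base]; exact hi _
    · rw [hB.lie_lie]; exact hj _

end Transfer

/-! ### Derivations of the functions on the dual bundle -/

section VectorFieldDerivation

variable {E : Type*} [NormedAddCommGroup E] [NormedSpace ℝ E] {H : Type*} [TopologicalSpace H]
  {I : ModelWithCorners ℝ E H} {M : Type*} [TopologicalSpace M] [ChartedSpace H M]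
  [IsManifold I ∞ M]

/-- The derivation of the algebra of smooth functions defined by a smooth vector field. -/
theorem exists_derivation_of_vectorField (Z : ∀ x : M, TangentSpace I x)
    (hZ : ContMDiff I I.tangent ∞ fun x => (⟨x, Z x⟩ : TangentBundle I M)) :
    ∃ D : Derivation ℝ C^∞⟮I, M; ℝ⟯ C^∞⟮I, M; ℝ⟯, ∀ f x, D f x = mvfderiv I f x (Z x) := by
  have hd (f : C^∞⟮I, M; ℝ⟯) (x : M) : MDifferentiableAt I 𝓘(ℝ, ℝ) f x :=
    f.contMDiff.mdifferentiable (by simp) x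
  let d (f : C^∞⟮I, M; ℝ⟯) : C^∞⟮I, M; ℝ⟯ := ⟨fun x => mvfderiv I f x (Z x), by
    have h1 : ContMDiff I.tangent 𝓘(ℝ, ℝ).tangent ∞ (tangentMap I 𝓘(ℝ, ℝ) f) :=
      f.contMDiff.contMDiff_tangentMap (by simp)
    exact ((contMDiff_snd_tangentBundle_modelSpace ℝ 𝓘(ℝ, ℝ)).comp h1).comp hZ⟩
  refine ⟨Derivation.mk' { toFun := d, map_add' := fun f g => ?_, map_smul' := fun r f => ?_ }
    fun f g => ?_, fun f x => rfl⟩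
  · ext x
    exact congrArg (fun φ => φ (Z x)) (mvfderiv_add (hd f x) (hd g x))
  · ext x
    have h := congrArg (fun φ => φ (Z x))
      (mvfderiv_smul (mdifferentiableAt_const (c := r)) (hd f x))
    rw [mvfderiv_const] at h
    refine h.trans ?_
    rw [add_apply, ContinuousLinearMap.smulRight_apply, zero_apply, zero_smul, add_zero]
    rfl
  · ext x
    exact congrArg (fun φ => φ (Z x)) (mvfderiv_mul (hd f x) (hd g x))

end VectorFieldDerivation

section RetractDerivation

variable {E : Type*} [NormedAddCommGroup E] [NormedSpace ℝ E] {H : Type*} [TopologicalSpace H]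
  {I : ModelWithCorners ℝ E H} {M : Type*} [TopologicalSpace M] [ChartedSpace H M]
  {E' : Type*} [NormedAddCommGroup E'] [NormedSpace ℝ E'] {H' : Type*} [TopologicalSpace H']
  {I' : ModelWithCorners ℝ E' H'} {Q : Type*} [TopologicalSpace Q] [ChartedSpace H' Q]

/-- A derivation of the smooth functions on `Q` induces one on the smooth functions on a retract. -/
theorem exists_retract_derivation (r : C^∞⟮I', Q; I, M⟯) (i : C^∞⟮I, M; I', Q⟯)
    (hri : ∀ x, r (i x) = x) (D : Derivation ℝ C^∞⟮I', Q; ℝ⟯ C^∞⟮I', Q; ℝ⟯) :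
    ∃ D' : Derivation ℝ C^∞⟮I, M; ℝ⟯ C^∞⟮I, M; ℝ⟯, ∀ f x, D' f x = D (f.comp r) (i x) := by
  refine ⟨Derivation.mk'
    { toFun := fun f => (D (f.comp r)).comp i
      map_add' := fun f g => ?_, map_smul' := fun c f => ?_ } fun f g => ?_, fun f x => rfl⟩
  · ext x
    exact congrArg (fun h : C^∞⟮I', Q; ℝ⟯ => h (i x)) (D.map_add (f.comp r) (g.comp r))
  · ext x
    exact congrArg (fun h : C^∞⟮I', Q; ℝ⟯ => h (i x)) (D.map_smul c (f.comp r))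
  · ext x
    have h := congrArg (fun h : C^∞⟮I', Q; ℝ⟯ => h (i x)) (D.leibniz (f.comp r) (g.comp r))
    refine h.trans ?_
    -- Only the Leibniz rule uses that r ∘ i is the identity.
    change f (r (i x)) * _ + g (r (i x)) * _ = _
    rw [hri]
    rfl

end RetractDerivation

section Product

variable {E : Type*} [NormedAddCommGroup E] [NormedSpace ℝ E]
  {N : Type*} [TopologicalSpace N] [ChartedSpace E N] [IsManifold 𝓘(ℝ, E) ∞ N]
  {G : Type*} [NormedAddCommGroup G] [NormedSpace ℝ G]

/-- The derivation of the smooth functions on `N × G` defined by a vector field on `N` and a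
constant vector field on `G`. -/
theorem exists_product_derivation
    (X : Cₛ^∞⟮𝓘(ℝ, E); E, (TangentSpace 𝓘(ℝ, E) : N → Type _)⟯) (e : G) :
    ∃ D : Derivation ℝ C^∞⟮𝓘(ℝ, E).prod 𝓘(ℝ, G), N × G; ℝ⟯ C^∞⟮𝓘(ℝ, E).prod 𝓘(ℝ, G), N × G; ℝ⟯,
      (∀ (f : C^∞⟮𝓘(ℝ, E), N; ℝ⟯) p,
        D (f.comp ⟨Prod.fst, contMDiff_fst⟩) p = derivAlong X f p.1) ∧
      ∀ (η : G →L[ℝ] ℝ) p,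
        D (ContMDiffMap.comp (⟨η, η.contMDiff⟩ : C^∞⟮𝓘(ℝ, G), G; ℝ⟯) ⟨Prod.snd, contMDiff_snd⟩) p =
          η e := by
  obtain ⟨D, hD⟩ := exists_derivation_of_vectorField (I := 𝓘(ℝ, E).prod 𝓘(ℝ, G)) (M := N × G)
    (fun p => (X p.1, (e : TangentSpace 𝓘(ℝ, G) p.2))) (by
      have h1 : ContMDiff (𝓘(ℝ, E).prod 𝓘(ℝ, G)) 𝓘(ℝ, E).tangent ∞
          fun p : N × G => (⟨p.1, X p.1⟩ : TangentBundle 𝓘(ℝ, E) N) :=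
        X.contMDiff.comp contMDiff_fst
      have h2 : ContMDiff (𝓘(ℝ, E).prod 𝓘(ℝ, G)) 𝓘(ℝ, G).tangent ∞
          fun p : N × G => (⟨p.2, e⟩ : TangentBundle 𝓘(ℝ, G) G) := by
        have h3 : ContMDiff 𝓘(ℝ, G) 𝓘(ℝ, G).tangent ∞
            fun y : G => (⟨y, e⟩ : TangentBundle 𝓘(ℝ, G) G) := by
          exact contMDiff_vectorSpace_iff_contDiff.2 contDiff_const
        exact h3.comp contMDiff_snd
      exact (contMDiff_equivTangentBundleProd_symm (I := 𝓘(ℝ, E)) (M := N) (I' := 𝓘(ℝ, G))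
        (M' := G) (n := ∞)).comp (h1.prodMk h2))
  refine ⟨D, fun f p => ?_, fun η p => ?_⟩
  · rw [hD]
    have hf : MDifferentiableAt 𝓘(ℝ, E) 𝓘(ℝ, ℝ) f p.1 := f.contMDiff.mdifferentiable (by simp) _
    refine (mvfderiv_comp_apply (g := f) (f := Prod.fst) p hf mdifferentiableAt_fst _).trans ?_
    rw [mfderiv_fst]
    rfl
  · rw [hD]
    have hη : MDifferentiableAt 𝓘(ℝ, G) 𝓘(ℝ, ℝ) η p.2 := η.mdifferentiableAt
    refine (mvfderiv_comp_apply (g := η) (f := Prod.snd) p hη mdifferentiableAt_snd _).trans ?_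
    rw [mfderiv_snd]
    exact congrArg (fun φ : G →L[ℝ] ℝ => φ e) (η.mfderiv_eq (x := p.2))

end Product

section DualBundle

variable {E : Type*} [NormedAddCommGroup E] [NormedSpace ℝ E] [FiniteDimensional ℝ E]
  {N : Type*} [TopologicalSpace N] [T2Space N] [ChartedSpace E N] [IsManifold 𝓘(ℝ, E) ∞ N]
  {F : Type*} [NormedAddCommGroup F] [NormedSpace ℝ F] [FiniteDimensional ℝ F]
  {V : N → Type*} [TopologicalSpace (Bundle.TotalSpace F V)] [∀ x, TopologicalSpace (V x)]
  [∀ x, AddCommGroup (V x)] [∀ x, Module ℝ (V x)] [FiberBundle F V] [VectorBundle ℝ F V]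
  [ContMDiffVectorBundle ∞ F V 𝓘(ℝ, E)] {J : Type*} [Fintype J]

namespace SpanningFamily

theorem contMDiff_components (𝓢 : SpanningFamily E F V J) :
    ContMDiff (𝓘(ℝ, E).prod 𝓘(ℝ, F →L[ℝ] ℝ)) (𝓘(ℝ, E).prod 𝓘(ℝ, J → ℝ)) ∞ 𝓢.components :=
  (Bundle.contMDiff_proj _).prodMk
    (contMDiff_pi_space.2 fun k => (linearFunction (𝓢.sec k)).contMDiff)

/-- The field (X, e) on N × ℝ^J is pushed to the retract. The formula on ℓ_α comes from ℓ_α ∘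
`covector` = ∑ y_k c_k(α), with y_k the coordinates of ℝ^J. -/
theorem exists_dual_derivation (𝓢 : SpanningFamily E F V J)
    (X : Cₛ^∞⟮𝓘(ℝ, E); E, (TangentSpace 𝓘(ℝ, E) : N → Type _)⟯) (e : J → ℝ) :
    ∃ D : Derivation ℝ (DualFunctions E F V) (DualFunctions E F V),
      (∀ a, D (pullback a) = pullback (derivAlong X a)) ∧
      ∀ α, D (linearFunction α) =
        ∑ k, (linearFunction (𝓢.sec k) * pullback (derivAlong X (𝓢.coeff k α))
          + e k • pullback (𝓢.coeff k α)) := by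
  obtain ⟨D, hD1, hD2⟩ := exists_product_derivation X e
  obtain ⟨D', hD'⟩ := exists_retract_derivation
    (⟨𝓢.covector, 𝓢.contMDiff_covector⟩ : C^∞⟮𝓘(ℝ, E).prod 𝓘(ℝ, J → ℝ), N × (J → ℝ);
      𝓘(ℝ, E).prod 𝓘(ℝ, F →L[ℝ] ℝ), DualBundle F V⟯)
    ⟨𝓢.components, 𝓢.contMDiff_components⟩ 𝓢.covector_components D
  refine ⟨D', fun a => ?_, fun α => ?_⟩
  · ext ξ
    rw [hD']
    exact hD1 a _
  · ext ξ
    rw [hD', contMDiffMap_sum_apply]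
    let y (k : J) : C^∞⟮𝓘(ℝ, E).prod 𝓘(ℝ, J → ℝ), N × (J → ℝ); ℝ⟯ :=
      ContMDiffMap.comp (⟨ContinuousLinearMap.proj (R := ℝ) (φ := fun _ : J => ℝ) k,
        ContinuousLinearMap.contMDiff _⟩ : C^∞⟮𝓘(ℝ, J → ℝ), J → ℝ; ℝ⟯)
        ⟨Prod.snd, contMDiff_snd⟩
    let c (k : J) : C^∞⟮𝓘(ℝ, E).prod 𝓘(ℝ, J → ℝ), N × (J → ℝ); ℝ⟯ :=
      (𝓢.coeff k α).comp ⟨Prod.fst, contMDiff_fst⟩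
    have h1 : ContMDiffMap.comp (linearFunction α) (⟨𝓢.covector, 𝓢.contMDiff_covector⟩ :
        C^∞⟮𝓘(ℝ, E).prod 𝓘(ℝ, J → ℝ), N × (J → ℝ);
          𝓘(ℝ, E).prod 𝓘(ℝ, F →L[ℝ] ℝ), DualBundle F V⟯) = ∑ k, y k * c k := by
      ext p
      rw [contMDiffMap_sum_apply]
      exact 𝓢.linearFunction_covector α p
    have h2 : D (∑ k, y k * c k) = ∑ k, D (y k * c k) := map_sum D.toLinearMap _ _
    rw [h1, h2, contMDiffMap_sum_apply]
    refine Finset.sum_congr rfl fun k _ => ?_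
    rw [D.leibniz]
    change y k (𝓢.components ξ) * D (c k) (𝓢.components ξ) +
      c k (𝓢.components ξ) * D (y k) (𝓢.components ξ) = _
    rw [hD1, hD2, mul_comm (c k _)]
    rfl

end SpanningFamily

section LieAlgebroid

variable [LieAlgebroid E F V]

/-- The vertical derivations come from X = 0 and the unit vectors of ℝ^J, the horizontal ones from
the anchors of the frame and e = 0. -/
theorem exists_dual_bracket (𝓢 : SpanningFamily E F V J) :
    ∃ B : SkewBiderivation ℝ (DualFunctions E F V),
      IsInducedBracket (L := Cₛ^∞⟮𝓘(ℝ, E); F, V⟯) pullback linearFunction B := by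
  classical
  choose D hD1 hD2 using fun k => 𝓢.exists_dual_derivation 0 (Pi.single k 1)
  choose D' hD1' hD2' using fun k => 𝓢.exists_dual_derivation (anchorSection (𝓢.sec k)) 0
  let j : Cₛ^∞⟮𝓘(ℝ, E); F, V⟯ →+ DualFunctions E F V :=
    AddMonoidHom.mk' linearFunction fun s t => by
      ext ξ
      exact map_add ξ.2 (s ξ.proj) (t ξ.proj)
  have hj (a : C^∞⟮𝓘(ℝ, E), N; ℝ⟯) (x : Cₛ^∞⟮𝓘(ℝ, E); F, V⟯) :
      j (a • x) = pullback a * j x := by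
    ext ξ
    exact map_smul ξ.2 (a ξ.proj) (x ξ.proj)
  have h0 (a : C^∞⟮𝓘(ℝ, E), N; ℝ⟯) :
      derivAlong (0 : Cₛ^∞⟮𝓘(ℝ, E); E, (TangentSpace 𝓘(ℝ, E) : N → Type _)⟯) a = 0 := by
    ext x
    exact map_zero (mvfderiv 𝓘(ℝ, E) a x)
  refine exists_isInducedBracket pullback j hj 𝓢.sec 𝓢.coeff 𝓢.sum_coeff_smul D D'
    (fun k a => ?_) (fun k x => ?_) (fun k a => hD1' k a) (fun k x => ?_)
  · rw [hD1, h0, map_zero]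
  · refine (hD2 k x).trans ?_
    simp [h0, Pi.single_apply]
  · refine (hD2' k x).trans ?_
    rw [frameConnection, map_sum]
    refine Finset.sum_congr rfl fun l _ => ?_
    rw [hj, Pi.zero_apply, zero_smul, add_zero, mul_comm]
    rfl

end LieAlgebroid

end DualBundle

end LieAlgd

end

noncomputable section

namespace LieAlgd

open Filter Topology Set Bundle MeasureTheory
open scoped Convolution

/-! ### Weierstrass approximation with all derivatives -/

section Polynomials

variable (G : Type*) [NormedAddCommGroup G] [NormedSpace ℝ G]

/-- The algebra of polynomial functions on a normed space, generated by the linear functionals. -/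
def polynomialFunctions : Subalgebra ℝ C(G, ℝ) :=
  Algebra.adjoin ℝ (Set.range fun η : G →L[ℝ] ℝ => (⟨η, η.continuous⟩ : C(G, ℝ)))

variable {G}

theorem contDiff_of_mem_polynomialFunctions {p : C(G, ℝ)} (hp : p ∈ polynomialFunctions G) :
    ContDiff ℝ ∞ p := by
  refine Algebra.adjoin_induction ?_ ?_ ?_ ?_ hp
  · rintro _ ⟨η, rfl⟩; exact η.contDiff
  · exact fun r => contDiff_const
  · exact fun p q _ _ hp hq => hp.add hq
  · exact fun p q _ _ hp hq => hp.mul hq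

theorem exists_expansion_sub {p : C(G, ℝ)} (hp : p ∈ polynomialFunctions G) :
    ∃ (n : ℕ) (a b : Fin n → C(G, ℝ)), (∀ i, a i ∈ polynomialFunctions G) ∧
      ∀ z w, p (z - w) = ∑ i, a i z * b i w := by
  have key {ι : Type} [Fintype ι] {p : C(G, ℝ)} (a b : ι → C(G, ℝ))
      (ha : ∀ i, a i ∈ polynomialFunctions G) (h : ∀ z w, p (z - w) = ∑ i, a i z * b i w) :
      ∃ (n : ℕ) (a b : Fin n → C(G, ℝ)), (∀ i, a i ∈ polynomialFunctions G) ∧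
      ∀ z w, p (z - w) = ∑ i, a i z * b i w :=
    ⟨_, fun i => a ((Fintype.equivFin ι).symm i), fun i => b ((Fintype.equivFin ι).symm i),
      fun i => ha _, fun z w => (h z w).trans
        ((Fintype.equivFin ι).symm.sum_comp fun i => a i z * b i w).symm⟩
  refine Algebra.adjoin_induction ?_ ?_ ?_ ?_ hp
  · rintro _ ⟨η, rfl⟩
    refine key (ι := Bool) (fun i => if i then 1 else ⟨η, η.continuous⟩)
      (fun i => if i then -⟨η, η.continuous⟩ else 1) (fun i => ?_) fun z w => ?_
    · cases i
      · exact Algebra.subset_adjoin ⟨η, rfl⟩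
      · exact one_mem _
    · simp [sub_eq_add_neg, add_comm]
  · exact fun r => key (ι := Unit) (fun _ => algebraMap ℝ _ r) (fun _ => 1)
      (fun _ => Subalgebra.algebraMap_mem _ r) fun z w => by simp
  · rintro p q _ _ ⟨n, a, b, ha, h⟩ ⟨n', a', b', ha', h'⟩
    refine key (ι := Fin n ⊕ Fin n') (Sum.elim a a') (Sum.elim b b') ?_ fun z w => ?_
    · rintro (i | i)
      · exact ha i
      · exact ha' i
    · rw [ContinuousMap.add_apply, h, h', Fintype.sum_sum_type]; rfl
  · rintro p q _ _ ⟨n, a, b, ha, h⟩ ⟨n', a', b', ha', h'⟩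
    refine key (ι := Fin n × Fin n') (fun i => a i.1 * a' i.2) (fun i => b i.1 * b' i.2)
      (fun i => mul_mem (ha _) (ha' _)) fun z w => ?_
    rw [ContinuousMap.mul_apply, h, h', Fintype.sum_prod_type, Finset.sum_mul_sum]
    refine Finset.sum_congr rfl fun i _ => Finset.sum_congr rfl fun j _ => ?_
    simp only [ContinuousMap.mul_apply]; ring

theorem separatesPoints_polynomialFunctions : (polynomialFunctions G).SeparatesPoints := by
  intro x y hxy
  obtain ⟨η, hη⟩ := SeparatingDual.exists_separating_of_ne (R := ℝ) hxy
  exact ⟨_, ⟨⟨η, η.continuous⟩, Algebra.subset_adjoin ⟨η, rfl⟩, rfl⟩, hη⟩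

variable [FiniteDimensional ℝ G] [MeasurableSpace G] [BorelSpace G] (μ : Measure G)
  [μ.IsAddHaarMeasure]

/-- Normalized bumps form an approximate identity. Stone–Weierstrass replaces the n-th one by a
polynomial, with error 1/(n + 1) on the ball of radius n, so that every compact set is eventually
covered. -/
theorem exists_polynomial_kernel : ∃ (φ : ℕ → ContDiffBump (0 : G)) (q : ℕ → C(G, ℝ)),
    Tendsto (fun n => (φ n).rOut) atTop (𝓝 0) ∧ ∀ n, q n ∈ polynomialFunctions G ∧
      ∀ z ∈ Metric.closedBall (0 : G) n, ‖q n z - (φ n).normed μ z‖ ≤ 1 / ((n : ℝ) + 1) := by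
  have hpos (n : ℕ) : (0 : ℝ) < 1 / ((n : ℝ) + 1) := Nat.one_div_pos_of_nat
  let φ (n : ℕ) : ContDiffBump (0 : G) :=
    ⟨1 / ((n : ℝ) + 1) / 2, 1 / ((n : ℝ) + 1), half_pos (hpos n), half_lt_self (hpos n)⟩
  have h (n : ℕ) :=
    ContinuousMap.exists_mem_subalgebra_near_continuous_of_isCompact_of_separatesPoints
      (separatesPoints_polynomialFunctions (G := G))
      ⟨(φ n).normed μ, (φ n).continuous_normed⟩ (isCompact_closedBall (0 : G) n) (hpos n)
  choose q hq1 hq2 using h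
  exact ⟨φ, q, tendsto_one_div_add_atTop_nhds_zero_nat, fun n => ⟨hq1 n, fun z hz =>
    (hq2 n z hz).le⟩⟩

/-- A polynomial in z − w is a finite sum of products a_i(z) b_i(w), so integration over w leaves a
polynomial in z. -/
theorem convolution_mem_polynomialFunctions {q : C(G, ℝ)} (hq : q ∈ polynomialFunctions G)
    {h : G → ℝ} (hc : HasCompactSupport h) (hh : Continuous h) :
    ∃ p ∈ polynomialFunctions G, ∀ z, p z = (q ⋆[ContinuousLinearMap.lsmul ℝ ℝ, μ] h) z := by
  obtain ⟨n, a, b, ha, hab⟩ := exists_expansion_sub hq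
  refine ⟨∑ i, (∫ w, b i w * h w ∂μ) • a i,
    sum_mem fun i _ => Subalgebra.smul_mem _ (ha i) _, fun z => ?_⟩
  rw [convolution_lsmul_swap]
  have h1 : ∀ w, q (z - w) • h w = ∑ i, a i z * (b i w * h w) := fun w => by
    rw [hab, smul_eq_mul, Finset.sum_mul]
    exact Finset.sum_congr rfl fun i _ => mul_assoc _ _ _
  simp only [h1]
  rw [integral_finsetSum]
  · rw [ContinuousMap.sum_apply]
    refine Finset.sum_congr rfl fun i _ => ?_
    rw [integral_const_mul, mul_comm]
    rfl
  · intro i _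
    refine Integrable.const_mul ?_ _
    exact ((b i).continuous.mul hh).integrable_of_hasCompactSupport hc.mul_left

variable {μ} {φ : ℕ → ContDiffBump (0 : G)} {q : ℕ → C(G, ℝ)}
  (hφ : Tendsto (fun n => (φ n).rOut) atTop (𝓝 0))
  (hq : ∀ n : ℕ, ∀ z ∈ Metric.closedBall (0 : G) n, ‖q n z - (φ n).normed μ z‖ ≤ 1 / ((n : ℝ) + 1))

include hφ hq in
theorem tendsto_kernel_convolution {W : Type*} [NormedAddCommGroup W] [NormedSpace ℝ W]
    [CompleteSpace W] {h : G → W} (hc : HasCompactSupport h) (hh : Continuous h) (y : G) :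
    Tendsto (fun p : ℕ × G => (q p.1 ⋆[ContinuousLinearMap.lsmul ℝ ℝ, μ] h) p.2 - h p.2)
      (atTop ×ˢ 𝓝 y) (𝓝 0) := by
  have h1 : Tendsto (fun p : ℕ × G =>
      ((φ p.1).normed μ ⋆[ContinuousLinearMap.lsmul ℝ ℝ, μ] h) p.2) (atTop ×ˢ 𝓝 y) (𝓝 (h y)) :=
    ContDiffBump.convolution_tendsto_right (φ := fun p : ℕ × G => φ p.1) (g := fun _ => h)
      (k := fun p => p.2) (hφ.comp tendsto_fst)
      (Eventually.of_forall fun _ => hh.aestronglyMeasurable)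
      ((hh.tendsto y).comp tendsto_snd) tendsto_snd
  have h2 := h1.sub ((hh.tendsto y).comp (tendsto_snd (f := (atTop : Filter ℕ))))
  have h3 : Tendsto (fun p : ℕ × G => (q p.1 ⋆[ContinuousLinearMap.lsmul ℝ ℝ, μ] h) p.2 -
      ((φ p.1).normed μ ⋆[ContinuousLinearMap.lsmul ℝ ℝ, μ] h) p.2) (atTop ×ˢ 𝓝 y) (𝓝 0) := by
    have h4 : Tendsto (fun p : ℕ × G => (∫ t, ‖h t‖ ∂μ) * (1 / ((p.1 : ℝ) + 1)))
        (atTop ×ˢ 𝓝 y) (𝓝 ((∫ t, ‖h t‖ ∂μ) * 0)) :=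
      tendsto_const_nhds.mul (tendsto_one_div_add_atTop_nhds_zero_nat.comp tendsto_fst)
    rw [mul_zero] at h4
    obtain ⟨r, hr⟩ := hc.isCompact.isBounded.subset_closedBall (0 : G)
    -- For z within 1 of `y` and t in the support of `h`, the point z − t lies in the ball of radius
    -- `m`, where the kernels are compared as soon as n ≥ m.
    obtain ⟨m, hm⟩ := exists_nat_ge (‖y‖ + 1 + r)
    refine squeeze_zero_norm' ?_ h4
    filter_upwards [prod_mem_prod (Ici_mem_atTop m) (Metric.ball_mem_nhds y zero_lt_one)]
      with p hp
    have hint {g : G → ℝ} (hg : Continuous g) : Integrable (fun t => g (p.2 - t) • h t) μ :=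
      ((hg.comp (continuous_const.sub continuous_id)).smul hh).integrable_of_hasCompactSupport
        hc.smul_left
    rw [convolution_lsmul_swap, convolution_lsmul_swap,
      ← integral_sub (hint (q p.1).continuous) (hint (φ p.1).continuous_normed),
      ← integral_mul_const]
    refine norm_integral_le_of_norm_le
      ((hh.norm.integrable_of_hasCompactSupport hc.norm).mul_const _)
      (Eventually.of_forall fun t => ?_)
    rw [← sub_smul, norm_smul, mul_comm]
    by_cases ht : h t = 0
    · simp [ht]
    · refine mul_le_mul_of_nonneg_left (hq _ _ ?_) (norm_nonneg _)
      have ht' : ‖t‖ ≤ r := by simpa using hr (subset_tsupport _ ht)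
      have hp2 : ‖p.2 - y‖ < 1 := by simpa [dist_eq_norm] using hp.2
      have hp1 : (m : ℝ) ≤ p.1 := by exact_mod_cast hp.1
      have e1 : ‖p.2 - t‖ ≤ ‖p.2‖ + ‖t‖ := norm_sub_le _ _
      have e2 : ‖p.2‖ ≤ ‖p.2 - y‖ + ‖y‖ := by simpa using norm_add_le (p.2 - y) y
      rw [mem_closedBall_zero_iff]
      linarith
  simpa using h3.add h2

/-- The derivative falls on `h`, not on the kernel, whose derivatives are not controlled. Induction
on the order then needs vector-valued `h`, since the derivative takes values in G →L[ℝ] W. -/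
theorem fderiv_kernel_convolution {W : Type*} [NormedAddCommGroup W] [NormedSpace ℝ W]
    [CompleteSpace W] (q : C(G, ℝ)) {h : G → W} (hc : HasCompactSupport h)
    (hh : ContDiff ℝ ∞ h) :
    fderiv ℝ (fun z => (q ⋆[ContinuousLinearMap.lsmul ℝ ℝ, μ] h) z - h z) =
      fun z => (q ⋆[ContinuousLinearMap.lsmul ℝ ℝ, μ] fderiv ℝ h) z - fderiv ℝ h z := by
  ext1 z
  have h1 : (ContinuousLinearMap.lsmul ℝ ℝ : ℝ →L[ℝ] W →L[ℝ] W).precompR G =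
      ContinuousLinearMap.lsmul ℝ ℝ := by
    ext r η
    rfl
  have h2 := hc.hasFDerivAt_convolution_right (ContinuousLinearMap.lsmul ℝ ℝ) (μ := μ)
    q.continuous.locallyIntegrable (hh.of_le (by exact_mod_cast le_top)) z
  rw [h1] at h2
  exact (h2.sub (hh.differentiable (by simp) z).hasFDerivAt).fderiv

include hφ hq in
theorem tendsto_iteratedFDeriv_zero_kernel_convolution {W : Type*} [NormedAddCommGroup W]
    [NormedSpace ℝ W] [CompleteSpace W] {h : G → W} (hc : HasCompactSupport h)
    (hh : ContDiff ℝ ∞ h) (y : G) :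
    Tendsto (fun p : ℕ × G => iteratedFDeriv ℝ 0
      (fun z => (q p.1 ⋆[ContinuousLinearMap.lsmul ℝ ℝ, μ] h) z - h z) p.2)
      (atTop ×ˢ 𝓝 y) (𝓝 0) := by
  rw [tendsto_zero_iff_norm_tendsto_zero]
  simp only [norm_iteratedFDeriv_zero]
  exact tendsto_zero_iff_norm_tendsto_zero.1 (tendsto_kernel_convolution hφ hq hc hh.continuous y)

end Polynomials

section Derivatives

universe u v

variable {G : Type u} [NormedAddCommGroup G] [NormedSpace ℝ G] [FiniteDimensional ℝ G]
  [MeasurableSpace G] [BorelSpace G] {μ : Measure G} [μ.IsAddHaarMeasure]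
  {φ : ℕ → ContDiffBump (0 : G)} {q : ℕ → C(G, ℝ)}
  (hφ : Tendsto (fun n => (φ n).rOut) atTop (𝓝 0))
  (hq : ∀ n : ℕ, ∀ z ∈ Metric.closedBall (0 : G) n,
    ‖q n z - (φ n).normed μ z‖ ≤ 1 / ((n : ℝ) + 1))

theorem tendsto_iteratedFDeriv_succ_kernel_convolution {k : ℕ} {W : Type v}
    [NormedAddCommGroup W] [NormedSpace ℝ W] [CompleteSpace W] {h : G → W}
    (hc : HasCompactSupport h) (hh : ContDiff ℝ ∞ h) {y : G}
    (H : Tendsto (fun p : ℕ × G => iteratedFDeriv ℝ k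
      (fun z => (q p.1 ⋆[ContinuousLinearMap.lsmul ℝ ℝ, μ] fderiv ℝ h) z - fderiv ℝ h z) p.2)
      (atTop ×ˢ 𝓝 y) (𝓝 0)) :
    Tendsto (fun p : ℕ × G => iteratedFDeriv ℝ (k + 1)
      (fun z => (q p.1 ⋆[ContinuousLinearMap.lsmul ℝ ℝ, μ] h) z - h z) p.2)
      (atTop ×ˢ 𝓝 y) (𝓝 0) := by
  rw [tendsto_zero_iff_norm_tendsto_zero] at H ⊢
  refine H.congr fun p => ?_
  rw [← norm_iteratedFDeriv_fderiv, fderiv_kernel_convolution _ hc hh]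

include hφ hq in
theorem tendsto_iteratedFDeriv_kernel_convolution (k : ℕ) {W : Type (max u v)}
    [NormedAddCommGroup W] [NormedSpace ℝ W] [CompleteSpace W] {h : G → W}
    (hc : HasCompactSupport h) (hh : ContDiff ℝ ∞ h) (y : G) :
    Tendsto (fun p : ℕ × G => iteratedFDeriv ℝ k
      (fun z => (q p.1 ⋆[ContinuousLinearMap.lsmul ℝ ℝ, μ] h) z - h z) p.2)
      (atTop ×ˢ 𝓝 y) (𝓝 0) := by
  induction k generalizing W with
  | zero => exact tendsto_iteratedFDeriv_zero_kernel_convolution hφ hq hc hh y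
  | succ k ih =>
    exact tendsto_iteratedFDeriv_succ_kernel_convolution hc hh
      (ih (hc.fderiv ℝ) (hh.fderiv_right (by simp)))

end Derivatives

section Weierstrass

variable {G : Type*} [NormedAddCommGroup G] [NormedSpace ℝ G] [FiniteDimensional ℝ G]

/-- Weierstrass approximation for all derivatives: a smooth function with compact support is a
limit of polynomials, with locally uniform convergence of the derivatives of all orders. -/
theorem exists_polynomial_jet_approximation {h : G → ℝ} (hc : HasCompactSupport h)
    (hh : ContDiff ℝ ∞ h) : ∃ p : ℕ → C(G, ℝ), (∀ n, p n ∈ polynomialFunctions G) ∧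
      ∀ y, JetTendstoZero (fun n z => p n z - h z) atTop y := by
  let _ : MeasurableSpace G := borel G
  have : BorelSpace G := ⟨rfl⟩
  obtain ⟨φ, q, hφ, hq⟩ := exists_polynomial_kernel (G := G) Measure.addHaar
  choose p hp1 hp2 using fun n =>
    convolution_mem_polynomialFunctions (Measure.addHaar) (hq n).1 hc hh.continuous
  refine ⟨p, hp1, fun y k => ?_⟩
  simp only [hp2]
  -- One derivative is taken by hand: ℝ lies in the lowest universe, whereas the induction runs over
  -- spaces in a universe containing that of `G`, such as G →L[ℝ] ℝ.
  cases k with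
  | zero => exact tendsto_iteratedFDeriv_zero_kernel_convolution hφ (fun n => (hq n).2) hc hh y
  | succ k =>
    exact tendsto_iteratedFDeriv_succ_kernel_convolution hc hh
      (tendsto_iteratedFDeriv_kernel_convolution hφ (fun n => (hq n).2) k (hc.fderiv ℝ)
        (hh.fderiv_right (by simp)) y)

end Weierstrass

end LieAlgd

end

noncomputable section

namespace LieAlgd

open Filter Topology Set Bundle

/-! ### Localization of the density statement -/

section Localization

variable {E : Type*} [NormedAddCommGroup E] [NormedSpace ℝ E] [FiniteDimensional ℝ E]
  {H : Type*} [TopologicalSpace H] {I : ModelWithCorners ℝ E H} [I.Boundaryless]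
  {M : Type*} [TopologicalSpace M] [ChartedSpace H M] [IsManifold I ∞ M] [T2Space M]

theorem tendsto_of_jetTendstoZero {ι : Type*} {l : Filter ι} {u : ι → C^∞⟮I, M; ℝ⟯}
    {f : C^∞⟮I, M; ℝ⟯} (h : ∀ (x : M), ∀ y ∈ (extChartAt I x).target,
      JetTendstoZero (fun i => chartRep I x (u i - f)) l y) : Tendsto u l (𝓝 f) :=
  tendsto_sub_nhds_zero_iff.1 (tendsto_zero_iff.2 h)

/-- A closed additive submonoid of the smooth functions contains all functions if it contains those
with small compact support. -/
theorem mem_of_forall_mem_of_tsupport_subset [SigmaCompactSpace M]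
    {C : AddSubmonoid C^∞⟮I, M; ℝ⟯} (hC : IsClosed (C : Set C^∞⟮I, M; ℝ⟯))
    (h : ∀ m : M, ∃ U ∈ 𝓝 m, ∀ f : C^∞⟮I, M; ℝ⟯, HasCompactSupport f → tsupport f ⊆ U → f ∈ C)
    (f : C^∞⟮I, M; ℝ⟯) : f ∈ C := by
  have : LocallyCompactSpace M := Manifold.locallyCompact_of_finiteDimensional I
  choose U hU hUC using h
  have hK (m : M) : ∃ K, IsCompact K ∧ m ∈ interior K ∧ K ⊆ U m := by
    obtain ⟨K, hK, hKU, hKc⟩ := local_compact_nhds (hU m)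
    exact ⟨K, hKc, mem_interior_iff_mem_nhds.2 hK, hKU⟩
  choose K hKc hmK hKU using hK
  obtain ⟨ρ, hρ⟩ := SmoothPartitionOfUnity.exists_isSubordinate I isClosed_univ
    (fun m => interior (K m)) (fun m => isOpen_interior)
    fun m _ => mem_iUnion.2 ⟨m, hmK m⟩
  let g (m : M) : C^∞⟮I, M; ℝ⟯ := ρ m
  have hlim : Tendsto (fun s : Finset M => ∑ m ∈ s, g m * f) atTop (𝓝 f) := by
    refine tendsto_of_jetTendstoZero fun x y hy => ?_
    -- Only finitely many ρ_m are nonzero on `B`; once `s` contains their indices, the partial sum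
    -- equals f on `B` and the difference has zero jets there.
    obtain ⟨B, hB, hBfin⟩ := ρ.locallyFinite ((extChartAt I x).symm y)
    refine JetTendstoZero.zero.congr
      ((continuousAt_extChartAt_symm'' hy).preimage_mem_nhds hB) ?_
    filter_upwards [Ici_mem_atTop hBfin.toFinset] with s hs z hz
    rw [chartRep_apply]
    change 0 = (∑ m ∈ s, g m * f) _ - f _
    rw [contMDiffMap_sum_apply]
    have h1 : ∑ m ∈ s, ρ m ((extChartAt I x).symm z) = 1 := by
      rw [← ρ.sum_eq_one (mem_univ ((extChartAt I x).symm z))]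
      refine (finsum_eq_sum_of_support_subset _ fun m hm => hs ?_).symm
      exact hBfin.mem_toFinset.2 ⟨_, hm, hz⟩
    have h2 : ∑ m ∈ s, (g m * f) ((extChartAt I x).symm z) =
        (∑ m ∈ s, ρ m ((extChartAt I x).symm z)) * f ((extChartAt I x).symm z) := by
      rw [Finset.sum_mul]; rfl
    rw [h2, h1, one_mul, sub_self]
  refine hC.mem_of_tendsto hlim (Eventually.of_forall fun s => sum_mem fun m _ => hUC m _ ?_ ?_)
  · exact HasCompactSupport.mul_right
      (HasCompactSupport.of_support_subset_isCompact (hKc m) ((subset_tsupport _).trans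
        ((hρ m).trans interior_subset)))
  · exact (tsupport_mul_subset_left).trans ((hρ m).trans (interior_subset.trans (hKU m)))

/-- A smooth function with compact support in a chart extends by zero in the chart. -/
theorem exists_contDiff_extension {m₀ : M} {f : C^∞⟮I, M; ℝ⟯} (hf : HasCompactSupport f)
    (hs : tsupport f ⊆ (extChartAt I m₀).source) :
    ∃ h : E → ℝ, ContDiff ℝ ∞ h ∧ HasCompactSupport h ∧
      ∀ m ∈ (extChartAt I m₀).source, h (extChartAt I m₀ m) = f m := by
  classical
  let K := extChartAt I m₀ '' tsupport f
  have hKc : IsCompact K := hf.isCompact.image_of_continuousOn ((continuousOn_extChartAt m₀).mono hs)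
  let h := (extChartAt I m₀).target.indicator (chartRep I m₀ f)
  have hzero (z : E) (hz : z ∉ K) : h z = 0 := by
    refine indicator_apply_eq_zero.2 fun hzt => ?_
    by_contra hne
    exact hz ⟨_, subset_tsupport _ hne, (extChartAt I m₀).right_inv hzt⟩
  refine ⟨h, contDiff_iff_contDiffAt.2 fun z => ?_, HasCompactSupport.intro hKc hzero,
    fun m hm => ?_⟩
  · by_cases hz : z ∈ K
    · obtain ⟨m, hm, rfl⟩ := hz
      have ht : (extChartAt I m₀).target ∈ 𝓝 (extChartAt I m₀ m) :=
        (isOpen_extChartAt_target m₀).mem_nhds ((extChartAt I m₀).map_source (hs hm))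
      refine ((contDiffOn_chartRep m₀ f).contDiffAt ht).congr_of_eventuallyEq ?_
      filter_upwards [ht] with z hz
      exact indicator_of_mem hz _
    · refine contDiffAt_const (c := (0 : ℝ)) |>.congr_of_eventuallyEq ?_
      filter_upwards [hKc.isClosed.isOpen_compl.mem_nhds hz] with z hz
      exact hzero z hz
  · refine (indicator_of_mem ((extChartAt I m₀).map_source hm) _).trans ?_
    rw [chartRep_apply, (extChartAt I m₀).left_inv hm]

theorem contDiffOn_extChartAt_comp_symm (x m₀ : M) {T : Set E} (hT : T ⊆ (extChartAt I x).target)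
    (hm : MapsTo (extChartAt I x).symm T (extChartAt I m₀).source) :
    ContDiffOn ℝ ∞ (extChartAt I m₀ ∘ (extChartAt I x).symm) T :=
  (contMDiffOn_extChartAt.comp ((contMDiffOn_extChartAt_symm x).mono hT)
    (fun z hz => by simpa using hm hz)).contDiffOn

end Localization

/-! ### Density of the fibrewise polynomial functions -/

section DualBundle

variable {E : Type*} [NormedAddCommGroup E] [NormedSpace ℝ E] [FiniteDimensional ℝ E]
  {N : Type*} [TopologicalSpace N] [T2Space N] [SigmaCompactSpace N] [ChartedSpace E N]
  [IsManifold 𝓘(ℝ, E) ∞ N]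
  {F : Type*} [NormedAddCommGroup F] [NormedSpace ℝ F] [FiniteDimensional ℝ F]
  {V : N → Type*} [TopologicalSpace (Bundle.TotalSpace F V)] [∀ x, TopologicalSpace (V x)]
  [∀ x, AddCommGroup (V x)] [∀ x, Module ℝ (V x)] [FiberBundle F V] [VectorBundle ℝ F V]
  [ContMDiffVectorBundle ∞ F V 𝓘(ℝ, E)]

theorem exists_mem_range_eq_polynomial {m₀ : DualBundle F V} {O : Set N}
    (hO : ∀ θ : E × (F →L[ℝ] ℝ) →L[ℝ] ℝ, ∃ (a : C^∞⟮𝓘(ℝ, E), N; ℝ⟯)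
      (s : Cₛ^∞⟮𝓘(ℝ, E); F, V⟯), ∀ m : DualBundle F V, m.proj ∈ O →
        θ (extChartAt (𝓘(ℝ, E).prod 𝓘(ℝ, F →L[ℝ] ℝ)) m₀ m) =
          (pullback a + linearFunction s : DualFunctions E F V) m)
    {p : C(E × (F →L[ℝ] ℝ), ℝ)} (hp : p ∈ polynomialFunctions (E × (F →L[ℝ] ℝ))) :
    ∃ u, ∀ m : DualBundle F V, m.proj ∈ O →
      symToFunctions E F V u m = p (extChartAt (𝓘(ℝ, E).prod 𝓘(ℝ, F →L[ℝ] ℝ)) m₀ m) := by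
  refine Algebra.adjoin_induction ?_ ?_ ?_ ?_ hp
  · rintro _ ⟨θ, rfl⟩
    obtain ⟨a, s, h⟩ := hO θ
    refine ⟨algebraMap _ _ a + SymmetricAlgebra.ι _ _ s, fun m hm => ?_⟩
    rw [map_add, symToFunctions_algebraMap, symToFunctions_ι]
    exact (h m hm).symm
  · intro r
    refine ⟨algebraMap ℝ _ r, fun m _ => ?_⟩
    rw [AlgHom.commutes]
    rfl
  · rintro p q _ _ ⟨u, hu⟩ ⟨v, hv⟩
    refine ⟨u + v, fun m hm => ?_⟩
    rw [map_add]
    exact congrArg₂ (· + ·) (hu m hm) (hv m hm)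
  · rintro p q _ _ ⟨u, hu⟩ ⟨v, hv⟩
    refine ⟨u * v, fun m hm => ?_⟩
    rw [map_mul]
    exact congrArg₂ (· * ·) (hu m hm) (hv m hm)

theorem denseRange_symToFunctions : DenseRange (symToFunctions E F V) := by
  have : T2Space (DualBundle F V) := t2Space_totalSpace _ _
  have : LocallyCompactSpace N := Manifold.locallyCompact_of_finiteDimensional 𝓘(ℝ, E)
  have : SigmaCompactSpace (DualBundle F V) := sigmaCompactSpace_totalSpace _ _
  let J := 𝓘(ℝ, E).prod 𝓘(ℝ, F →L[ℝ] ℝ)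
  let C : AddSubmonoid (DualFunctions E F V) :=
    (AddMonoidHom.mrange (symToFunctions E F V)).topologicalClosure
  refine fun f => mem_of_forall_mem_of_tsupport_subset (C := C)
    (AddSubmonoid.isClosed_topologicalClosure _) (fun m₀ => ?_) f
  obtain ⟨O, hOo, hm₀, hOs, hθ⟩ := exists_dual_coordinates E m₀
  -- The cut-off depends on the base point only, so multiplication by its pullback keeps the
  -- approximants in the range. It equals 1 on the support of the functions to be approximated.
  obtain ⟨χ, hχ1, hχO⟩ := exists_smooth_bump (I := 𝓘(ℝ, E)) (hOo.mem_nhds hm₀)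
  have hproj : Continuous fun m : DualBundle F V => m.proj := FiberBundle.continuous_proj _ _
  refine ⟨{m | χ m.proj = 1 ∧ m.proj ∈ O}, hproj.continuousAt.preimage_mem_nhds
    (hχ1.and (hOo.mem_nhds hm₀)), fun f hfc hfs => ?_⟩
  have hχf (m : DualBundle F V) : χ m.proj * f m = f m := by
    by_cases hm : f m = 0
    · rw [hm, mul_zero]
    · rw [(hfs (subset_tsupport _ hm)).1, one_mul]
  obtain ⟨h, hh, hhc, hhf⟩ := exists_contDiff_extension hfc fun m hm => hOs m (hfs hm).2
  obtain ⟨p, hp, hlim⟩ := exists_polynomial_jet_approximation hhc hh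
  choose u hu using fun n => exists_mem_range_eq_polynomial hθ (hp n)
  have hw (n : ℕ) (m : DualBundle F V) (hm : m.proj ∈ O) :
      (symToFunctions E F V (algebraMap _ _ χ * u n) - f) m =
        χ m.proj * (p n (extChartAt J m₀ m) - h (extChartAt J m₀ m)) := by
    rw [map_mul, symToFunctions_algebraMap]
    change χ m.proj * symToFunctions E F V (u n) m - f m = _
    rw [hu n m hm, hhf m (hOs m hm), mul_sub, hχf]
  refine mem_closure_of_tendsto (f := fun n => symToFunctions E F V (algebraMap _ _ χ * u n))
    (b := atTop) (tendsto_of_jetTendstoZero fun x y hy => ?_)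
    (Eventually.of_forall fun n => ⟨_, rfl⟩)
  -- Over `O` the error is χ · (p_n − h) in the coordinates of `m₀`, controlled through the change
  -- of charts. Away from `O` the cut-off vanishes nearby, and the error is zero.
  by_cases hyO : ((extChartAt J x).symm y).proj ∈ O
  · let T := (extChartAt J x).target ∩ (extChartAt J x).symm ⁻¹' (TotalSpace.proj ⁻¹' O)
    have hTo : IsOpen T := (continuousOn_extChartAt_symm x).isOpen_inter_preimage
      (isOpen_extChartAt_target x) (hOo.preimage hproj)
    have hyT : y ∈ T := ⟨hy, hyO⟩
    have hsm (n : ℕ) : ContDiff ℝ ∞ fun z => p n z - h z :=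
      (contDiff_of_mem_polynomialFunctions (hp n)).sub hh
    have hτ : ContDiffOn ℝ ∞ (extChartAt J m₀ ∘ (extChartAt J x).symm) T :=
      contDiffOn_extChartAt_comp_symm x m₀ inter_subset_left fun z hz => hOs _ hz.2
    have h1 := (hlim ((extChartAt J m₀ ∘ (extChartAt J x).symm) y)).comp hTo hyT isOpen_univ hτ
      (mapsTo_univ _ _) fun n => (hsm n).contDiffOn
    have h2 := h1.mul hTo hyT (fun n => (hsm n).comp_contDiffOn hτ)
      ((contDiffOn_chartRep x (pullback χ : DualFunctions E F V)).mono inter_subset_left)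
    refine h2.congr (hTo.mem_nhds hyT) (Eventually.of_forall fun n z hz => ?_)
    exact (hw n _ hz.2).symm
  · have hT : (extChartAt J x).symm ⁻¹' (TotalSpace.proj ⁻¹' (tsupport χ)ᶜ) ∈ 𝓝 y :=
      (continuousAt_extChartAt_symm'' hy).preimage_mem_nhds (hproj.continuousAt.preimage_mem_nhds
        ((isClosed_tsupport χ).isOpen_compl.mem_nhds fun hmem => hyO (hχO hmem)))
    refine JetTendstoZero.zero.congr hT (Eventually.of_forall fun n z hz => ?_)
    have hz0 : χ ((extChartAt J x).symm z).proj = 0 := image_eq_zero_of_notMem_tsupport hz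
    rw [chartRep_apply, map_mul, symToFunctions_algebraMap]
    change 0 = χ ((extChartAt J x).symm z).proj * _ - f _
    rw [← hχf, hz0, zero_mul, zero_mul, sub_zero]

end DualBundle

/-! ### Uniqueness by generators and by density -/

theorem symmetricAlgebra_derivation_eq_zero {R A L : Type*} [CommRing R] [CommRing A] [Algebra R A]
    [AddCommGroup L] [Module R L] [Module A L] [IsScalarTower R A L]
    (D : Derivation R (SymmetricAlgebra A L) (SymmetricAlgebra A L))
    (h1 : ∀ a, D (algebraMap A _ a) = 0) (h2 : ∀ x, D (SymmetricAlgebra.ι A L x) = 0) : D = 0 := by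
  ext u
  induction u using SymmetricAlgebra.induction with
  | algebraMap a => exact h1 a
  | ι x => exact h2 x
  | mul u v hu hv =>
    rw [Derivation.zero_apply] at hu hv
    rw [D.leibniz, hu, hv, smul_zero, smul_zero, add_zero, Derivation.zero_apply]
  | add u v hu hv => rw [map_add, map_add, hu, hv]

section DualBundle

variable {E : Type*} [NormedAddCommGroup E] [NormedSpace ℝ E]
  {N : Type*} [TopologicalSpace N] [ChartedSpace E N]
  {F : Type*} [NormedAddCommGroup F] [NormedSpace ℝ F]
  {V : N → Type*} [TopologicalSpace (Bundle.TotalSpace F V)] [∀ x, TopologicalSpace (V x)]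
  [∀ x, AddCommGroup (V x)] [∀ x, Module ℝ (V x)] [FiberBundle F V] [VectorBundle ℝ F V]
  [ContMDiffVectorBundle ∞ F V 𝓘(ℝ, E)]

variable (E F V) in
/-- `linearFunction` as an additive map. -/
def linearFunctionHom : Cₛ^∞⟮𝓘(ℝ, E); F, V⟯ →+ DualFunctions E F V :=
  AddMonoidHom.mk' linearFunction fun s t => by
    ext ξ
    exact map_add ξ.2 (s ξ.proj) (t ξ.proj)

variable [FiniteDimensional ℝ E] [IsManifold 𝓘(ℝ, E) ∞ N] [LieAlgebroid E F V]

theorem exists_isConnection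
    {σ : Cₛ^∞⟮𝓘(ℝ, E); E, (TangentSpace 𝓘(ℝ, E) : N → Type _)⟯ →ₗ[C^∞⟮𝓘(ℝ, E), N; ℝ⟯]
      Cₛ^∞⟮𝓘(ℝ, E); F, V⟯} (hσ : ∀ X, anchorHom E F V (σ X) = X) :
    ∃ σ, IsConnection (anchorHom E F V) σ :=
  ⟨{ toFun := fun X => σ X
     map_add' := fun X Y => map_add σ (X : Cₛ^∞⟮𝓘(ℝ, E); E, (TangentSpace 𝓘(ℝ, E) : N → Type _)⟯) Y
     map_smul' := fun f X =>
      map_smul σ f (X : Cₛ^∞⟮𝓘(ℝ, E); E, (TangentSpace 𝓘(ℝ, E) : N → Type _)⟯) },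
    fun X => hσ X⟩

end DualBundle

section Uniqueness

/-- Density is applied in one variable at a time, so separate continuity is enough. -/
theorem bilinear_ext_of_denseRange {S P : Type*} [AddCommGroup P] [Module ℝ P] [TopologicalSpace P]
    [T2Space P] {Φ : S → P} (hΦ : DenseRange Φ) {B B' : P →ₗ[ℝ] P →ₗ[ℝ] P}
    (h1 : ∀ f, Continuous (B f)) (h2 : ∀ g, Continuous fun f => B f g)
    (h1' : ∀ f, Continuous (B' f)) (h2' : ∀ g, Continuous fun f => B' f g)
    (h : ∀ u v, B (Φ u) (Φ v) = B' (Φ u) (Φ v)) : B = B' := by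
  have h3 (u : S) (g : P) : B (Φ u) g = B' (Φ u) g :=
    congrFun (hΦ.equalizer (h1 _) (h1' _) (funext fun v => h u v)) g
  refine LinearMap.ext fun f => LinearMap.ext fun g => ?_
  exact congrFun (hΦ.equalizer (h2 g) (h2' g) (funext fun u => h3 u g)) f

end Uniqueness

end LieAlgd

end

/-! ### The main theorem -/

open LieAlgd in
theorem mainTheorem6
    {E : Type*} [NormedAddCommGroup E] [NormedSpace ℝ E] [FiniteDimensional ℝ E]
    {N : Type*} [TopologicalSpace N] [T2Space N] [SigmaCompactSpace N]
    [ChartedSpace E N] [IsManifold 𝓘(ℝ, E) ∞ N]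
    {F : Type*} [NormedAddCommGroup F] [NormedSpace ℝ F] [FiniteDimensional ℝ F]
    {V : N → Type*} [TopologicalSpace (Bundle.TotalSpace F V)] [∀ x, TopologicalSpace (V x)]
    [∀ x, AddCommGroup (V x)] [∀ x, Module ℝ (V x)] [FiberBundle F V] [VectorBundle ℝ F V]
    [ContMDiffVectorBundle ∞ F V 𝓘(ℝ, E)] [LieAlgebroid E F V]
    (transitive : ∀ x : N, Function.Surjective (anchorAt E F V x)) :
    -- the image of the sections under the anchor consists of all vector fields
    (∀ X : Cₛ^∞⟮𝓘(ℝ, E); E, (TangentSpace 𝓘(ℝ, E) : N → Type _)⟯,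
      X ∈ range (anchorHom E F V)) ∧
    -- the extension splits
    (∃ σ, IsConnection (anchorHom E F V) σ) ∧
    -- the symmetric algebra is the algebra of fibrewise polynomial functions, and it is dense
    Function.Injective (symToFunctions E F V) ∧
    (∀ f, f ∈ (symToFunctions E F V).range ↔ IsFibrewisePolynomial f) ∧
    DenseRange (symToFunctions E F V) ∧
    ∃ (T : PoissonBracket ℝ (SymmetricAlgebra C^∞⟮𝓘(ℝ, E), N; ℝ⟯ Cₛ^∞⟮𝓘(ℝ, E); F, V⟯))
      (P : PoissonBracket ℝ (DualFunctions E F V)),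
      -- `T` is the tautological Poisson structure, `P` is the Poisson structure of the dual bundle
      (∀ B, IsInducedBracket (L := Cₛ^∞⟮𝓘(ℝ, E); F, V⟯)
        (algebraMap C^∞⟮𝓘(ℝ, E), N; ℝ⟯ _) (SymmetricAlgebra.ι _ _) B ↔
          B = T.toSkewBiderivation) ∧
      (∀ B, IsInducedBracket (L := Cₛ^∞⟮𝓘(ℝ, E); F, V⟯) pullback linearFunction B ↔
        B = P.toSkewBiderivation) ∧
      -- every connection has a unique curvature, and the identities in terms of the extension
      -- characterize both Poisson structures
      (∀ σ, IsConnection (anchorHom E F V) σ →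
        (∃! Ω, IsCurvature (anchorHom E F V) σ Ω) ∧
        ∀ Ω, IsCurvature (anchorHom E F V) σ Ω →
          (∀ B, IsBracketOfExtension (anchorHom E F V) σ Ω
            (algebraMap C^∞⟮𝓘(ℝ, E), N; ℝ⟯ _) (SymmetricAlgebra.ι _ _) B ↔
              B = T.toSkewBiderivation) ∧
          (∀ B, IsBracketOfExtension (anchorHom E F V) σ Ω pullback linearFunction B ↔
            B = P.toSkewBiderivation)) ∧
      -- the embedding is compatible with the Poisson structures, and `P` is the only separately
      -- continuous extension of `T`
      (∀ u v, symToFunctions E F V (T.toFun u v) =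
        P.toFun (symToFunctions E F V u) (symToFunctions E F V v)) ∧
      (∀ f, Continuous (P.toFun f)) ∧
      (∀ B : DualFunctions E F V →ₗ[ℝ] DualFunctions E F V →ₗ[ℝ] DualFunctions E F V,
        (∀ f, Continuous (B f)) → (∀ g, Continuous fun f => B f g) →
        (∀ u v, B (symToFunctions E F V u) (symToFunctions E F V v) =
          symToFunctions E F V (T.toFun u v)) → B = P.toFun) := by
  obtain ⟨n, s, hs⟩ := exists_finite_spanning E F V
  obtain ⟨𝓢, -⟩ := exists_spanningFamily s hs
  obtain ⟨σ₀, hσ₀⟩ := exists_anchor_section 𝓢 transitive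
  have : T2Space (DualBundle F V) := t2Space_totalSpace _ _
  -- the two Poisson brackets
  have hGP (D : Derivation ℝ (DualFunctions E F V) (DualFunctions E F V))
      (h1 : ∀ a, D ((pullback (E := E) (F := F) (V := V)).toRingHom.toAddMonoidHom a) = 0)
      (h2 : ∀ x, D (linearFunctionHom E F V x) = 0) : D = 0 := dual_derivation_eq_zero D h1 h2
  have hGT := symmetricAlgebra_derivation_eq_zero (R := ℝ) (A := C^∞⟮𝓘(ℝ, E), N; ℝ⟯)
    (L := Cₛ^∞⟮𝓘(ℝ, E); F, V⟯)
  let iT : C^∞⟮𝓘(ℝ, E), N; ℝ⟯ →+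
    SymmetricAlgebra C^∞⟮𝓘(ℝ, E), N; ℝ⟯ Cₛ^∞⟮𝓘(ℝ, E); F, V⟯ := (algebraMap _ _).toAddMonoidHom
  let jT : Cₛ^∞⟮𝓘(ℝ, E); F, V⟯ →+
    SymmetricAlgebra C^∞⟮𝓘(ℝ, E), N; ℝ⟯ Cₛ^∞⟮𝓘(ℝ, E); F, V⟯ :=
      (SymmetricAlgebra.ι _ _).toAddMonoidHom
  let iP : C^∞⟮𝓘(ℝ, E), N; ℝ⟯ →+ DualFunctions E F V :=
    (pullback (E := E) (F := F) (V := V)).toRingHom.toAddMonoidHom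
  let jP := linearFunctionHom E F V
  have hΦ := 𝓢.symToFunctions_injective
  have hdense : DenseRange (symToFunctions E F V) := denseRange_symToFunctions
  obtain ⟨P, hP⟩ := exists_dual_bracket 𝓢
  -- The tautological bracket is obtained by restriction from the dual bundle, so compatibility with
  -- Φ holds by construction.
  obtain ⟨T, hT⟩ := P.exists_restrict (symToFunctions E F V) hΦ
    (hP.mem_range _ symToFunctions_algebraMap symToFunctions_ι)
  have hTi : IsInducedBracket (L := Cₛ^∞⟮𝓘(ℝ, E); F, V⟯) iT jT T := by
    refine ⟨fun x y => hΦ ?_, fun x a => hΦ ?_, fun a b => hΦ ?_⟩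
    · refine (hT _ _).trans ?_
      exact (congrArg₂ (fun f g => P.toFun f g) (symToFunctions_ι x) (symToFunctions_ι y)).trans
        ((hP.lie_lie x y).trans (symToFunctions_ι _).symm)
    · refine (hT _ _).trans ?_
      exact (congrArg₂ (fun f g => P.toFun f g) (symToFunctions_ι x)
        (symToFunctions_algebraMap a)).trans
        ((hP.lie_base x a).trans (symToFunctions_algebraMap _).symm)
    · refine (hT _ _).trans ?_
      exact (congrArg₂ (fun f g => P.toFun f g) (symToFunctions_algebraMap a)
        (symToFunctions_algebraMap b)).trans ((hP.base_base a b).trans (map_zero _).symm)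
  have hTiff (B) : IsInducedBracket (L := Cₛ^∞⟮𝓘(ℝ, E); F, V⟯) iT jT B ↔ B = T :=
    ⟨fun h => h.unique iT jT hGT hTi, fun h => h ▸ hTi⟩
  have hPiff (B) : IsInducedBracket (L := Cₛ^∞⟮𝓘(ℝ, E); F, V⟯) iP jP B ↔ B = P :=
    ⟨fun h => h.unique iP jP hGP hP, fun h => h ▸ hP⟩
  -- Bracketing with a fixed function is a derivation, hence continuous; continuity in the other
  -- variable follows by skew-symmetry.
  have hcont (f : DualFunctions E F V) : Continuous (P.toFun f) :=
    continuous_derivation (P.derivation f)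
  refine ⟨fun X => ⟨σ₀ X, hσ₀ X⟩, exists_isConnection hσ₀, hΦ, 𝓢.mem_range_iff, hdense,
    ⟨T, hTi.jacobi iT jT hGT⟩, ⟨P, hP.jacobi iP jP hGP⟩, hTiff, hPiff, fun σ hσ =>
      ⟨existsUnique_curvature _ σ hσ, fun Ω hΩ => ⟨fun B => ?_, fun B => ?_⟩⟩, hT, hcont,
    fun B hB1 hB2 hB => ?_⟩
  · exact (isBracketOfExtension_iff _ σ hσ Ω hΩ iT jT B).trans (hTiff B)
  · exact (isBracketOfExtension_iff _ σ hσ Ω hΩ iP jP B).trans (hPiff B)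
  · refine bilinear_ext_of_denseRange hdense hB1 hB2 hcont (fun g => ?_) fun u v => ?_
    · have h1 : (fun f => P.toFun f g) = fun f => -P.toFun g f := funext fun f => P.skew f g
      exact h1 ▸ (hcont g).neg
    · exact (hB u v).trans (hT u v)
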